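/- Let $\Omega=(0,1)^2$ and let $\mathcal T_h$ be the partition of $\Omega$ into the rectangles $T_{ij}=[x_{i-1},x_i]\times[y_{j-1},y_j]$, $1\le i\le n$, $1\le j\le m$, where $0=x_0<x_1<\dots<x_n=1$ and $0=y_0<y_1<\dots<y_m=1$ are arbitrary (nonuniform) partitions; let $h=\max_T \operatorname{diam}T$ be the mesh size. Let $a=\operatorname{diag}(a_{11},a_{22})$ be constant on each $T\in\mathcal T_h$ with $0<\lambda\le a_{11},a_{22}\le\Lambda$, let $f\in L^2(\Omega)$, and let $u\in H^3(\Omega)$ be a weak solution of $-\nabla\cdot(a\nabla u)=f$ in $\Omega$, $u=g$ on $\partial\Omega$ (in the sense of traces). Let $g_{yy}$ and $g_{xx}$ denote the weak second tangential derivatives of $g$ in $L^2$ of the vertical and of the horizontal sides of $\Omega$. Let $V_h$ be the space of $v=\{v_0,v_b\}$ with $v_0|_T$ a polynomial of degree at most $1$ for each $T\in\mathcal T_h$ and $v_b$ a single constant on each edge of $\mathcal T_h$, and $V_h^0=\{v\in V_h: v_b|_{\partial\Omega}=0\}$. Let $Q_b$ be the $L^2$ projection onto constants on each edge, $\mathbb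 Q_h$ the $L^2$ projection onto constant vectors on each $T$, and let $\nabla_d v|_T=|T|^{-1}\int_{\partial T}v_b\,\mathbf n\,ds$ be the discrete weak gradient (it depends only on $v_b$; write $\nabla_d v_b$). For a fixed $\rho>0$ let $u_h=\{u_0,u_b\}\in V_h$ satisfy $$\sum_T (a\nabla_d u_h,\nabla_d v)_T+\rho h^{-1}\sum_T\langle u_b-Q_bu_0,\,v_b-Q_bv_0\rangle_{\partial T}=(f,v_0)\qquad\forall v\in V_h^0,$$ with the boundary values $$u_b=Q_b g+\tfrac1{12}h_y\,(h_y-6\rho^{-1}a_{22}h)\,Q_b(g_{yy})\ \text{ on vertical boundary edges},$$ $$u_b=Q_b g+\tfrac1{12}h_x\,(h_x-6\rho^{-1}a_{11}h)\,Q_b(g_{xx})\ \text{ on horizontal boundary edges},$$ where $h_y$, respectively $h_x$, is the length of the edge and the coefficient is taken on the element that contains the edge. Assume that $a_{22}Q_b(u_{yy})$ has the same value from both sides of each interior vertical edge and that $a_{11}Q_b(u_{xx})$ has the same value from both sides of each interior horizontal edge (which is automatic if $a$ is constant on $\Omega$). Then $$\Big(\sum_{T\in\mathcal T_h}\|\mathbb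 Q_h\nabla u-\nabla_d u_b\|_T^2\Big)^{1/2}\le C h^2\|u\|_3,$$ where $\|u\|_3$ is the norm of $H^3(\Omega)$ and $C$ depends only on $\rho$, $\lambda$ and $\Lambda$. -/

import Mathlib

open MeasureTheory Set Filter Topology
open scoped ContDiff

namespace WG

noncomputable section

/-! ### Sobolev functions on the unit square -/

/-- The domain `Ω = (0,1)²`. -/
def Omega : Set (ℝ × ℝ) := Ioo 0 1 ×ˢ Ioo 0 1

/-- Lebesgue measure on `Ω`. -/
def muOmega : Measure (ℝ × ℝ) := volume.restrict Omega

/-- Classical partial derivative in `x`. -/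
def dx (φ : ℝ × ℝ → ℝ) (p : ℝ × ℝ) : ℝ := fderiv ℝ φ p (1, 0)

/-- Classical partial derivative in `y`. -/
def dy (φ : ℝ × ℝ → ℝ) (p : ℝ × ℝ) : ℝ := fderiv ℝ φ p (0, 1)

/-- `φ ∈ C_c^∞(Ω)`. -/
def IsTest (φ : ℝ × ℝ → ℝ) : Prop :=
  ContDiff ℝ ∞ φ ∧ HasCompactSupport φ ∧ tsupport φ ⊆ Omega

/-- `v ∈ L²(Ω)` is the weak derivative `∂_x^i ∂_y^j u` on `Ω`. -/
def IsWeakDeriv (i j : ℕ) (u v : ℝ × ℝ → ℝ) : Prop :=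
  MemLp v 2 muOmega ∧ ∀ φ, IsTest φ →
    ∫ p in Omega, u p * (dx^[i] (dy^[j] φ)) p = (-1) ^ (i + j) * ∫ p in Omega, v p * φ p

/-- `u ∈ H^k(Ω)`. -/
def MemSobolev (k : ℕ) (u : ℝ × ℝ → ℝ) : Prop :=
  MemLp u 2 muOmega ∧ ∀ i j, i + j ≤ k → ∃ v, IsWeakDeriv i j u v

open Classical in
/-- The weak derivative `∂_x^i ∂_y^j u` in `L²(Ω)`, if there is one
(it is unique up to null sets for `u ∈ L²(Ω)`), and `0` otherwise. -/
def weakDeriv (i j : ℕ) (u : ℝ × ℝ → ℝ) : ℝ × ℝ → ℝ :=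
  if h : ∃ v, IsWeakDeriv i j u v then h.choose else 0

/-- The norm `‖u‖_k` of `H^k(Ω)`. -/
def sobolevNorm (k : ℕ) (u : ℝ × ℝ → ℝ) : ℝ :=
  Real.sqrt (∑ i ∈ Finset.range (k + 1), ∑ j ∈ Finset.range (k + 1 - i),
    ∫ p in Omega, (weakDeriv i j u p) ^ 2)

/-- The functions `φ k`, smooth on the closed square, converge to `v` in `H¹(Ω)`. -/
def TendstoH1 (φ : ℕ → ℝ × ℝ → ℝ) (v : ℝ × ℝ → ℝ) : Prop :=
  (∀ k, ContDiff ℝ ∞ (φ k)) ∧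
  Tendsto (fun k => eLpNorm (φ k - v) 2 muOmega) atTop (𝓝 0) ∧
  Tendsto (fun k => eLpNorm (dx (φ k) - weakDeriv 1 0 v) 2 muOmega) atTop (𝓝 0) ∧
  Tendsto (fun k => eLpNorm (dy (φ k) - weakDeriv 0 1 v) 2 muOmega) atTop (𝓝 0)

/-- `τ ∈ L²(0,1)` is the trace of `v ∈ H¹(Ω)` on the vertical segment `{c} × (0,1)`, `0 ≤ c ≤ 1`:
the limit of the restrictions of smooth functions that converge to `v` in `H¹(Ω)`. -/
def IsTraceV (v : ℝ × ℝ → ℝ) (c : ℝ) (τ : ℝ → ℝ) : Prop :=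
  MemLp τ 2 (volume.restrict (Ioo (0 : ℝ) 1)) ∧ ∃ φ, TendstoH1 φ v ∧
    Tendsto (fun k => eLpNorm (fun y => φ k (c, y) - τ y) 2 (volume.restrict (Ioo (0 : ℝ) 1)))
      atTop (𝓝 0)

/-- `τ ∈ L²(0,1)` is the trace of `v ∈ H¹(Ω)` on the horizontal segment `(0,1) × {c}`,
`0 ≤ c ≤ 1`. -/
def IsTraceH (v : ℝ × ℝ → ℝ) (c : ℝ) (τ : ℝ → ℝ) : Prop :=
  MemLp τ 2 (volume.restrict (Ioo (0 : ℝ) 1)) ∧ ∃ φ, TendstoH1 φ v ∧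
    Tendsto (fun k => eLpNorm (fun x => φ k (x, c) - τ x) 2 (volume.restrict (Ioo (0 : ℝ) 1)))
      atTop (𝓝 0)

/-- `u = g` on `∂Ω` in the sense of traces. -/
def HasBoundaryValue (u g : ℝ × ℝ → ℝ) : Prop :=
  IsTraceV u 0 (fun y => g (0, y)) ∧ IsTraceV u 1 (fun y => g (1, y)) ∧
  IsTraceH u 0 (fun x => g (x, 0)) ∧ IsTraceH u 1 (fun x => g (x, 1))

/-- `G ∈ L²(0,1)` is the weak second derivative of `g` on the interval `(0,1)`. -/
def IsWeakSecondDeriv (g G : ℝ → ℝ) : Prop :=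
  MemLp G 2 (volume.restrict (Ioo (0 : ℝ) 1)) ∧
  ∀ φ : ℝ → ℝ, ContDiff ℝ ∞ φ → HasCompactSupport φ → tsupport φ ⊆ Ioo 0 1 →
    ∫ t in Ioo (0 : ℝ) 1, g t * iteratedDeriv 2 φ t = ∫ t in Ioo (0 : ℝ) 1, G t * φ t

/-- `gxx` and `gyy` are the second tangential derivatives of the boundary function `g`
on the horizontal and on the vertical sides of `Ω`, respectively. -/
def IsTangentialSecondDeriv (g gxx gyy : ℝ × ℝ → ℝ) : Prop :=
  (∀ c : ℝ, c = 0 ∨ c = 1 → IsWeakSecondDeriv (fun y => g (c, y)) (fun y => gyy (c, y))) ∧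
  (∀ c : ℝ, c = 0 ∨ c = 1 → IsWeakSecondDeriv (fun x => g (x, c)) (fun x => gxx (x, c)))

/-! ### Rectangular partitions -/

/-- The Cartesian product of `0 = x₀ < ⋯ < x_n = 1` and `0 = y₀ < ⋯ < y_m = 1`.
The elements are indexed by `Fin n × Fin m`. -/
structure Mesh (n m : ℕ) where
  x : Fin (n + 1) → ℝ
  y : Fin (m + 1) → ℝ
  x_strictMono : StrictMono x
  y_strictMono : StrictMono y
  x_zero : x 0 = 0
  x_last : x (Fin.last n) = 1
  y_zero : y 0 = 0
  y_last : y (Fin.last m) = 1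

variable {n m : ℕ}

namespace Mesh

/-- Width of the `i`-th column, the length of its horizontal edges. -/
def hx (M : Mesh n m) (i : Fin n) : ℝ := M.x i.succ - M.x i.castSucc

/-- Height of the `j`-th row, the length of its vertical edges. -/
def hy (M : Mesh n m) (j : Fin m) : ℝ := M.y j.succ - M.y j.castSucc

/-- The element `T_{ij}`. -/
def elem (M : Mesh n m) (i : Fin n) (j : Fin m) : Set (ℝ × ℝ) :=
  Icc (M.x i.castSucc) (M.x i.succ) ×ˢ Icc (M.y j.castSucc) (M.y j.succ)

/-- The area of `T_{ij}`. -/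
def area (M : Mesh n m) (i : Fin n) (j : Fin m) : ℝ := M.hx i * M.hy j

/-- The mesh size, the maximum of the Euclidean diameters of the elements. -/
def size (M : Mesh n m) : ℝ :=
  ⨆ T : Fin n × Fin m, Real.sqrt (M.hx T.1 ^ 2 + M.hy T.2 ^ 2)

/-- `Q_b` on the vertical edge `{x_i} × [y_j, y_{j+1}]`: the `L²` projection onto constants. -/
def QbV (M : Mesh n m) (i : Fin (n + 1)) (j : Fin m) (w : ℝ × ℝ → ℝ) : ℝ :=
  ⨍ t in M.y j.castSucc..M.y j.succ, w (M.x i, t)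

/-- `Q_b` on the horizontal edge `[x_i, x_{i+1}] × {y_j}`. -/
def QbH (M : Mesh n m) (i : Fin n) (j : Fin (m + 1)) (w : ℝ × ℝ → ℝ) : ℝ :=
  ⨍ s in M.x i.castSucc..M.x i.succ, w (s, M.y j)

/-- `ℚ_h` on `T_{ij}` for a scalar function: the `L²(T)` projection onto constants. -/
def Qh (M : Mesh n m) (i : Fin n) (j : Fin m) (w : ℝ × ℝ → ℝ) : ℝ :=
  ⨍ p in M.elem i j, w p

end Mesh

/-! ### The lowest order weak Galerkin method -/

/-- The space `V_h` for `k = 1`: a polynomial of degree at most one on each element, and a constant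
on each vertical edge `{x_i} × [y_j, y_{j+1}]` and each horizontal edge `[x_i, x_{i+1}] × {y_j}`. -/
structure WeakFun (n m : ℕ) where
  v0 : Fin n → Fin m → (ℝ × ℝ →ᵃ[ℝ] ℝ)
  vV : Fin (n + 1) → Fin m → ℝ
  vH : Fin n → Fin (m + 1) → ℝ

/-- The subspace `V_h^0` of functions that vanish on `∂Ω`. -/
def WeakFun.VanishesOnBoundary (v : WeakFun n m) : Prop :=
  (∀ j, v.vV 0 j = 0 ∧ v.vV (Fin.last n) j = 0) ∧
  (∀ i, v.vH i 0 = 0 ∧ v.vH i (Fin.last m) = 0)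

/-- The discrete weak gradient on `T_{ij}`, the constant vector `|T|⁻¹ ∫_{∂T} v_b n ds`. -/
def weakGrad (M : Mesh n m) (v : WeakFun n m) (i : Fin n) (j : Fin m) : ℝ × ℝ :=
  ((M.area i j)⁻¹ * (M.hy j * v.vV i.succ j - M.hy j * v.vV i.castSucc j),
   (M.area i j)⁻¹ * (M.hx i * v.vH i j.succ - M.hx i * v.vH i j.castSucc))

/-- `weakGrad` is the only constant vector with `(∇_d v, ψ)_T = ⟨v_b, ψ · n⟩_{∂T}` for all constant
vectors `ψ`; the term `(v_0, ∇ · ψ)_T` is zero. -/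
theorem weakGrad_unique (M : Mesh n m) (v : WeakFun n m) (i : Fin n) (j : Fin m) (d : ℝ × ℝ) :
    d = weakGrad M v i j ↔ ∀ ψ : ℝ × ℝ,
      M.area i j * (d.1 * ψ.1 + d.2 * ψ.2) =
        M.hy j * (v.vV i.castSucc j * (-ψ.1)) + M.hy j * (v.vV i.succ j * ψ.1) +
        M.hx i * (v.vH i j.castSucc * (-ψ.2)) + M.hx i * (v.vH i j.succ * ψ.2) := by
  have hx : 0 < M.hx i := sub_pos.2 (M.x_strictMono Fin.castSucc_lt_succ)
  have hy : 0 < M.hy j := sub_pos.2 (M.y_strictMono Fin.castSucc_lt_succ)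
  have hA : M.area i j ≠ 0 := (mul_pos hx hy).ne'
  constructor
  · rintro rfl ψ
    simp only [weakGrad]
    field_simp
    ring
  · intro h
    have h1 := h (1, 0)
    have h2 := h (0, 1)
    simp only [weakGrad] at *
    refine Prod.ext ?_ ?_
    · simp only
      rw [eq_inv_mul_iff_mul_eq₀ hA]
      linarith
    · simp only
      rw [eq_inv_mul_iff_mul_eq₀ hA]
      linarith

/-- `Σ_T (a ∇_d w, ∇_d v)_T` for the tensor `a = diag(a11, a22)`, constant on each element. -/
def diffusionForm (M : Mesh n m) (a11 a22 : Fin n → Fin m → ℝ) (w v : WeakFun n m) : ℝ :=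
  ∑ i, ∑ j, M.area i j *
    (a11 i j * (weakGrad M w i j).1 * (weakGrad M v i j).1 +
     a22 i j * (weakGrad M w i j).2 * (weakGrad M v i j).2)

/-- The stabilizer `s(w, v) = ρ h⁻¹ Σ_T ⟨w_b - Q_b w_0, v_b - Q_b v_0⟩_{∂T}`. -/
def stabilizer (M : Mesh n m) (ρ : ℝ) (w v : WeakFun n m) : ℝ :=
  ρ * M.size⁻¹ * ∑ i, ∑ j,
    (M.hy j * ((w.vV i.castSucc j - M.QbV i.castSucc j (w.v0 i j)) *
        (v.vV i.castSucc j - M.QbV i.castSucc j (v.v0 i j))) +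
     M.hy j * ((w.vV i.succ j - M.QbV i.succ j (w.v0 i j)) *
        (v.vV i.succ j - M.QbV i.succ j (v.v0 i j))) +
     M.hx i * ((w.vH i j.castSucc - M.QbH i j.castSucc (w.v0 i j)) *
        (v.vH i j.castSucc - M.QbH i j.castSucc (v.v0 i j))) +
     M.hx i * ((w.vH i j.succ - M.QbH i j.succ (w.v0 i j)) *
        (v.vH i j.succ - M.QbH i j.succ (v.v0 i j))))

/-- `u_h` satisfies `(a ∇_d u_h, ∇_d v)_h + s(u_h, v) = (f, v_0)` for all `v ∈ V_h^0`. -/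
def IsWGSolution (M : Mesh n m) (ρ : ℝ) (a11 a22 : Fin n → Fin m → ℝ) (f : ℝ × ℝ → ℝ)
    (uh : WeakFun n m) : Prop :=
  ∀ v : WeakFun n m, v.VanishesOnBoundary →
    diffusionForm M a11 a22 uh v + stabilizer M ρ uh v =
      ∑ i, ∑ j, ∫ p in M.elem i j, f p * v.v0 i j p

/-- The boundary value of `u_h`: `Q_b g + (1/12) h_y (h_y - 6 ρ⁻¹ a22 h) Q_b(g_yy)` on the vertical
and `Q_b g + (1/12) h_x (h_x - 6 ρ⁻¹ a11 h) Q_b(g_xx)` on the horizontal boundary edges, with the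
value of the coefficient on the element that contains the edge. -/
def HasPerturbedBoundaryValue (M : Mesh n m) (ρ : ℝ) (a11 a22 : Fin n → Fin m → ℝ)
    (g gxx gyy : ℝ × ℝ → ℝ) (uh : WeakFun n m) : Prop :=
  (∀ (i : Fin n) (j : Fin m) (k : Fin (n + 1)),
    (k = 0 ∧ k = i.castSucc) ∨ (k = Fin.last n ∧ k = i.succ) →
    uh.vV k j = M.QbV k j g +
      1 / 12 * M.hy j * (M.hy j - 6 * ρ⁻¹ * a22 i j * M.size) * M.QbV k j gyy) ∧
  (∀ (i : Fin n) (j : Fin m) (k : Fin (m + 1)),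
    (k = 0 ∧ k = j.castSucc) ∨ (k = Fin.last m ∧ k = j.succ) →
    uh.vH i k = M.QbH i k g +
      1 / 12 * M.hx i * (M.hx i - 6 * ρ⁻¹ * a11 i j * M.size) * M.QbH i k gxx)

/-! ### The model problem -/

/-- `u` is a weak solution of `-∇ · (a ∇u) = f` in `Ω`, where `a = diag(a11, a22)` is constant on
each element of the partition. -/
def IsWeakSolution (M : Mesh n m) (a11 a22 : Fin n → Fin m → ℝ) (f u : ℝ × ℝ → ℝ) : Prop :=
  ∀ φ, IsTest φ →
    ∑ i, ∑ j, ∫ p in M.elem i j,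
        (a11 i j * weakDeriv 1 0 u p * dx φ p + a22 i j * weakDeriv 0 1 u p * dy φ p) =
      ∫ p in Omega, f p * φ p

/-- `a22 Q_b(u_yy)` takes the same value from both sides of each interior vertical edge, and so does
`a11 Q_b(u_xx)` for each interior horizontal edge: where the coefficient jumps, the average over the
edge of the trace of the second derivative is zero. This holds trivially for constant `a`. -/
def EdgeSingleValued (M : Mesh n m) (a11 a22 : Fin n → Fin m → ℝ) (u : ℝ × ℝ → ℝ) : Prop :=
  (∀ (i i' : Fin n) (j : Fin m), i'.val = i.val + 1 → a22 i j ≠ a22 i' j →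
    ∃ τ, IsTraceV (weakDeriv 0 2 u) (M.x i.succ) τ ∧
      ⨍ t in M.y j.castSucc..M.y j.succ, τ t = 0) ∧
  (∀ (i : Fin n) (j j' : Fin m), j'.val = j.val + 1 → a11 i j ≠ a11 i j' →
    ∃ τ, IsTraceH (weakDeriv 2 0 u) (M.y j.succ) τ ∧
      ⨍ s in M.x i.castSucc..M.x i.succ, τ s = 0)

/-- `(Σ_T ‖ℚ_h ∇u - ∇_d u_b‖_T²)^{1/2}`. -/
def gradError (M : Mesh n m) (u : ℝ × ℝ → ℝ) (uh : WeakFun n m) : ℝ :=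
  Real.sqrt (∑ i, ∑ j, M.area i j *
    ((M.Qh i j (weakDeriv 1 0 u) - (weakGrad M uh i j).1) ^ 2 +
     (M.Qh i j (weakDeriv 0 1 u) - (weakGrad M uh i j).2) ^ 2))

end

end WG

namespace WG

/-! The proof is an energy argument with a comparison function `w` in the discrete space that is
closer to `u_h` than the interpolant of `u`. On a vertical edge `w_b` is the mean of `u` plus `1/12
h_y (h_y - 6 ρ⁻¹ a22 h)` times the mean of `u_yy`, and similarly on horizontal edges. The exact edge
means have discrete gradient equal to `ℚ_h ∇u`, and the correction changes it only by a multiple, of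
order `h²`, of the means of `u_xyy` and `u_xxy` over the element (`grad_perturbation_le`). It is
therefore enough to bound `∇_d (w - u_h)`.

The correction is designed for consistency. On each edge of an element the stabilizer `ρ h⁻¹ (w_b -
Q_b w_0)` has to reproduce the oscillation `a (∂_n u - ℚ_h ∂_n u)` of the normal flux, whose leading
part is half the width times the mean of the second normal derivative. This prescribes the four edge
means of `w_0`. Affine functions satisfy one relation: the means on the two pairs of opposite edges
have equal sums. By the quadrature rules in `EdgeRules`, the term `h_y²/12` makes the two sums agree
up to third order, and the term with `ρ⁻¹` allows one common shift on all four edges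
(`exists_edgeMeans`). The remaining defect goes on the pair of edges at the larger distance, which
keeps the constants independent of the aspect ratio.

For discrete `v`, integration by parts on an element (`integral_load`) writes the difference of the
bilinear form at `(w, v)` and `(f, v_0)` as a flux through the boundary weighted by `v_b`, plus
terms that are small compared with the energy of `v` (`exists_element_estimate`). The fluxes cancel
after summation if `v_b` vanishes on the boundary, because the normal flux of `u` is continuous
(`IsFlux.sum_edgeV`). The edge values of `w` are single-valued by the hypothesis on jumps, and on
the boundary they equal those of `u_h`, since `g_yy` and `g_xx` are the traces of `u_yy` and `u_xx`
(`integral_secondDeriv_eq`). So `v = w - u_h` is admissible, and coercivity finishes the proof.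

No trace theorem is used: a trace at `t` is represented by a bounded kernel acting on the function
and its derivative (`integral_traceKernel`). -/

/-! ### Weak derivatives and point values in one dimension -/

/-- `ψ ∈ C_c^∞(0,1)`. -/
def IsTest1 (ψ : ℝ → ℝ) : Prop :=
  ContDiff ℝ ∞ ψ ∧ HasCompactSupport ψ ∧ tsupport ψ ⊆ Ioo 0 1

theorem IsTest1.eq_zero {ψ : ℝ → ℝ} (h : IsTest1 ψ) {x : ℝ} (hx : x ∉ Ioo (0 : ℝ) 1) : ψ x = 0 :=
  image_eq_zero_of_notMem_tsupport fun hx' => hx (h.2.2 hx')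

theorem IsTest1.deriv {ψ : ℝ → ℝ} (h : IsTest1 ψ) : IsTest1 (deriv ψ) :=
  ⟨h.1.deriv' , h.2.1.deriv, (tsupport_deriv_subset).trans h.2.2⟩

theorem exists_Icc_of_isCompact_subset_Ioo {K : Set ℝ} (hK : IsCompact K)
    (hs : K ⊆ Ioo 0 1) : ∃ a b : ℝ, 0 < a ∧ a ≤ b ∧ b < 1 ∧ K ⊆ Icc a b := by
  -- The extra point makes the set nonempty, so that its extrema exist.
  have hK' : IsCompact (insert (1 / 2 : ℝ) K) := hK.insert _
  have hs' : insert (1 / 2 : ℝ) K ⊆ Ioo 0 1 := insert_subset (by norm_num) hs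
  obtain ⟨a, ha, ha'⟩ := hK'.exists_isMinOn (insert_nonempty _ _) continuousOn_id
  obtain ⟨b, hb, hb'⟩ := hK'.exists_isMaxOn (insert_nonempty _ _) continuousOn_id
  refine ⟨a, b, (hs' ha).1, ha' hb, (hs' hb).2, fun x hx => ⟨?_, ?_⟩⟩
  · exact ha' (mem_insert_of_mem _ hx)
  · exact hb' (mem_insert_of_mem _ hx)

/-- Integration by parts for the primitive of an integrable function. -/
theorem integral_primitive_mul_deriv_add {Z p : ℝ → ℝ} {a b : ℝ} (c : ℝ)
    (hZ : IntegrableOn Z (Ioo 0 1)) (ha : a ∈ Icc (0 : ℝ) 1) (hb : b ∈ Icc (0 : ℝ) 1)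
    (hp : ContDiff ℝ 1 p) :
    ∫ x in a..b, ((c + ∫ s in (0 : ℝ)..x, Z s) * deriv p x + Z x * p x) =
      (c + ∫ s in (0 : ℝ)..b, Z s) * p b - (c + ∫ s in (0 : ℝ)..a, Z s) * p a := by
  have hZ01 : IntervalIntegrable Z volume 0 1 := by
    rwa [intervalIntegrable_iff_integrableOn_Ioo_of_le zero_le_one]
  have hsub : uIcc a b ⊆ uIcc 0 1 := by
    rw [uIcc_of_le (zero_le_one' ℝ)]; exact uIcc_subset_Icc ha hb
  have hZab : IntervalIntegrable Z volume a b := hZ01.mono_set hsub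
  have h1 : AbsolutelyContinuousOnInterval (fun x => ∫ s in (0 : ℝ)..x, Z s) a b :=
    (hZ01.absolutelyContinuousOnInterval_intervalIntegral (by simp)).mono hsub
  have h2 : AbsolutelyContinuousOnInterval p a b := hp.contDiffOn.absolutelyContinuousOnInterval
  have hc : AbsolutelyContinuousOnInterval (fun _ : ℝ => c) a b :=
    (contDiff_const : ContDiff ℝ 1 fun _ : ℝ => c).contDiffOn.absolutelyContinuousOnInterval
  have h3 := (hc.add h1).integral_deriv_mul_eq_sub h2
  simp only [Pi.add_apply] at h3
  rw [← h3]
  refine intervalIntegral.integral_congr_ae ?_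
  filter_upwards [hZ01.ae_hasDerivAt_integral] with x hx hxab
  have hx' : x ∈ uIcc (0 : ℝ) 1 := hsub (uIoc_subset_uIcc hxab)
  have := (hx hx' 0 (by simp)).const_add c
  have e : deriv ((fun _ : ℝ => c) + fun x => ∫ s in (0 : ℝ)..x, Z s) x = Z x := this.deriv
  rw [e]; ring

/-- A function on `(0,1)` with a weak derivative that is integrable is absolutely continuous. -/
theorem ae_eq_primitive_of_weak {W Z : ℝ → ℝ} (hW : IntegrableOn W (Ioo 0 1))
    (hZ : IntegrableOn Z (Ioo 0 1))
    (h : ∀ ψ, IsTest1 ψ → ∫ x in Ioo (0 : ℝ) 1, (W x * deriv ψ x + Z x * ψ x) = 0) :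
    ∃ c : ℝ, ∀ᵐ x, x ∈ Ioo (0 : ℝ) 1 → W x = c + ∫ s in (0 : ℝ)..x, Z s := by
  have hZ01 : IntervalIntegrable Z volume 0 1 := by
    rwa [intervalIntegrable_iff_integrableOn_Ioo_of_le zero_le_one]
  have hbdd : ∀ {φ ψ : ℝ → ℝ}, IntegrableOn φ (Ioo 0 1) → Continuous ψ → HasCompactSupport ψ →
      IntegrableOn (fun x => φ x * ψ x) (Ioo 0 1) := by
    intro φ ψ hφ hψ hψ'
    obtain ⟨C, hC⟩ := hψ'.exists_bound_of_continuous hψ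
    exact hφ.mul_bdd hψ.aestronglyMeasurable (Eventually.of_forall hC)
  set P : ℝ → ℝ := fun x => ∫ s in (0 : ℝ)..x, Z s with hP
  have hPc : ContinuousOn P (Icc 0 1) := by
    have := (hZ01.absolutelyContinuousOnInterval_intervalIntegral (c := 0) (by simp)).continuousOn
    rwa [uIcc_of_le (zero_le_one' ℝ)] at this
  have hPi : IntegrableOn P (Ioo 0 1) :=
    (hPc.integrableOn_compact isCompact_Icc).mono_set Ioo_subset_Icc_self
  set F : ℝ → ℝ := fun x => W x - P x with hF
  have hFi : IntegrableOn F (Ioo 0 1) := hW.sub hPi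
  have hF0 : ∀ ψ, IsTest1 ψ → ∫ x in Ioo (0 : ℝ) 1, F x * deriv ψ x = 0 := by
    intro ψ hψ
    have h1 := integral_primitive_mul_deriv_add (a := 0) (b := 1) 0 hZ (by simp) (by simp)
      (hψ.1.of_le (by norm_cast))
    rw [hψ.eq_zero (by simp), hψ.eq_zero (by simp), intervalIntegral.integral_of_le zero_le_one,
      integral_Ioc_eq_integral_Ioo] at h1
    have h2 := h ψ hψ
    have hd := hψ.deriv
    have i1 := hbdd hW hd.1.continuous hd.2.1
    have i2 := hbdd hZ hψ.1.continuous hψ.2.1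
    have i3 := hbdd hPi hd.1.continuous hd.2.1
    have : ∫ x in Ioo (0 : ℝ) 1, F x * deriv ψ x =
        (∫ x in Ioo (0 : ℝ) 1, (W x * deriv ψ x + Z x * ψ x)) -
        ∫ x in Ioo (0 : ℝ) 1, ((0 + ∫ s in (0 : ℝ)..x, Z s) * deriv ψ x + Z x * ψ x) := by
      have i4 : Integrable (fun x => (0 + ∫ s in (0 : ℝ)..x, Z s) * deriv ψ x + Z x * ψ x)
          (volume.restrict (Ioo 0 1)) := by
        simp only [zero_add]
        exact i3.add i2
      rw [← integral_sub (f := fun x => W x * deriv ψ x + Z x * ψ x) (i1.add i2) i4]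
      refine integral_congr_ae (Eventually.of_forall fun x => ?_)
      simp only [hF, hP]; ring
    rw [this, h1, h2]; ring
  -- `F` annihilates derivatives of test functions. A fixed test function `θ` of mass one then
  -- identifies the constant that `F` must equal.
  let B : ContDiffBump (1 / 2 : ℝ) := ⟨1 / 8, 1 / 4, by norm_num, by norm_num⟩
  set θ : ℝ → ℝ := B.normed volume with hθ
  have hθt : IsTest1 θ := by
    refine ⟨B.contDiff_normed, B.hasCompactSupport_normed, ?_⟩
    rw [hθ, B.tsupport_normed_eq, Real.closedBall_eq_Icc]
    intro x hx
    have h1 : (1 / 2 : ℝ) - 1 / 4 ≤ x := hx.1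
    have h2 : x ≤ (1 / 2 : ℝ) + 1 / 4 := hx.2
    constructor <;> linarith
  have hθ1 : ∫ x, θ x = 1 := B.integral_normed
  set c := ∫ x in Ioo (0 : ℝ) 1, F x * θ x with hc
  -- `χ - (∫ χ) θ` has mean zero, hence its primitive again has compact support in `(0,1)` and `F`
  -- annihilates it.
  have key : ∀ χ, IsTest1 χ → ∫ x in Ioo (0 : ℝ) 1, F x * χ x = c * ∫ x, χ x := by
    intro χ hχ
    set I := ∫ x, χ x with hI
    set ξ : ℝ → ℝ := fun x => χ x - I * θ x with hξ
    have hξc : ContDiff ℝ ∞ ξ := hχ.1.sub (contDiff_const.mul hθt.1)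
    obtain ⟨a, b, ha, hab, hb, hK⟩ := exists_Icc_of_isCompact_subset_Ioo
      (K := tsupport χ ∪ tsupport θ) (hχ.2.1.isCompact.union hθt.2.1.isCompact)
      (union_subset hχ.2.2 hθt.2.2)
    have hξ0 : ∀ x, x ∉ Icc a b → ξ x = 0 := by
      intro x hx
      have h1 : χ x = 0 := image_eq_zero_of_notMem_tsupport fun h => hx (hK (Or.inl h))
      have h2 : θ x = 0 := image_eq_zero_of_notMem_tsupport fun h => hx (hK (Or.inr h))
      simp [hξ, h1, h2]
    have hξI : ∫ x in (0 : ℝ)..1, ξ x = 0 := by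
      rw [intervalIntegral.integral_eq_integral_of_support_subset]
      · rw [hξ, integral_sub (hχ.1.continuous.integrable_of_hasCompactSupport hχ.2.1)
          ((hθt.1.continuous.integrable_of_hasCompactSupport hθt.2.1).const_mul _),
          integral_const_mul, hθ1]
        simp [hI]
      · intro x hx
        by_contra hx'
        refine hx (hξ0 x fun h => hx' ⟨by linarith [h.1], by linarith [h.2]⟩)
    set ψ : ℝ → ℝ := fun x => ∫ s in (0 : ℝ)..x, ξ s with hψ
    have hψd : ∀ x, HasDerivAt ψ (ξ x) x := fun x =>
      intervalIntegral.integral_hasDerivAt_right (hξc.continuous.intervalIntegrable _ _)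
        (hξc.continuous.stronglyMeasurableAtFilter _ _) hξc.continuous.continuousAt
    have hψd' : deriv ψ = ξ := funext fun x => (hψd x).deriv
    have hψc : ContDiff ℝ ∞ ψ := by
      rw [contDiff_infty_iff_deriv, hψd']
      exact ⟨fun x => (hψd x).differentiableAt, hξc⟩
    have hψ0 : ∀ x, x ∉ Icc a b → ψ x = 0 := by
      intro x hx
      rw [mem_Icc, not_and_or, not_le, not_le] at hx
      rcases hx with hx | hx
      · refine intervalIntegral.integral_zero_ae (Eventually.of_forall fun s hs => hξ0 s fun h => ?_)
        rcases mem_uIoc.1 hs with h' | h' <;> linarith [h.1, h'.2]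
      · have : ψ x = (∫ s in (0 : ℝ)..1, ξ s) + ∫ s in (1 : ℝ)..x, ξ s :=
          (intervalIntegral.integral_add_adjacent_intervals
            (hξc.continuous.intervalIntegrable _ _) (hξc.continuous.intervalIntegrable _ _)).symm
        rw [this, hξI, zero_add]
        refine intervalIntegral.integral_zero_ae (Eventually.of_forall fun s hs => hξ0 s fun h => ?_)
        rcases mem_uIoc.1 hs with h' | h' <;> linarith [h.2, h'.1]
    have hψs : tsupport ψ ⊆ Icc a b :=
      closure_minimal (fun x hx => by_contra fun h => hx (hψ0 x h)) isClosed_Icc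
    have hψt : IsTest1 ψ := ⟨hψc, HasCompactSupport.of_support_subset_isCompact isCompact_Icc
      ((subset_tsupport _).trans hψs), hψs.trans (Icc_subset_Ioo ha hb)⟩
    have h0 := hF0 ψ hψt
    rw [hψd'] at h0
    have e : ∫ x in Ioo (0 : ℝ) 1, F x * ξ x =
        (∫ x in Ioo (0 : ℝ) 1, F x * χ x) - I * ∫ x in Ioo (0 : ℝ) 1, F x * θ x := by
      rw [← integral_const_mul, ← integral_sub (hbdd hFi hχ.1.continuous hχ.2.1)
        ((hbdd hFi hθt.1.continuous hθt.2.1).const_mul _)]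
      refine integral_congr_ae (Eventually.of_forall fun x => ?_)
      simp only [hξ]; ring
    rw [e] at h0
    linarith
  refine ⟨c, ?_⟩
  have := isOpen_Ioo.ae_eq_zero_of_integral_contDiff_smul_eq_zero (μ := volume)
    (U := Ioo (0 : ℝ) 1) (f := fun x => F x - c)
    (hFi.sub (integrableOn_const (by simp))).locallyIntegrableOn ?_
  · filter_upwards [this] with x hx hx'
    have := hx hx'
    simp only [hF, hP] at this ⊢
    linarith
  · intro χ h1 h2 h3
    have hχ : IsTest1 χ := ⟨h1, h2, h3⟩
    have e1 : ∀ φ : ℝ → ℝ, ∫ x, χ x • φ x = ∫ x in Ioo (0 : ℝ) 1, φ x * χ x := by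
      intro φ
      rw [setIntegral_eq_integral_of_forall_compl_eq_zero]
      · simp [mul_comm]
      · intro x hx; simp [hχ.eq_zero hx]
    have e2 : ∫ x in Ioo (0 : ℝ) 1, χ x = ∫ x, χ x :=
      setIntegral_eq_integral_of_forall_compl_eq_zero fun x hx => hχ.eq_zero hx
    rw [e1]
    simp only [sub_mul]
    rw [integral_sub (hbdd hFi hχ.1.continuous hχ.2.1)
      ((h1.continuous.integrable_of_hasCompactSupport h2).integrableOn.const_mul c),
      key χ hχ, integral_const_mul, e2, sub_self]

/-- The derivative kernel `s ↦ K(t, s)` with `W t = ∫₀¹ (W + K(t, ·) deriv W)`. -/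
noncomputable def traceKernel (t s : ℝ) : ℝ := if s < t then s else s - 1

theorem measurable_traceKernel (t : ℝ) : Measurable (traceKernel t) :=
  Measurable.ite measurableSet_Iio measurable_id (measurable_id.sub_const 1)

theorem norm_traceKernel_le (t : ℝ) {s : ℝ} (hs : s ∈ Ioo (0 : ℝ) 1) : ‖traceKernel t s‖ ≤ 1 := by
  unfold traceKernel
  split_ifs <;> rw [Real.norm_eq_abs, abs_le] <;> constructor <;> linarith [hs.1, hs.2]

/-- Integration by parts against `x` on `(0,t)` and against `x - 1` on `(t,1)`: the terms at `0` and
`1` vanish, and those at `t` combine with weight `t - (t - 1) = 1`. The point value thus becomes a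
bounded functional of `W` and `Z`, which makes sense for functions known only almost everywhere. -/
theorem integral_traceKernel {W Z : ℝ → ℝ} {c t : ℝ} (hW : IntegrableOn W (Ioo 0 1))
    (hZ : IntegrableOn Z (Ioo 0 1)) (ht : t ∈ Icc (0 : ℝ) 1)
    (h : ∀ᵐ x, x ∈ Ioo (0 : ℝ) 1 → W x = c + ∫ s in (0 : ℝ)..x, Z s) :
    ∫ s in Ioo (0 : ℝ) 1, (W s + traceKernel t s * Z s) = c + ∫ s in (0 : ℝ)..t, Z s := by
  have h1 := integral_primitive_mul_deriv_add (p := fun x => x) (a := 0) (b := t) c hZ (by simp) ht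
    (contDiff_id : ContDiff ℝ 1 fun x : ℝ => x)
  have h2 := integral_primitive_mul_deriv_add (p := fun x => x - 1) (a := t) (b := 1) c hZ ht (by simp)
    (contDiff_id.sub contDiff_const : ContDiff ℝ 1 fun x : ℝ => x - 1)
  have hi : IntegrableOn (fun s => W s + traceKernel t s * Z s) (Ioo 0 1) := by
    refine hW.add (Integrable.bdd_mul (c := 1) hZ
      (measurable_traceKernel t).aestronglyMeasurable ?_)
    filter_upwards [ae_restrict_mem measurableSet_Ioo] with s hs using norm_traceKernel_le t hs
  have hi' : IntervalIntegrable (fun s => W s + traceKernel t s * Z s) volume 0 1 := by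
    rwa [intervalIntegrable_iff_integrableOn_Ioo_of_le zero_le_one]
  rw [← integral_Ioc_eq_integral_Ioo, ← intervalIntegral.integral_of_le zero_le_one,
    ← intervalIntegral.integral_add_adjacent_intervals
      (hi'.mono_set (c := 0) (d := t) (by
        rw [uIcc_of_le (zero_le_one' ℝ)]; exact uIcc_subset_Icc (by simp) ht))
      (hi'.mono_set (c := t) (d := 1) (by
        rw [uIcc_of_le (zero_le_one' ℝ)]; exact uIcc_subset_Icc ht (by simp)))]
  have hne : ∀ᵐ x : ℝ, x ≠ 1 := by simp [ae_iff]
  have hnt : ∀ᵐ x : ℝ, x ≠ t := by simp [ae_iff]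
  have e1 : ∫ s in (0 : ℝ)..t, (W s + traceKernel t s * Z s) =
      ∫ x in (0 : ℝ)..t, ((c + ∫ s in (0 : ℝ)..x, Z s) * deriv (fun x => x) x + Z x * x) := by
    refine intervalIntegral.integral_congr_ae ?_
    filter_upwards [h, hne, hnt] with x hx h1 hxt hx'
    rw [uIoc_of_le ht.1] at hx'
    rw [hx ⟨hx'.1, lt_of_le_of_ne (hx'.2.trans ht.2) h1⟩, traceKernel,
      if_pos (lt_of_le_of_ne hx'.2 hxt)]
    simp [mul_comm]
  have e2 : ∫ s in t..1, (W s + traceKernel t s * Z s) =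
      ∫ x in t..1, ((c + ∫ s in (0 : ℝ)..x, Z s) * deriv (fun x => x - 1) x + Z x * (x - 1)) := by
    refine intervalIntegral.integral_congr_ae ?_
    filter_upwards [h, hne] with x hx h1 hx'
    rw [uIoc_of_le ht.2] at hx'
    rw [hx ⟨ht.1.trans_lt hx'.1, lt_of_le_of_ne hx'.2 h1⟩, traceKernel,
      if_neg (not_lt.2 hx'.1.le)]
    simp [mul_comm]
  rw [e1, e2, h1, h2]
  ring

/-! ### The square as a product -/

theorem isOpen_Omega : IsOpen Omega := isOpen_Ioo.prod isOpen_Ioo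

theorem muOmega_eq_prod : muOmega =
    (volume.restrict (Ioo (0 : ℝ) 1)).prod (volume.restrict (Ioo (0 : ℝ) 1)) := by
  rw [muOmega, Omega, Measure.prod_restrict, Measure.volume_eq_prod]

instance isFiniteMeasure_muOmega : IsFiniteMeasure muOmega := by
  rw [muOmega_eq_prod]; infer_instance

theorem ae_mem_Omega : ∀ᵐ p ∂muOmega, p ∈ Omega := ae_restrict_mem isOpen_Omega.measurableSet

theorem measurePreserving_swap_muOmega : MeasurePreserving Prod.swap muOmega muOmega := by
  rw [muOmega_eq_prod]; exact Measure.measurePreserving_swap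

theorem integral_comp_swap_muOmega (F : ℝ × ℝ → ℝ) :
    ∫ p, F p.swap ∂muOmega = ∫ p, F p ∂muOmega :=
  measurePreserving_swap_muOmega.integral_comp MeasurableEquiv.prodComm.measurableEmbedding F

theorem integral_muOmega {F : ℝ × ℝ → ℝ} (hF : Integrable F muOmega) :
    ∫ p, F p ∂muOmega = ∫ x in Ioo (0 : ℝ) 1, ∫ y in Ioo (0 : ℝ) 1, F (x, y) := by
  rw [muOmega_eq_prod] at hF ⊢
  exact integral_prod _ hF

theorem integral_muOmega_symm {F : ℝ × ℝ → ℝ} (hF : Integrable F muOmega) :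
    ∫ p, F p ∂muOmega = ∫ y in Ioo (0 : ℝ) 1, ∫ x in Ioo (0 : ℝ) 1, F (x, y) := by
  rw [muOmega_eq_prod] at hF ⊢
  exact integral_prod_symm _ hF

/-- A bounded measurable weight. -/
def IsWeight {α : Type*} [MeasurableSpace α] (k : α → ℝ) : Prop :=
  Measurable k ∧ ∃ C, ∀ y, ‖k y‖ ≤ C

theorem IsWeight.integrable_mul {α : Type*} [MeasurableSpace α] {μ : Measure α} {k F : α → ℝ}
    (hk : IsWeight k) (hF : Integrable F μ) : Integrable (fun p => k p * F p) μ := by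
  obtain ⟨C, hC⟩ := hk.2
  exact hF.bdd_mul hk.1.aestronglyMeasurable (Eventually.of_forall hC)

theorem IsWeight.comp {α β : Type*} [MeasurableSpace α] [MeasurableSpace β] {k : α → ℝ}
    (hk : IsWeight k) {g : β → α} (hg : Measurable g) : IsWeight fun p => k (g p) :=
  ⟨hk.1.comp hg, hk.2.choose, fun _ => hk.2.choose_spec _⟩

theorem IsWeight.mul {α : Type*} [MeasurableSpace α] {k l : α → ℝ}
    (hk : IsWeight k) (hl : IsWeight l) : IsWeight fun p => k p * l p := by
  obtain ⟨C, hC⟩ := hk.2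
  obtain ⟨D, hD⟩ := hl.2
  refine ⟨hk.1.mul hl.1, C * D, fun y => ?_⟩
  rw [norm_mul]
  exact mul_le_mul (hC y) (hD y) (norm_nonneg _) ((norm_nonneg _).trans (hC y))

theorem IsTest1.isWeight {ψ : ℝ → ℝ} (h : IsTest1 ψ) : IsWeight ψ :=
  ⟨h.1.continuous.measurable, h.2.1.exists_bound_of_continuous h.1.continuous⟩

theorem isWeight_indicator {s : Set ℝ} (hs : MeasurableSet s) :
    IsWeight (s.indicator (1 : ℝ → ℝ)) :=
  ⟨measurable_one.indicator hs, 1, fun y => (norm_indicator_le_norm_self _ _).trans (by simp)⟩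

/-- The kernel restricted to `(0,1)`, where it is bounded. -/
theorem isWeight_traceKernel (t : ℝ) :
    IsWeight ((Ioo (0 : ℝ) 1).indicator (traceKernel t)) := by
  refine ⟨(measurable_traceKernel t).indicator measurableSet_Ioo, 1, fun s => ?_⟩
  by_cases hs : s ∈ Ioo (0 : ℝ) 1
  · rw [indicator_of_mem hs]; exact norm_traceKernel_le t hs
  · rw [indicator_of_notMem hs]; simp

/-! ### Weak derivatives -/

theorem hasDerivAt_fst {φ : ℝ × ℝ → ℝ} (h : Differentiable ℝ φ) (x y : ℝ) :
    HasDerivAt (fun s => φ (s, y)) (dx φ (x, y)) x := by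
  have h1 : HasDerivAt (fun s : ℝ => (s, y)) ((1 : ℝ), (0 : ℝ)) x :=
    (hasDerivAt_id x).prodMk (hasDerivAt_const x y)
  exact (h (x, y)).hasFDerivAt.comp_hasDerivAt x h1

theorem hasDerivAt_snd {φ : ℝ × ℝ → ℝ} (h : Differentiable ℝ φ) (x y : ℝ) :
    HasDerivAt (fun s => φ (x, s)) (dy φ (x, y)) y := by
  have h1 : HasDerivAt (fun s : ℝ => (x, s)) ((0 : ℝ), (1 : ℝ)) y :=
    (hasDerivAt_const y x).prodMk (hasDerivAt_id y)
  exact (h (x, y)).hasFDerivAt.comp_hasDerivAt y h1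

theorem contDiff_dx {φ : ℝ × ℝ → ℝ} (h : ContDiff ℝ ∞ φ) : ContDiff ℝ ∞ (dx φ) :=
  (h.fderiv_right (m := ∞) (by norm_cast)).clm_apply contDiff_const

theorem contDiff_dy {φ : ℝ × ℝ → ℝ} (h : ContDiff ℝ ∞ φ) : ContDiff ℝ ∞ (dy φ) :=
  (h.fderiv_right (m := ∞) (by norm_cast)).clm_apply contDiff_const

theorem IsTest.dx {φ : ℝ × ℝ → ℝ} (h : IsTest φ) : IsTest (dx φ) :=
  ⟨contDiff_dx h.1, h.2.1.fderiv_apply ℝ _,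
    (tsupport_fderiv_apply_subset ℝ _).trans h.2.2⟩

theorem IsTest.dy {φ : ℝ × ℝ → ℝ} (h : IsTest φ) : IsTest (dy φ) :=
  ⟨contDiff_dy h.1, h.2.1.fderiv_apply ℝ _,
    (tsupport_fderiv_apply_subset ℝ _).trans h.2.2⟩

theorem IsTest.isWeight {φ : ℝ × ℝ → ℝ} (h : IsTest φ) : IsWeight φ :=
  ⟨h.1.continuous.measurable, h.2.1.exists_bound_of_continuous h.1.continuous⟩

theorem dx_dy_comm {φ : ℝ × ℝ → ℝ} (h : ContDiff ℝ ∞ φ) : dx (dy φ) = dy (dx φ) := by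
  funext p
  have h1 : DifferentiableAt ℝ (fderiv ℝ φ) p :=
    ((h.fderiv_right (m := ∞) (by norm_cast)).differentiable (by simp)) p
  have e : ∀ v w : ℝ × ℝ, fderiv ℝ (fun q => fderiv ℝ φ q v) p w =
      fderiv ℝ (fderiv ℝ φ) p w v := by
    intro v w
    rw [fderiv_clm_apply h1 (differentiableAt_const v)]
    simp
  have hs : IsSymmSndFDerivAt ℝ φ p := by
    refine (h.contDiffAt (x := p)).isSymmSndFDerivAt ?_
    simp only [minSmoothness_of_isRCLikeNormedField]
    norm_cast
  unfold WG.dx WG.dy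
  rw [e, e]
  exact hs _ _

theorem dx_iterate_dy_comm {φ : ℝ × ℝ → ℝ} (h : ContDiff ℝ ∞ φ) (j : ℕ) :
    dy^[j] (dx φ) = dx (dy^[j] φ) := by
  induction j generalizing φ with
  | zero => rfl
  | succ j ih =>
    rw [Function.iterate_succ_apply, Function.iterate_succ_apply, ← dx_dy_comm h,
      ih (contDiff_dy h)]

theorem weakDeriv_spec {k : ℕ} {u : ℝ × ℝ → ℝ} (hu : MemSobolev k u) {i j : ℕ} (h : i + j ≤ k) :
    IsWeakDeriv i j u (weakDeriv i j u) := by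
  have := hu.2 i j h
  rw [weakDeriv, dif_pos this]
  exact this.choose_spec

/-- Needed because `weakDeriv` is an arbitrary choice: it identifies the first derivative of a
chosen second derivative with the chosen third derivative. -/
theorem IsWeakDeriv.ae_eq {i j : ℕ} {u v v' : ℝ × ℝ → ℝ} (h : IsWeakDeriv i j u v)
    (h' : IsWeakDeriv i j u v') : v =ᵐ[muOmega] v' := by
  have hv := h.1.integrable one_le_two
  have hv' := h'.1.integrable one_le_two
  have := isOpen_Omega.ae_eq_zero_of_integral_contDiff_smul_eq_zero (μ := volume)
    (f := fun p => v p - v' p) (IntegrableOn.locallyIntegrableOn (hv.sub hv')) ?_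
  · rw [muOmega, Filter.EventuallyEq, ae_restrict_iff' isOpen_Omega.measurableSet]
    filter_upwards [this] with p hp hp'
    exact sub_eq_zero.1 (hp hp')
  · intro φ h1 h2 h3
    have hφ : IsTest φ := ⟨h1, h2, h3⟩
    have e := (h.2 φ hφ).symm.trans (h'.2 φ hφ)
    have e' : ∫ p in Omega, v p * φ p = ∫ p in Omega, v' p * φ p :=
      mul_left_cancel₀ (pow_ne_zero _ (by norm_num)) e
    rw [← setIntegral_eq_integral_of_forall_compl_eq_zero (s := Omega)]
    · simp only [smul_eq_mul, mul_sub]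
      refine (integral_sub (hφ.isWeight.integrable_mul hv)
        (hφ.isWeight.integrable_mul hv')).trans ?_
      change (∫ p in Omega, φ p * v p) - ∫ p in Omega, φ p * v' p = 0
      simp only [mul_comm (φ _)]
      rw [e', sub_self]
    · intro p hp
      rw [image_eq_zero_of_notMem_tsupport fun h => hp (h3 h), zero_smul]

/-- `z` is the weak derivative of `w ∈ L²(Ω)` in `x`. -/
def WeakX (w z : ℝ × ℝ → ℝ) : Prop := MemLp w 2 muOmega ∧ IsWeakDeriv 1 0 w z

/-- `z` is the weak derivative of `w ∈ L²(Ω)` in `y`. -/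
def WeakY (w z : ℝ × ℝ → ℝ) : Prop := MemLp w 2 muOmega ∧ IsWeakDeriv 0 1 w z

/-- Follows by testing the identity for `v` with `dx φ`; the extra `dx` sits inside the
`y`-derivatives and has to be commuted outwards. -/
theorem weakX_of_isWeakDeriv {i j : ℕ} {u v z : ℝ × ℝ → ℝ} (h : IsWeakDeriv i j u v)
    (h' : IsWeakDeriv (i + 1) j u z) : WeakX v z := by
  refine ⟨h.1, h'.1, fun φ hφ => ?_⟩
  have e1 := h.2 (dx φ) hφ.dx
  have e2 := h'.2 φ hφ
  rw [dx_iterate_dy_comm hφ.1, ← Function.iterate_succ_apply, e2] at e1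
  have hne : ((-1 : ℝ)) ^ (i + j) ≠ 0 := pow_ne_zero _ (by norm_num)
  refine mul_left_cancel₀ hne ?_
  simp only [Function.iterate_one, Function.iterate_zero, id_eq]
  rw [← e1]
  ring

theorem weakY_of_isWeakDeriv {i j : ℕ} {u v z : ℝ × ℝ → ℝ} (h : IsWeakDeriv i j u v)
    (h' : IsWeakDeriv i (j + 1) u z) : WeakY v z := by
  refine ⟨h.1, h'.1, fun φ hφ => ?_⟩
  have e1 := h.2 (dy φ) hφ.dy
  have e2 := h'.2 φ hφ
  rw [← Function.iterate_succ_apply, e2] at e1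
  have hne : ((-1 : ℝ)) ^ (i + j) ≠ 0 := pow_ne_zero _ (by norm_num)
  refine mul_left_cancel₀ hne ?_
  simp only [Function.iterate_one, Function.iterate_zero, id_eq]
  rw [← e1]
  ring

theorem dx_comp_swap {φ : ℝ × ℝ → ℝ} (h : Differentiable ℝ φ) (p : ℝ × ℝ) :
    dx (fun q => φ q.swap) p = dy φ p.swap := by
  have hd : Differentiable ℝ fun q : ℝ × ℝ => φ q.swap :=
    h.comp (differentiable_snd.prodMk differentiable_fst)
  exact (hasDerivAt_fst hd p.1 p.2).unique (hasDerivAt_snd h p.2 p.1)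

theorem IsTest.comp_swap {φ : ℝ × ℝ → ℝ} (h : IsTest φ) : IsTest fun q => φ q.swap := by
  have hs : HasCompactSupport fun q : ℝ × ℝ => φ q.swap :=
    h.2.1.comp_homeomorph (Homeomorph.prodComm ℝ ℝ)
  refine ⟨h.1.comp (contDiff_snd.prodMk contDiff_fst), hs, ?_⟩
  have e : tsupport (fun q : ℝ × ℝ => φ q.swap) = Prod.swap ⁻¹' tsupport φ :=
    tsupport_comp_eq_preimage φ (Homeomorph.prodComm ℝ ℝ)
  rw [e]
  intro p hp
  have := h.2.2 hp
  exact ⟨this.2, this.1⟩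

/-- Reflection in the diagonal lets statements about horizontal edges be deduced from those about
vertical edges. -/
theorem WeakY.swap {w z : ℝ × ℝ → ℝ} (h : WeakY w z) :
    WeakX (fun p => w p.swap) (fun p => z p.swap) := by
  refine ⟨h.1.comp_measurePreserving measurePreserving_swap_muOmega,
    h.2.1.comp_measurePreserving measurePreserving_swap_muOmega, fun φ hφ => ?_⟩
  have e := h.2.2 _ hφ.comp_swap
  simp only [Function.iterate_one, Function.iterate_zero, id_eq] at e ⊢
  change ∫ p, w p * dy (fun q => φ q.swap) p ∂muOmega = _ * ∫ p, z p * φ p.swap ∂muOmega at e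
  change ∫ p, w p.swap * dx φ p ∂muOmega = _ * ∫ p, z p.swap * φ p ∂muOmega
  rw [← integral_comp_swap_muOmega, ← integral_comp_swap_muOmega (fun p => z p * φ p.swap)] at e
  simp only [Prod.swap_swap] at e
  rw [show (1 + 0 : ℕ) = 0 + 1 from rfl, ← e]
  congr 1
  funext p
  have := dx_comp_swap (hφ.comp_swap.1.differentiable (by simp)) p
  simp only [Prod.swap_swap] at this
  rw [this]

theorem isTest_mul {ψ η : ℝ → ℝ} (hψ : IsTest1 ψ) (hη : IsTest1 η) :
    IsTest fun p => ψ p.1 * η p.2 := by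
  have hs : tsupport (fun p : ℝ × ℝ => ψ p.1 * η p.2) ⊆ tsupport ψ ×ˢ tsupport η := by
    refine closure_minimal (fun p hp => ?_) ((isClosed_tsupport _).prod (isClosed_tsupport _))
    have hp' : ψ p.1 * η p.2 ≠ 0 := hp
    exact ⟨subset_tsupport _ (left_ne_zero_of_mul hp'), subset_tsupport _ (right_ne_zero_of_mul hp')⟩
  refine ⟨(hψ.1.comp contDiff_fst).mul (hη.1.comp contDiff_snd), ?_, hs.trans ?_⟩
  · exact HasCompactSupport.of_support_subset_isCompact
      (hψ.2.1.isCompact.prod hη.2.1.isCompact) ((subset_tsupport _).trans hs)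
  · exact prod_mono hψ.2.2 hη.2.2

theorem dx_mul {ψ η : ℝ → ℝ} (hψ : IsTest1 ψ) (hη : IsTest1 η) (p : ℝ × ℝ) :
    dx (fun p => ψ p.1 * η p.2) p = deriv ψ p.1 * η p.2 :=
  (hasDerivAt_fst ((isTest_mul hψ hη).1.differentiable (by simp)) p.1 p.2).unique
    (((hψ.1.differentiable (by simp)) p.1).hasDerivAt.mul_const (η p.2))

theorem dy_mul {ψ η : ℝ → ℝ} (hψ : IsTest1 ψ) (hη : IsTest1 η) (p : ℝ × ℝ) :
    dy (fun p => ψ p.1 * η p.2) p = ψ p.1 * deriv η p.2 :=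
  (hasDerivAt_snd ((isTest_mul hψ hη).1.differentiable (by simp)) p.1 p.2).unique
    (((hη.1.differentiable (by simp)) p.2).hasDerivAt.const_mul (ψ p.1))

/-- A function on `(0,1)` that vanishes as a distribution vanishes almost everywhere. -/
theorem ae_eq_zero_of_test {F : ℝ → ℝ} {a b : ℝ} (hab : Ioo a b ⊆ Ioo 0 1)
    (hF : IntegrableOn F (Ioo 0 1))
    (h : ∀ ψ, IsTest1 ψ → tsupport ψ ⊆ Ioo a b → ∫ x in Ioo (0 : ℝ) 1, ψ x * F x = 0) :
    ∀ᵐ x, x ∈ Ioo a b → F x = 0 := by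
  refine isOpen_Ioo.ae_eq_zero_of_integral_contDiff_smul_eq_zero
    (hF.mono_set hab).locallyIntegrableOn fun ψ h1 h2 h3 => ?_
  have hψ : IsTest1 ψ := ⟨h1, h2, h3.trans hab⟩
  rw [← h ψ hψ h3, setIntegral_eq_integral_of_forall_compl_eq_zero]
  · rfl
  · intro x hx; rw [hψ.eq_zero hx, zero_mul]

/-- The weak derivative in `x` may be tested with functions that are only bounded in `y`. -/
theorem WeakX.integral_weight {w z : ℝ × ℝ → ℝ} (h : WeakX w z) {k : ℝ → ℝ} (hk : IsWeight k)
    {ψ : ℝ → ℝ} (hψ : IsTest1 ψ) :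
    ∫ p, k p.2 * (w p * deriv ψ p.1 + z p * ψ p.1) ∂muOmega = 0 := by
  have hw := h.1.integrable one_le_two
  have hz := h.2.1.integrable one_le_two
  set G : ℝ × ℝ → ℝ := fun p => w p * deriv ψ p.1 + z p * ψ p.1 with hG
  have hGi : Integrable G muOmega := by
    have h1 := (hψ.deriv.isWeight.comp measurable_fst).integrable_mul hw
    have h2 := (hψ.isWeight.comp measurable_fst).integrable_mul hz
    refine (h1.add h2).congr (Eventually.of_forall fun p => ?_)
    simp only [Pi.add_apply, hG]; ring
  set F : ℝ → ℝ := fun y => ∫ x in Ioo (0 : ℝ) 1, G (x, y) with hF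
  have hFi : IntegrableOn F (Ioo 0 1) := by
    rw [muOmega_eq_prod] at hGi
    exact hGi.integral_prod_right
  have hkF : ∀ {k : ℝ → ℝ}, IsWeight k →
      ∫ p, k p.2 * G p ∂muOmega = ∫ y in Ioo (0 : ℝ) 1, k y * F y := by
    intro k hk
    rw [integral_muOmega_symm ((hk.comp measurable_snd).integrable_mul hGi)]
    simp only [integral_const_mul, hF]
  -- Smooth weights in `y` already force the slice integral `F` to vanish almost everywhere; after
  -- that any bounded weight is allowed.
  have hF0 : ∀ᵐ y, y ∈ Ioo (0 : ℝ) 1 → F y = 0 := by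
    refine ae_eq_zero_of_test Subset.rfl hFi fun η hη _ => ?_
    rw [← hkF hη.isWeight]
    have e := h.2.2 _ (isTest_mul hψ hη)
    simp only [Function.iterate_one, Function.iterate_zero, id_eq, dx_mul hψ hη] at e
    change ∫ p, w p * (deriv ψ p.1 * η p.2) ∂muOmega = _ * ∫ p, z p * (ψ p.1 * η p.2) ∂muOmega at e
    have i1 := ((hψ.deriv.isWeight.comp measurable_fst).mul
      (hη.isWeight.comp measurable_snd)).integrable_mul hw
    have i2 := ((hψ.isWeight.comp measurable_fst).mul
      (hη.isWeight.comp measurable_snd)).integrable_mul hz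
    simp only [mul_comm _ (w _), mul_comm _ (z _)] at i1 i2
    calc ∫ p, η p.2 * G p ∂muOmega
        = ∫ p, (w p * (deriv ψ p.1 * η p.2) + z p * (ψ p.1 * η p.2)) ∂muOmega := by
          congr 1; funext p; simp only [hG]; ring
      _ = 0 := by rw [integral_add i1 i2, e]; ring
  rw [hkF hk]
  rw [← ae_restrict_iff' measurableSet_Ioo] at hF0
  exact integral_eq_zero_of_ae (hF0.mono fun y hy => by simp [hy])

/-- The weak derivative in `y` may be tested with functions that are only bounded in `x`. -/
theorem WeakY.integral_weight {w z : ℝ × ℝ → ℝ} (h : WeakY w z) {k : ℝ → ℝ} (hk : IsWeight k)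
    {ψ : ℝ → ℝ} (hψ : IsTest1 ψ) :
    ∫ p, k p.1 * (w p * deriv ψ p.2 + z p * ψ p.2) ∂muOmega = 0 := by
  rw [← integral_comp_swap_muOmega]
  exact h.swap.integral_weight hk hψ

/-! ### Weighted integrals of traces -/

/-- For `z = ∂_x w`, the integral of `k` times the trace of `w` on the line `{t} × (0,1)`. -/
noncomputable def traceV (w z : ℝ × ℝ → ℝ) (k : ℝ → ℝ) (t : ℝ) : ℝ :=
  ∫ p, k p.2 * (w p + traceKernel t p.1 * z p) ∂muOmega

theorem integrable_traceKernel_mul {z : ℝ × ℝ → ℝ} (hz : Integrable z muOmega) (t : ℝ) :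
    Integrable (fun p => traceKernel t p.1 * z p) muOmega := by
  refine (((isWeight_traceKernel t).comp measurable_fst).integrable_mul hz).congr ?_
  filter_upwards [ae_mem_Omega] with p hp
  rw [indicator_of_mem hp.1]

theorem integrable_trace {w z : ℝ × ℝ → ℝ} (hw : Integrable w muOmega) (hz : Integrable z muOmega)
    (t : ℝ) : Integrable (fun p => w p + traceKernel t p.1 * z p) muOmega :=
  hw.add (integrable_traceKernel_mul hz t)

theorem integral_mul_Ioo_prod {F : ℝ × ℝ → ℝ} (hF : Integrable F muOmega) {k l : ℝ → ℝ}
    (hk : IsWeight k) (hl : IsWeight l) :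
    ∫ p, k p.2 * (F p * l p.1) ∂muOmega =
      ∫ x in Ioo (0 : ℝ) 1, (∫ y in Ioo (0 : ℝ) 1, k y * F (x, y)) * l x := by
  rw [integral_muOmega]
  · congr 1; funext x
    rw [← integral_mul_const]
    congr 1; funext y; ring
  · refine (((hk.comp measurable_snd).mul (hl.comp measurable_fst)).integrable_mul hF).congr
      (Eventually.of_forall fun p => ?_)
    simp only; ring

theorem integrableOn_strip {F : ℝ × ℝ → ℝ} (hF : Integrable F muOmega) {k : ℝ → ℝ}
    (hk : IsWeight k) :
    IntegrableOn (fun x => ∫ y in Ioo (0 : ℝ) 1, k y * F (x, y)) (Ioo 0 1) := by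
  have := (hk.comp measurable_snd).integrable_mul hF
  rw [muOmega_eq_prod] at this
  exact this.integral_prod_left

/-- The integrals over vertical segments are absolutely continuous, with values `traceV`. -/
theorem WeakX.exists_primitive {w z : ℝ × ℝ → ℝ} (h : WeakX w z) {k : ℝ → ℝ} (hk : IsWeight k) :
    ∃ c : ℝ,
      (∀ᵐ x, x ∈ Ioo (0 : ℝ) 1 → ∫ y in Ioo (0 : ℝ) 1, k y * w (x, y) =
        c + ∫ s in (0 : ℝ)..x, ∫ y in Ioo (0 : ℝ) 1, k y * z (s, y)) ∧
      ∀ t ∈ Icc (0 : ℝ) 1, traceV w z k t =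
        c + ∫ s in (0 : ℝ)..t, ∫ y in Ioo (0 : ℝ) 1, k y * z (s, y) := by
  have hw := h.1.integrable one_le_two
  have hz := h.2.1.integrable one_le_two
  have hW := integrableOn_strip hw hk
  have hZ := integrableOn_strip hz hk
  obtain ⟨c, hc⟩ := ae_eq_primitive_of_weak hW hZ (fun ψ hψ => by
    rw [integral_add (hψ.deriv.isWeight.integrable_mul hW |>.congr
        (Eventually.of_forall fun _ => mul_comm _ _))
      (hψ.isWeight.integrable_mul hZ |>.congr (Eventually.of_forall fun _ => mul_comm _ _)),
      ← integral_mul_Ioo_prod hw hk hψ.deriv.isWeight, ← integral_mul_Ioo_prod hz hk hψ.isWeight,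
      ← integral_add]
    · simpa only [mul_add] using h.integral_weight hk hψ
    · refine (((hk.comp measurable_snd).mul
        (hψ.deriv.isWeight.comp measurable_fst)).integrable_mul hw).congr
        (Eventually.of_forall fun p => ?_)
      simp only; ring
    · refine (((hk.comp measurable_snd).mul
        (hψ.isWeight.comp measurable_fst)).integrable_mul hz).congr
        (Eventually.of_forall fun p => ?_)
      simp only; ring)
  refine ⟨c, hc, fun t ht => ?_⟩
  rw [← integral_traceKernel hW hZ ht hc, traceV,
    integral_muOmega ((hk.comp measurable_snd).integrable_mul (integrable_trace hw hz t))]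
  have i1 := (hk.comp measurable_snd).integrable_mul hw
  have i2 := (hk.comp measurable_snd).integrable_mul hz
  rw [muOmega_eq_prod] at i1 i2
  refine integral_congr_ae ?_
  filter_upwards [i1.prod_right_ae, i2.prod_right_ae] with x h1 h2
  rw [← integral_const_mul, ← integral_add h1 (h2.const_mul _)]
  congr 1; funext y; ring

/-- Integration by parts in `x` over a vertical strip. -/
theorem WeakX.strip_integral {w z : ℝ × ℝ → ℝ} (h : WeakX w z) {k : ℝ → ℝ} (hk : IsWeight k)
    {a b : ℝ} (ha : 0 ≤ a) (hab : a ≤ b) (hb : b ≤ 1) {p : ℝ → ℝ} (hp : ContDiff ℝ 1 p) :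
    ∫ q in Ioo a b ×ˢ Ioo (0 : ℝ) 1, k q.2 * (w q * deriv p q.1 + z q * p q.1) =
      traceV w z k b * p b - traceV w z k a * p a := by
  obtain ⟨c, hc, ht⟩ := h.exists_primitive hk
  have hw := h.1.integrable one_le_two
  have hz := h.2.1.integrable one_le_two
  have hsub : Ioo a b ⊆ Ioo 0 1 := Ioo_subset_Ioo ha hb
  rw [ht b ⟨ha.trans hab, hb⟩, ht a ⟨ha, hab.trans hb⟩,
    ← integral_primitive_mul_deriv_add c (integrableOn_strip hz hk) ⟨ha, hab.trans hb⟩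
      ⟨ha.trans hab, hb⟩ hp, intervalIntegral.integral_of_le hab, integral_Ioc_eq_integral_Ioo]
  have hr : volume.restrict (Ioo a b ×ˢ Ioo (0 : ℝ) 1) =
      (volume.restrict (Ioo a b)).prod (volume.restrict (Ioo (0 : ℝ) 1)) := by
    rw [Measure.prod_restrict, Measure.volume_eq_prod]
  have hle : volume.restrict (Ioo a b ×ˢ Ioo (0 : ℝ) 1) ≤ muOmega :=
    Measure.restrict_mono (prod_mono hsub Subset.rfl) le_rfl
  have hbd : ∀ {F : ℝ × ℝ → ℝ} {l : ℝ → ℝ}, Integrable F muOmega → Continuous l →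
      Integrable (fun q => k q.2 * (F q * l q.1)) (volume.restrict (Ioo a b ×ˢ Ioo (0 : ℝ) 1)) := by
    intro F l hF hl
    refine (hk.comp measurable_snd).integrable_mul ?_
    obtain ⟨C, hC⟩ := isCompact_Icc.exists_bound_of_continuousOn (s := Icc a b) hl.continuousOn
    refine (hF.mono_measure hle).mul_bdd (c := C)
      (hl.comp continuous_fst).aestronglyMeasurable ?_
    filter_upwards [ae_restrict_mem (measurableSet_Ioo.prod measurableSet_Ioo)] with q hq
      using hC _ (Ioo_subset_Icc_self hq.1)
  have i1 := hbd hw (hp.continuous_deriv le_rfl)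
  have i2 := hbd hz hp.continuous
  have i3 := i1.add i2
  simp only [mul_add]
  rw [hr] at i1 i2 i3 ⊢
  refine (integral_prod _ i3).trans (integral_congr_ae ?_)
  have hc' : ∀ᵐ x ∂volume.restrict (Ioo a b), ∫ y in Ioo (0 : ℝ) 1, k y * w (x, y) =
        c + ∫ s in (0 : ℝ)..x, ∫ y in Ioo (0 : ℝ) 1, k y * z (s, y) := by
    rw [ae_restrict_iff' measurableSet_Ioo]
    filter_upwards [hc] with x hx hx' using hx (hsub hx')
  filter_upwards [hc', i1.prod_right_ae, i2.prod_right_ae] with x hx h1 h2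
  simp only [Pi.add_apply]
  rw [integral_add h1 h2, ← hx, ← integral_mul_const, ← integral_mul_const]
  congr 2 <;> (funext y; ring)

theorem restrict_Icc_prod_Icc (a b c d : ℝ) :
    (volume : Measure (ℝ × ℝ)).restrict (Icc a b ×ˢ Icc c d) =
      volume.restrict (Ioo a b ×ˢ Ioo c d) := by
  rw [Measure.volume_eq_prod, ← Measure.prod_restrict, ← Measure.prod_restrict,
    Measure.restrict_congr_set Ioo_ae_eq_Icc, Measure.restrict_congr_set Ioo_ae_eq_Icc]

theorem restrict_Icc_prod_Icc_le {a b c d : ℝ} (ha : 0 ≤ a) (hb : b ≤ 1) (hc : 0 ≤ c)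
    (hd : d ≤ 1) : volume.restrict (Icc a b ×ˢ Icc c d) ≤ muOmega := by
  rw [restrict_Icc_prod_Icc]
  exact Measure.restrict_mono (prod_mono (Ioo_subset_Ioo ha hb) (Ioo_subset_Ioo hc hd)) le_rfl

/-- The integral of the trace of `w` over the segment `{t} × [c, d]`. -/
noncomputable def edgeV (w z : ℝ × ℝ → ℝ) (c d t : ℝ) : ℝ :=
  traceV w z ((Icc c d).indicator 1) t

theorem setIntegral_strip_indicator (F : ℝ × ℝ → ℝ) {a b c d : ℝ} (hc : 0 ≤ c) (hd : d ≤ 1) :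
    ∫ q in Ioo a b ×ˢ Ioo (0 : ℝ) 1, (Icc c d).indicator 1 q.2 * F q =
      ∫ q in Icc a b ×ˢ Icc c d, F q := by
  have e : (fun q : ℝ × ℝ => (Icc c d).indicator 1 q.2 * F q) =
      (univ ×ˢ Icc c d).indicator F := by
    funext q
    by_cases hq : q.2 ∈ Icc c d
    · rw [indicator_of_mem hq, indicator_of_mem (show q ∈ univ ×ˢ Icc c d from ⟨trivial, hq⟩)]
      simp
    · rw [indicator_of_notMem hq, indicator_of_notMem fun h => hq h.2, zero_mul]
  rw [e, setIntegral_indicator (MeasurableSet.univ.prod measurableSet_Icc), prod_inter_prod,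
    inter_univ]
  have h1 : (Ioo (0 : ℝ) 1 ∩ Icc c d : Set ℝ) =ᵐ[volume] Icc c d := by
    have := (Ioo_ae_eq_Icc (μ := volume) (a := (0 : ℝ)) (b := 1)).inter (ae_eq_refl (Icc c d))
    rwa [inter_eq_right.2 (Icc_subset_Icc hc hd)] at this
  rw [Measure.volume_eq_prod, ← Measure.prod_restrict, ← Measure.prod_restrict,
    Measure.restrict_congr_set h1, Measure.restrict_congr_set Ioo_ae_eq_Icc]

/-- Integration by parts in `x` over a rectangle. -/
theorem WeakX.rect_integral {w z : ℝ × ℝ → ℝ} (h : WeakX w z) {a b c d : ℝ} (ha : 0 ≤ a)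
    (hab : a ≤ b) (hb : b ≤ 1) (hc : 0 ≤ c) (hd : d ≤ 1) {p : ℝ → ℝ} (hp : ContDiff ℝ 1 p) :
    ∫ q in Icc a b ×ˢ Icc c d, (w q * deriv p q.1 + z q * p q.1) =
      edgeV w z c d b * p b - edgeV w z c d a * p a := by
  rw [← setIntegral_strip_indicator _ hc hd]
  exact h.strip_integral (isWeight_indicator measurableSet_Icc) ha hab hb hp

/-! ### Traces as limits of smooth functions -/

/-- On a finite measure space `L²` convergence implies `L¹` convergence, and a bounded weight
preserves it. -/
theorem tendsto_integral_of_eLpNorm {α : Type*} [MeasurableSpace α] {μ : Measure α}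
    [IsFiniteMeasure μ] {F : ℕ → α → ℝ} {f k : α → ℝ} (hk : IsWeight k)
    (hF : ∀ i, Integrable (F i) μ) (hf : Integrable f μ)
    (h : Tendsto (fun i => eLpNorm (F i - f) 2 μ) atTop (𝓝 0)) :
    Tendsto (fun i => ∫ p, k p * F i p ∂μ) atTop (𝓝 (∫ p, k p * f p ∂μ)) := by
  obtain ⟨C, hC⟩ := hk.2
  refine tendsto_integral_of_L1' _ (hk.integrable_mul hf).aestronglyMeasurable
    (Eventually.of_forall fun i => hk.integrable_mul (hF i)) ?_
  have h1 : ∀ i, eLpNorm ((fun p => k p * F i p) - fun p => k p * f p) 1 μ ≤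
      ENNReal.ofReal C * (eLpNorm (F i - f) 2 μ * μ univ ^ (1 / (1 : ENNReal).toReal -
        1 / (2 : ENNReal).toReal)) := by
    intro i
    refine (eLpNorm_le_mul_eLpNorm_of_ae_le_mul (g := F i - f) (c := C)
      (Eventually.of_forall fun p => ?_) 1).trans ?_
    · simp only [Pi.sub_apply, ← mul_sub, norm_mul]
      exact mul_le_mul_of_nonneg_right (hC p) (norm_nonneg _)
    · gcongr
      exact eLpNorm_le_eLpNorm_mul_rpow_measure_univ one_le_two
        ((hF i).sub hf).aestronglyMeasurable
  refine tendsto_of_tendsto_of_tendsto_of_le_of_le tendsto_const_nhds ?_ (fun _ => zero_le) h1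
  have h2 : Tendsto (fun i => eLpNorm (F i - f) 2 μ * μ univ ^ (1 / (1 : ENNReal).toReal -
        1 / (2 : ENNReal).toReal)) atTop (𝓝 (0 * μ univ ^ (1 / (1 : ENNReal).toReal -
        1 / (2 : ENNReal).toReal))) := by
    refine ENNReal.Tendsto.mul_const h (Or.inr ?_)
    exact ENNReal.rpow_ne_top_of_nonneg (by norm_num) (measure_ne_top _ _)
  have h3 := ENNReal.Tendsto.const_mul (a := ENNReal.ofReal C) h2 (Or.inr ENNReal.ofReal_ne_top)
  simpa using h3

theorem integrable_muOmega_of_continuous {φ : ℝ × ℝ → ℝ} (h : Continuous φ) :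
    Integrable φ muOmega := by
  have : IntegrableOn φ (Icc 0 1 ×ˢ Icc 0 1) :=
    h.continuousOn.integrableOn_compact (isCompact_Icc.prod isCompact_Icc)
  exact this.mono_set (prod_mono Ioo_subset_Icc_self Ioo_subset_Icc_self)

/-- The kernel formula is applied on each horizontal line, where the fundamental theorem of calculus
supplies the primitive. -/
theorem traceV_of_contDiff {φ : ℝ × ℝ → ℝ} (h : ContDiff ℝ ∞ φ) {k : ℝ → ℝ} (hk : IsWeight k)
    {t : ℝ} (ht : t ∈ Icc (0 : ℝ) 1) :
    traceV φ (dx φ) k t = ∫ y in Ioo (0 : ℝ) 1, k y * φ (t, y) := by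
  have hd := (contDiff_dx h).continuous
  rw [traceV, integral_muOmega_symm ((hk.comp measurable_snd).integrable_mul
    (integrable_trace (integrable_muOmega_of_continuous h.continuous)
      (integrable_muOmega_of_continuous hd) t))]
  congr 1; funext y
  simp only
  rw [integral_const_mul]
  congr 1
  have hg : ∀ x, φ (x, y) = φ (0, y) + ∫ s in (0 : ℝ)..x, dx φ (s, y) := by
    intro x
    rw [intervalIntegral.integral_eq_sub_of_hasDerivAt (f := fun s => φ (s, y))
      (fun s _ => hasDerivAt_fst (h.differentiable (by simp)) s y)
      ((hd.comp (by fun_prop : Continuous fun s : ℝ => (s, y))).intervalIntegrable _ _)]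
    ring
  have hi : ∀ {f : ℝ × ℝ → ℝ}, Continuous f → IntegrableOn (fun s => f (s, y)) (Ioo (0 : ℝ) 1) :=
    fun hf => ((hf.comp (by fun_prop : Continuous fun s : ℝ => (s, y))).integrableOn_Icc).mono_set
      Ioo_subset_Icc_self
  rw [hg t]
  exact integral_traceKernel (hi h.continuous) (hi hd) ht (Eventually.of_forall fun x _ => hg x)

/-- Both sides are limits along the same smooth sequence, for which they agree. In particular the
trace does not depend on the sequence. -/
theorem traceV_eq_of_tendsto {w z : ℝ × ℝ → ℝ} (hw : MemLp w 2 muOmega) (hz : MemLp z 2 muOmega)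
    {φ : ℕ → ℝ × ℝ → ℝ} (hφ : ∀ i, ContDiff ℝ ∞ (φ i))
    (h0 : Tendsto (fun i => eLpNorm (φ i - w) 2 muOmega) atTop (𝓝 0))
    (h1 : Tendsto (fun i => eLpNorm (dx (φ i) - z) 2 muOmega) atTop (𝓝 0))
    {t : ℝ} (ht : t ∈ Icc (0 : ℝ) 1) {τ : ℝ → ℝ} (hτ : MemLp τ 2 (volume.restrict (Ioo (0 : ℝ) 1)))
    (h2 : Tendsto (fun i => eLpNorm (fun y => φ i (t, y) - τ y) 2
      (volume.restrict (Ioo (0 : ℝ) 1))) atTop (𝓝 0)) {k : ℝ → ℝ} (hk : IsWeight k) :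
    ∫ y in Ioo (0 : ℝ) 1, k y * τ y = traceV w z k t := by
  have hwi := hw.integrable one_le_two
  have hzi := hz.integrable one_le_two
  have hφi := fun i => integrable_muOmega_of_continuous (hφ i).continuous
  have hdi := fun i => integrable_muOmega_of_continuous (contDiff_dx (hφ i)).continuous
  have hk2 := hk.comp (measurable_snd (α := ℝ))
  have hkK := hk2.mul ((isWeight_traceKernel t).comp (measurable_fst (β := ℝ)))
  have e : ∀ {w z : ℝ × ℝ → ℝ}, Integrable w muOmega → Integrable z muOmega →
      traceV w z k t = (∫ p, k p.2 * w p ∂muOmega) +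
        ∫ p, k p.2 * (Ioo (0 : ℝ) 1).indicator (traceKernel t) p.1 * z p ∂muOmega := by
    intro w z hw hz
    rw [← integral_add (hk2.integrable_mul hw) (hkK.integrable_mul hz), traceV]
    refine integral_congr_ae ?_
    filter_upwards [ae_mem_Omega] with p hp
    rw [indicator_of_mem hp.1]; ring
  have t1 := (tendsto_integral_of_eLpNorm hk2 hφi hwi h0).add
    (tendsto_integral_of_eLpNorm hkK hdi hzi h1)
  have t2 := tendsto_integral_of_eLpNorm (F := fun i y => φ i (t, y)) hk (fun i =>
    (((hφ i).continuous.comp (by fun_prop : Continuous fun s : ℝ => (t, s))).integrableOn_Icc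
      (a := 0) (b := 1)).mono_set Ioo_subset_Icc_self) (hτ.integrable one_le_two) h2
  rw [e hwi hzi]
  refine tendsto_nhds_unique t2 (t1.congr fun i => ?_)
  rw [← e (hφi i) (hdi i), traceV_of_contDiff (hφ i) hk ht]

theorem IsTraceV.integral_eq {w z : ℝ × ℝ → ℝ} (h : WeakX w z) {t : ℝ} (ht : t ∈ Icc (0 : ℝ) 1)
    {τ : ℝ → ℝ} (hτ : IsTraceV w t τ) {k : ℝ → ℝ} (hk : IsWeight k) :
    ∫ y in Ioo (0 : ℝ) 1, k y * τ y = traceV w z k t := by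
  obtain ⟨h0, φ, ⟨h1, h2, h3, -⟩, h5⟩ := hτ
  refine traceV_eq_of_tendsto h.1 h.2.1 h1 h2 ?_ ht h0 h5 hk
  have he : weakDeriv 1 0 w =ᵐ[muOmega] z := by
    have hex : ∃ v, IsWeakDeriv 1 0 w v := ⟨z, h.2⟩
    rw [weakDeriv, dif_pos hex]
    exact hex.choose_spec.ae_eq h.2
  exact h3.congr fun i => eLpNorm_congr_ae ((ae_eq_refl _).sub he)

theorem IsTraceH.integral_eq {w z : ℝ × ℝ → ℝ} (h : WeakY w z) {t : ℝ} (ht : t ∈ Icc (0 : ℝ) 1)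
    {τ : ℝ → ℝ} (hτ : IsTraceH w t τ) {k : ℝ → ℝ} (hk : IsWeight k) :
    ∫ x in Ioo (0 : ℝ) 1, k x * τ x = traceV (fun p => w p.swap) (fun p => z p.swap) k t := by
  obtain ⟨h0, φ, ⟨h1, h2, -, h4⟩, h5⟩ := hτ
  have hs : ∀ i, ContDiff ℝ ∞ fun p : ℝ × ℝ => φ i p.swap := fun i =>
    (h1 i).comp (contDiff_snd.prodMk contDiff_fst)
  have he : weakDeriv 0 1 w =ᵐ[muOmega] z := by
    have hex : ∃ v, IsWeakDeriv 0 1 w v := ⟨z, h.2⟩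
    rw [weakDeriv, dif_pos hex]
    exact hex.choose_spec.ae_eq h.2
  refine traceV_eq_of_tendsto (φ := fun i p => φ i p.swap) h.swap.1 h.swap.2.1 hs ?_ ?_ ht h0 h5 hk
  · refine h2.congr fun i => ?_
    exact (eLpNorm_comp_measurePreserving ((integrable_muOmega_of_continuous
      (h1 i).continuous).aestronglyMeasurable.sub h.1.aestronglyMeasurable)
      measurePreserving_swap_muOmega).symm
  · refine h4.congr fun i => ?_
    have e : dx (fun p => φ i p.swap) - (fun p => z p.swap) = (dy (φ i) - z) ∘ Prod.swap := by
      funext p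
      simp only [Pi.sub_apply, Function.comp_apply]
      rw [dx_comp_swap ((h1 i).differentiable (by simp))]
    rw [e, eLpNorm_comp_measurePreserving ((integrable_muOmega_of_continuous
      (contDiff_dy (h1 i)).continuous).aestronglyMeasurable.sub h.2.1.aestronglyMeasurable)
      measurePreserving_swap_muOmega]
    exact eLpNorm_congr_ae ((ae_eq_refl _).sub he)

/-- The tangential second derivative of the trace is the trace of the second derivative. -/
theorem integral_secondDeriv_eq {w wx wy wxy wyy wxyy : ℝ × ℝ → ℝ} {t : ℝ} {τ G : ℝ → ℝ}
    (hτ : ∀ k, IsWeight k → ∫ y in Ioo (0 : ℝ) 1, k y * τ y = traceV w wx k t)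
    (h1 : WeakY w wy) (h2 : WeakY wy wyy) (h3 : WeakY wx wxy) (h4 : WeakY wxy wxyy)
    (hG : IsWeakSecondDeriv τ G) {k : ℝ → ℝ} (hk : IsWeight k) :
    ∫ y in Ioo (0 : ℝ) 1, k y * G y = traceV wyy wxyy k t := by
  have hyy := h2.2.1.integrable one_le_two
  have hxyy := h4.2.1.integrable one_le_two
  have hT := integrable_trace hyy hxyy t
  set F : ℝ → ℝ := fun y => ∫ x in Ioo (0 : ℝ) 1, (wyy (x, y) + traceKernel t x * wxyy (x, y))
    with hF
  have hFi : IntegrableOn F (Ioo 0 1) := by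
    have := hT
    rw [muOmega_eq_prod] at this
    exact this.integral_prod_right
  have hGi : IntegrableOn G (Ioo 0 1) := hG.1.integrable one_le_two
  have hTk : ∀ {k : ℝ → ℝ}, IsWeight k →
      traceV wyy wxyy k t = ∫ y in Ioo (0 : ℝ) 1, k y * F y := by
    intro k hk
    rw [traceV, integral_muOmega_symm ((hk.comp measurable_snd).integrable_mul hT)]
    simp only [integral_const_mul, hF]
  have twice : ∀ {v vy vyy : ℝ × ℝ → ℝ}, WeakY v vy → WeakY vy vyy → ∀ {κ ψ : ℝ → ℝ},
      IsWeight κ → IsTest1 ψ →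
      ∫ p, κ p.1 * (v p * deriv (deriv ψ) p.2) ∂muOmega =
        ∫ p, κ p.1 * (vyy p * ψ p.2) ∂muOmega := by
    intro v vy vyy hv hvy κ ψ hκ hψ
    have e1 := hv.integral_weight hκ hψ.deriv
    have e2 := hvy.integral_weight hκ hψ
    have hi : ∀ {f : ℝ × ℝ → ℝ} {η : ℝ → ℝ}, MemLp f 2 muOmega → IsTest1 η →
        Integrable (fun p => κ p.1 * (f p * η p.2)) muOmega := by
      intro f η hf hη
      refine (((hκ.comp measurable_fst).mul (hη.isWeight.comp measurable_snd)).integrable_mul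
        (hf.integrable one_le_two)).congr (Eventually.of_forall fun p => ?_)
      simp only; ring
    simp only [mul_add] at e1 e2
    rw [integral_add (hi hv.1 hψ.deriv.deriv) (hi hv.2.1 hψ.deriv)] at e1
    rw [integral_add (hi hvy.1 hψ.deriv) (hi hvy.2.1 hψ)] at e2
    linarith
  -- The kernel depends on `x` only, so both `y`-derivatives can be moved from `ψ` to `w` and `wx`
  -- under the integral. Hence `G` and the trace of `wyy` coincide as distributions.
  have hFG : ∀ᵐ y, y ∈ Ioo (0 : ℝ) 1 → G y - F y = 0 := by
    refine ae_eq_zero_of_test Subset.rfl (hGi.sub hFi) fun ψ hψ _ => ?_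
    simp only [mul_sub]
    rw [integral_sub (hψ.isWeight.integrable_mul hGi) (hψ.isWeight.integrable_mul hFi),
      ← hTk hψ.isWeight, sub_eq_zero]
    have e1 := hG.2 ψ hψ.1 hψ.2.1 hψ.2.2
    have e2 := hτ _ hψ.deriv.deriv.isWeight
    have e3 : iteratedDeriv 2 ψ = deriv (deriv ψ) := by
      rw [iteratedDeriv_succ, iteratedDeriv_one]
    rw [e3] at e1
    simp only [mul_comm (ψ _)]
    rw [← e1]
    simp only [mul_comm (τ _)]
    rw [e2, traceV, traceV]
    have hK := isWeight_traceKernel t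
    have hi : ∀ {f : ℝ × ℝ → ℝ} {η κ : ℝ → ℝ}, MemLp f 2 muOmega → IsTest1 η → IsWeight κ →
        Integrable (fun p => κ p.1 * (f p * η p.2)) muOmega := by
      intro f η κ hf hη hκ
      refine (((hκ.comp measurable_fst).mul (hη.isWeight.comp measurable_snd)).integrable_mul
        (hf.integrable one_le_two)).congr (Eventually.of_forall fun p => ?_)
      simp only; ring
    have h1w : IsWeight (fun _ : ℝ => (1 : ℝ)) := ⟨measurable_const, 1, by simp⟩
    have split : ∀ {f g : ℝ × ℝ → ℝ} {η : ℝ → ℝ}, MemLp f 2 muOmega → MemLp g 2 muOmega →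
        IsTest1 η → ∫ p, η p.2 * (f p + traceKernel t p.1 * g p) ∂muOmega =
          (∫ p, (fun _ => (1 : ℝ)) p.1 * (f p * η p.2) ∂muOmega) +
          ∫ p, (Ioo (0 : ℝ) 1).indicator (traceKernel t) p.1 * (g p * η p.2) ∂muOmega := by
      intro f g η hf hg hη
      rw [← integral_add (hi hf hη h1w) (hi hg hη hK)]
      refine integral_congr_ae ?_
      filter_upwards [ae_mem_Omega] with p hp
      rw [indicator_of_mem hp.1]; ring
    rw [split h1.1 h3.1 hψ.deriv.deriv, split h2.2.1 h4.2.1 hψ, twice h1 h2 h1w hψ,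
      twice h3 h4 hK hψ]
  rw [hTk hk]
  rw [← ae_restrict_iff' measurableSet_Ioo] at hFG
  refine integral_congr_ae (hFG.mono fun y hy => ?_)
  simp only
  rw [sub_eq_zero.1 hy]

variable {n m : ℕ}

/-! ### Elements and strips of a mesh -/

namespace Mesh

theorem x_mem (M : Mesh n m) (i : Fin (n + 1)) : M.x i ∈ Icc (0 : ℝ) 1 := by
  constructor
  · rw [← M.x_zero]; exact M.x_strictMono.monotone (Fin.zero_le i)
  · rw [← M.x_last]; exact M.x_strictMono.monotone (Fin.le_last i)

theorem y_mem (M : Mesh n m) (j : Fin (m + 1)) : M.y j ∈ Icc (0 : ℝ) 1 := by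
  constructor
  · rw [← M.y_zero]; exact M.y_strictMono.monotone (Fin.zero_le j)
  · rw [← M.y_last]; exact M.y_strictMono.monotone (Fin.le_last j)

theorem x_lt (M : Mesh n m) (i : Fin n) : M.x i.castSucc < M.x i.succ :=
  M.x_strictMono Fin.castSucc_lt_succ

theorem y_lt (M : Mesh n m) (j : Fin m) : M.y j.castSucc < M.y j.succ :=
  M.y_strictMono Fin.castSucc_lt_succ

theorem Ioo_x_subset (M : Mesh n m) (i : Fin n) :
    Ioo (M.x i.castSucc) (M.x i.succ) ⊆ Ioo 0 1 :=
  Ioo_subset_Ioo (M.x_mem _).1 (M.x_mem _).2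

theorem Ioo_y_subset (M : Mesh n m) (j : Fin m) :
    Ioo (M.y j.castSucc) (M.y j.succ) ⊆ Ioo 0 1 :=
  Ioo_subset_Ioo (M.y_mem _).1 (M.y_mem _).2

/-- The mesh with the two coordinates exchanged. -/
def swap (M : Mesh n m) : Mesh m n :=
  ⟨M.y, M.x, M.y_strictMono, M.x_strictMono, M.y_zero, M.y_last, M.x_zero, M.x_last⟩

end Mesh

theorem notMem_Ioo_of_strictMono {x : Fin (n + 1) → ℝ} (hx : StrictMono x) (i : Fin n)
    (k : Fin (n + 1)) : x k ∉ Ioo (x i.castSucc) (x i.succ) := by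
  rintro ⟨h1, h2⟩
  rw [hx.lt_iff_lt] at h1 h2
  simp only [Fin.lt_def, Fin.val_castSucc, Fin.val_succ] at h1 h2
  omega

theorem disjoint_Icc_Ioo_of_strictMono {x : Fin (n + 1) → ℝ} (hx : StrictMono x) {i k : Fin n}
    (h : i ≠ k) {t : ℝ} (ht : t ∈ Icc (x k.castSucc) (x k.succ)) :
    t ∉ Ioo (x i.castSucc) (x i.succ) := by
  rintro ⟨h1, h2⟩
  rcases lt_or_gt_of_ne h with h' | h'
  · have : x i.succ ≤ x k.castSucc := hx.monotone (by
      simp only [Fin.le_def, Fin.val_castSucc, Fin.val_succ]; exact h')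
    linarith [ht.1]
  · have : x k.succ ≤ x i.castSucc := hx.monotone (by
      simp only [Fin.le_def, Fin.val_castSucc, Fin.val_succ]; exact h')
    linarith [ht.2]

theorem sum_integral_partition {n : ℕ} {x : Fin (n + 1) → ℝ} (hx : Monotone x) {g : ℝ → ℝ}
    (hg : IntervalIntegrable g volume (x 0) (x (Fin.last n))) :
    ∑ i : Fin n, ∫ t in x i.castSucc..x i.succ, g t = ∫ t in x 0..x (Fin.last n), g t := by
  induction n with
  | zero => simp
  | succ n ih =>
    rw [Fin.sum_univ_castSucc]
    have h0 : x 0 ≤ x (Fin.last n).castSucc := hx (Fin.zero_le _)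
    have h1 : x (Fin.last n).castSucc ≤ x (Fin.last n).succ := hx Fin.castSucc_lt_succ.le
    have e : (Fin.last n).succ = Fin.last (n + 1) := rfl
    rw [e] at h1 ⊢
    have hg1 : IntervalIntegrable g volume (x 0) (x (Fin.last n).castSucc) :=
      hg.mono_set (by
        rw [uIcc_of_le h0, uIcc_of_le (h0.trans h1)]; exact Icc_subset_Icc_right h1)
    have hg2 : IntervalIntegrable g volume (x (Fin.last n).castSucc) (x (Fin.last (n + 1))) :=
      hg.mono_set (by
        rw [uIcc_of_le h1, uIcc_of_le (h0.trans h1)]; exact Icc_subset_Icc_left h0)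
    have := ih (x := fun i => x i.castSucc) (fun a b h => hx (Fin.castSucc_le_castSucc_iff.2 h)) hg1
    rw [← intervalIntegral.integral_add_adjacent_intervals hg1 hg2]
    exact congrArg (· + _) this

theorem sum_setIntegral_partition {x : Fin (n + 1) → ℝ} (hx : StrictMono x) (h0 : x 0 = 0)
    (h1 : x (Fin.last n) = 1) {g : ℝ → ℝ} (hg : IntegrableOn g (Ioo 0 1)) :
    ∑ i : Fin n, ∫ t in Ioo (x i.castSucc) (x i.succ), g t = ∫ t in Ioo (0 : ℝ) 1, g t := by
  have := sum_integral_partition (g := g) hx.monotone (by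
    rwa [h0, h1, intervalIntegrable_iff_integrableOn_Ioo_of_le zero_le_one])
  rw [h0, h1, intervalIntegral.integral_of_le zero_le_one, integral_Ioc_eq_integral_Ioo] at this
  rw [← this]
  refine Finset.sum_congr rfl fun i _ => ?_
  rw [intervalIntegral.integral_of_le (hx Fin.castSucc_lt_succ).le, integral_Ioc_eq_integral_Ioo]

theorem volume_restrict_prod (s t : Set ℝ) : (volume : Measure (ℝ × ℝ)).restrict (s ×ˢ t) =
    (volume.restrict s).prod (volume.restrict t) := by
  rw [Measure.prod_restrict, Measure.volume_eq_prod]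

theorem sum_strip (M : Mesh n m) {F : ℝ × ℝ → ℝ} (hF : Integrable F muOmega) :
    ∑ i : Fin n, ∫ p in Ioo (M.x i.castSucc) (M.x i.succ) ×ˢ Ioo (0 : ℝ) 1, F p =
      ∫ p, F p ∂muOmega := by
  have hi : IntegrableOn (fun x => ∫ y in Ioo (0 : ℝ) 1, F (x, y)) (Ioo 0 1) := by
    rw [muOmega_eq_prod] at hF
    exact hF.integral_prod_left
  rw [integral_muOmega hF, ← sum_setIntegral_partition M.x_strictMono M.x_zero M.x_last hi]
  refine Finset.sum_congr rfl fun i _ => ?_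
  have hFi : Integrable F (volume.restrict
      (Ioo (M.x i.castSucc) (M.x i.succ) ×ˢ Ioo (0 : ℝ) 1)) :=
    hF.mono_measure (Measure.restrict_mono (prod_mono (M.Ioo_x_subset i) Subset.rfl) le_rfl)
  rw [volume_restrict_prod] at hFi ⊢
  exact integral_prod _ hFi

theorem sum_elem_strip (M : Mesh n m) {F : ℝ × ℝ → ℝ} (hF : Integrable F muOmega) (i : Fin n) :
    ∑ j, ∫ p in M.elem i j, F p =
      ∫ p in Ioo (M.x i.castSucc) (M.x i.succ) ×ˢ Ioo (0 : ℝ) 1, F p := by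
  have hFi : Integrable F (volume.restrict
      (Ioo (M.x i.castSucc) (M.x i.succ) ×ˢ Ioo (0 : ℝ) 1)) :=
    hF.mono_measure (Measure.restrict_mono (prod_mono (M.Ioo_x_subset i) Subset.rfl) le_rfl)
  have e := hFi
  rw [volume_restrict_prod] at e ⊢
  have hi : IntegrableOn (fun y => ∫ x in Ioo (M.x i.castSucc) (M.x i.succ), F (x, y)) (Ioo 0 1) :=
    e.integral_prod_right
  refine Eq.trans ?_ (integral_prod_symm _ e).symm
  rw [← sum_setIntegral_partition M.y_strictMono M.y_zero M.y_last hi]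
  refine Finset.sum_congr rfl fun j _ => ?_
  have hFj : Integrable F (volume.restrict
      (Ioo (M.x i.castSucc) (M.x i.succ) ×ˢ Ioo (M.y j.castSucc) (M.y j.succ))) :=
    hFi.mono_measure (Measure.restrict_mono (prod_mono Subset.rfl (M.Ioo_y_subset j)) le_rfl)
  rw [Mesh.elem, restrict_Icc_prod_Icc]
  rw [volume_restrict_prod] at hFj ⊢
  exact integral_prod_symm _ hFj

theorem sum_elem (M : Mesh n m) {F : ℝ × ℝ → ℝ} (hF : Integrable F muOmega) :
    ∑ i, ∑ j, ∫ p in M.elem i j, F p = ∫ p, F p ∂muOmega := by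
  rw [← sum_strip M hF]
  exact Finset.sum_congr rfl fun i _ => sum_elem_strip M hF i

theorem elem_measure_le (M : Mesh n m) (i : Fin n) (j : Fin m) :
    volume.restrict (M.elem i j) ≤ muOmega :=
  restrict_Icc_prod_Icc_le (M.x_mem _).1 (M.x_mem _).2 (M.y_mem _).1 (M.y_mem _).2

theorem measurableSet_elem (M : Mesh n m) (i : Fin n) (j : Fin m) : MeasurableSet (M.elem i j) :=
  measurableSet_Icc.prod measurableSet_Icc

theorem setIntegral_strip_eq (F : ℝ × ℝ → ℝ) {a b : ℝ} (hab : Ioo a b ⊆ Ioo 0 1) :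
    ∫ p in Ioo a b ×ˢ Ioo (0 : ℝ) 1, F p =
      ∫ p, (Ioo a b).indicator 1 p.1 * F p ∂muOmega := by
  have e : (fun q : ℝ × ℝ => (Ioo a b).indicator 1 q.1 * F q) =
      (Ioo a b ×ˢ univ).indicator F := by
    funext q
    by_cases hq : q.1 ∈ Ioo a b
    · rw [indicator_of_mem hq, indicator_of_mem (show q ∈ Ioo a b ×ˢ univ from ⟨hq, trivial⟩)]
      simp
    · rw [indicator_of_notMem hq, indicator_of_notMem fun h => hq h.1, zero_mul]
  rw [e, muOmega, setIntegral_indicator (measurableSet_Ioo.prod MeasurableSet.univ), Omega,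
    prod_inter_prod, inter_univ, inter_eq_right.2 hab]

/-! ### Consequences of the equation -/

/-- The weak form of `-∂_x (a11 wx) - ∂_y (a22 wy) = f`. -/
def IsFlux (M : Mesh n m) (a11 a22 : Fin n → Fin m → ℝ) (f wx wy : ℝ × ℝ → ℝ) : Prop :=
  ∀ φ, IsTest φ → ∑ i, ∑ j, ∫ p in M.elem i j,
    (a11 i j * wx p * dx φ p + a22 i j * wy p * dy φ p) = ∫ p in Omega, f p * φ p

theorem setIntegral_elem_swap (M : Mesh n m) (i : Fin n) (j : Fin m) (F : ℝ × ℝ → ℝ) :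
    ∫ p in M.swap.elem j i, F p.swap = ∫ p in M.elem i j, F p := by
  rw [Mesh.elem, Mesh.elem, Measure.volume_eq_prod]
  exact setIntegral_prod_swap (Icc (M.x i.castSucc) (M.x i.succ))
    (Icc (M.y j.castSucc) (M.y j.succ)) F

/-- Transfers the flux balance from rows to columns; the two coefficients change roles. -/
theorem IsFlux.swap {M : Mesh n m} {a11 a22 : Fin n → Fin m → ℝ} {f wx wy : ℝ × ℝ → ℝ}
    (h : IsFlux M a11 a22 f wx wy) :
    IsFlux M.swap (fun j i => a22 i j) (fun j i => a11 i j) (fun p => f p.swap)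
      (fun p => wy p.swap) (fun p => wx p.swap) := by
  intro φ hφ
  have e := h _ hφ.comp_swap
  have hd := hφ.comp_swap.1.differentiable (by simp)
  have hd' := hφ.1.differentiable (by simp)
  rw [Finset.sum_comm] at e
  have e2 : ∫ p in Omega, f p.swap * φ p = ∫ p in Omega, f p * φ p.swap := by
    have := integral_comp_swap_muOmega (fun p => f p * φ p.swap)
    simp only [Prod.swap_swap] at this
    exact this
  rw [e2, ← e]
  refine Finset.sum_congr rfl fun j _ => Finset.sum_congr rfl fun i _ => ?_
  rw [← setIntegral_elem_swap M i j]
  congr 1; funext p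
  have e3 := dx_comp_swap hd p
  simp only [Prod.swap_swap] at e3
  rw [dx_comp_swap hd', ← e3, Prod.swap_swap]
  ring

section Equation

variable {M : Mesh n m} {a11 a22 : Fin n → Fin m → ℝ} {f wx wy wxx wyy : ℝ × ℝ → ℝ}

/-- The residual `f + a11 wxx + a22 wyy`. -/
def residual (α β : ℝ) (f wxx wyy : ℝ × ℝ → ℝ) (p : ℝ × ℝ) : ℝ := f p + α * wxx p + β * wyy p

theorem integrable_residual (hf : MemLp f 2 muOmega) (hx : WeakX wx wxx) (hy : WeakY wy wyy)
    (α β : ℝ) : Integrable (residual α β f wxx wyy) muOmega :=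
  ((hf.integrable one_le_two).add ((hx.2.1.integrable one_le_two).const_mul α)).add
    ((hy.2.1.integrable one_le_two).const_mul β)

/-- The weak equation is tested with `ψ(x) η(y)`, where `η` lives in one row, and is integrated by
parts column by column. It contains both the equation inside the elements and the continuity of the
flux between them; different choices of `ψ` separate the two. -/
theorem IsFlux.row_identity (h : IsFlux M a11 a22 f wx wy) (hf : MemLp f 2 muOmega)
    (hx : WeakX wx wxx) (hy : WeakY wy wyy) (j : Fin m) {ψ η : ℝ → ℝ} (hψ : IsTest1 ψ)
    (hη : IsTest1 η) (hηj : tsupport η ⊆ Ioo (M.y j.castSucc) (M.y j.succ)) :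
    ∑ i, a11 i j * (traceV wx wxx η (M.x i.succ) * ψ (M.x i.succ) -
        traceV wx wxx η (M.x i.castSucc) * ψ (M.x i.castSucc)) =
      ∑ i, ∫ p in Ioo (M.x i.castSucc) (M.x i.succ) ×ˢ Ioo (0 : ℝ) 1,
        η p.2 * (ψ p.1 * residual (a11 i j) (a22 i j) f wxx wyy p) := by
  have hfi := hf.integrable one_le_two
  have hwx := hx.1.integrable one_le_two
  have hwxx := hx.2.1.integrable one_le_two
  have hwy := hy.1.integrable one_le_two
  have hwyy := hy.2.1.integrable one_le_two
  have hi : ∀ {F : ℝ × ℝ → ℝ} {k l : ℝ → ℝ}, Integrable F muOmega → IsTest1 k → IsTest1 l →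
      Integrable (fun p => F p * (k p.1 * l p.2)) muOmega := by
    intro F k l hF hk hl
    refine (((hk.isWeight.comp measurable_fst).mul
      (hl.isWeight.comp measurable_snd)).integrable_mul hF).congr
      (Eventually.of_forall fun p => mul_comm _ _)
  have hres : ∀ (i : Fin n) {F : ℝ × ℝ → ℝ}, Integrable F muOmega →
      Integrable F (volume.restrict (Ioo (M.x i.castSucc) (M.x i.succ) ×ˢ Ioo (0 : ℝ) 1)) :=
    fun i F hF => hF.mono_measure
      (Measure.restrict_mono (prod_mono (M.Ioo_x_subset i) Subset.rfl) le_rfl)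
  have e := h _ (isTest_mul hψ hη)
  simp only [dx_mul hψ hη, dy_mul hψ hη] at e
  -- Outside row `j` both `η` and its derivative vanish, so the coefficients of row `j` can be used
  -- along the whole strip.
  have e1 : ∀ i : Fin n, ∑ j', ∫ p in M.elem i j', (a11 i j' * wx p * (deriv ψ p.1 * η p.2) +
      a22 i j' * wy p * (ψ p.1 * deriv η p.2)) =
      ∫ p in Ioo (M.x i.castSucc) (M.x i.succ) ×ˢ Ioo (0 : ℝ) 1,
        (a11 i j * (wx p * (deriv ψ p.1 * η p.2)) + a22 i j * (wy p * (ψ p.1 * deriv η p.2))) := by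
    intro i
    refine Eq.trans ?_ (sum_elem_strip M (((hi hwx hψ.deriv hη).const_mul (a11 i j)).add
      ((hi hwy hψ hη.deriv).const_mul (a22 i j))) i)
    refine Finset.sum_congr rfl fun j' _ => ?_
    refine setIntegral_congr_fun (measurableSet_elem M i j') fun p hp => ?_
    by_cases hj : j = j'
    · subst hj; simp only [Pi.add_apply]; ring
    · have hn := disjoint_Icc_Ioo_of_strictMono M.y_strictMono hj hp.2
      have z1 : η p.2 = 0 := image_eq_zero_of_notMem_tsupport fun h => hn (hηj h)
      have z2 : deriv η p.2 = 0 := image_eq_zero_of_notMem_tsupport fun h =>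
        hn (hηj (tsupport_deriv_subset h))
      simp [z1, z2]
  rw [Finset.sum_congr rfl fun i _ => e1 i] at e
  change _ = ∫ p, f p * (ψ p.1 * η p.2) ∂muOmega at e
  rw [← sum_strip M (hi hfi hψ hη)] at e
  -- Integration by parts in `y` leaves no boundary term because `η` has compact support. The cut to
  -- one column is a discontinuous weight in `x`, which `WeakY.integral_weight` permits.
  have e2 : ∀ i : Fin n, ∫ p in Ioo (M.x i.castSucc) (M.x i.succ) ×ˢ Ioo (0 : ℝ) 1,
      (wy p * (ψ p.1 * deriv η p.2) + wyy p * (ψ p.1 * η p.2)) = 0 := by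
    intro i
    rw [setIntegral_strip_eq _ (M.Ioo_x_subset i), ← hy.integral_weight
      ((isWeight_indicator (s := Ioo (M.x i.castSucc) (M.x i.succ)) measurableSet_Ioo).mul
        hψ.isWeight) hη]
    congr 1; funext p; ring
  have e3 : ∀ i : Fin n, traceV wx wxx η (M.x i.succ) * ψ (M.x i.succ) -
        traceV wx wxx η (M.x i.castSucc) * ψ (M.x i.castSucc) =
      ∫ p in Ioo (M.x i.castSucc) (M.x i.succ) ×ˢ Ioo (0 : ℝ) 1,
        (wx p * (deriv ψ p.1 * η p.2) + wxx p * (ψ p.1 * η p.2)) := by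
    intro i
    rw [← hx.strip_integral hη.isWeight (M.x_mem _).1 (M.x_lt i).le (M.x_mem _).2
      (hψ.1.of_le (by norm_cast))]
    congr 1; funext p; ring
  have key : ∀ i : Fin n, a11 i j * (traceV wx wxx η (M.x i.succ) * ψ (M.x i.succ) -
        traceV wx wxx η (M.x i.castSucc) * ψ (M.x i.castSucc)) =
      (∫ p in Ioo (M.x i.castSucc) (M.x i.succ) ×ˢ Ioo (0 : ℝ) 1,
        η p.2 * (ψ p.1 * residual (a11 i j) (a22 i j) f wxx wyy p)) +
      ((∫ p in Ioo (M.x i.castSucc) (M.x i.succ) ×ˢ Ioo (0 : ℝ) 1,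
        (a11 i j * (wx p * (deriv ψ p.1 * η p.2)) + a22 i j * (wy p * (ψ p.1 * deriv η p.2)))) -
      ∫ p in Ioo (M.x i.castSucc) (M.x i.succ) ×ˢ Ioo (0 : ℝ) 1, f p * (ψ p.1 * η p.2)) := by
    intro i
    have j1 := hres i (hi hwx hψ.deriv hη)
    have j2 := hres i (hi hwxx hψ hη)
    have j3 := hres i (hi hwy hψ hη.deriv)
    have j4 := hres i (hi hwyy hψ hη)
    have j5 := hres i (hi hfi hψ hη)
    have j24 : ∀ i, Integrable (fun p => a11 i j * (wxx p * (ψ p.1 * η p.2)) +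
        a22 i j * (wyy p * (ψ p.1 * η p.2)))
        (volume.restrict (Ioo (M.x i.castSucc) (M.x i.succ) ×ˢ Ioo (0 : ℝ) 1)) := fun i =>
      ((hres i (hi hwxx hψ hη)).const_mul _).add ((hres i (hi hwyy hψ hη)).const_mul _)
    have e2' := e2 i
    rw [integral_add j3 j4] at e2'
    have er : ∫ p in Ioo (M.x i.castSucc) (M.x i.succ) ×ˢ Ioo (0 : ℝ) 1,
        η p.2 * (ψ p.1 * residual (a11 i j) (a22 i j) f wxx wyy p) =
        ∫ p in Ioo (M.x i.castSucc) (M.x i.succ) ×ˢ Ioo (0 : ℝ) 1, (f p * (ψ p.1 * η p.2) +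
          (a11 i j * (wxx p * (ψ p.1 * η p.2)) + a22 i j * (wyy p * (ψ p.1 * η p.2)))) := by
      congr 1; funext p; simp only [residual]; ring
    rw [e3 i, er, integral_add j1 j2, integral_add j5 (j24 i),
      integral_add (j1.const_mul _) (j3.const_mul _),
      integral_add (j2.const_mul _) (j4.const_mul _)]
    simp only [integral_const_mul]
    linear_combination (-(a22 i j)) * e2'
  rw [Finset.sum_congr rfl fun i _ => key i, Finset.sum_add_distrib, Finset.sum_sub_distrib, e,
    sub_self, add_zero]

/-- If `ψ` is supported inside one column, all its values at the nodes vanish and `row_identity`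
leaves only the residual of one element. The slice integral of the residual is therefore zero almost
everywhere in that column, and `ψ` may be replaced by any bounded weight. -/
theorem IsFlux.integral_residual_test (h : IsFlux M a11 a22 f wx wy) (hf : MemLp f 2 muOmega)
    (hx : WeakX wx wxx) (hy : WeakY wy wyy) (i : Fin n) (j : Fin m) {l η : ℝ → ℝ}
    (hl : IsWeight l) (hη : IsTest1 η)
    (hηj : tsupport η ⊆ Ioo (M.y j.castSucc) (M.y j.succ)) :
    ∫ p in Ioo (M.x i.castSucc) (M.x i.succ) ×ˢ Ioo (0 : ℝ) 1,
        η p.2 * (l p.1 * residual (a11 i j) (a22 i j) f wxx wyy p) = 0 := by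
  have hR := integrable_residual hf hx hy (a11 i j) (a22 i j)
  set R := residual (a11 i j) (a22 i j) f wxx wyy with hRdef
  set H : ℝ → ℝ := fun x => ∫ y in Ioo (0 : ℝ) 1, η y * R (x, y) with hH
  have hHi : IntegrableOn H (Ioo 0 1) := integrableOn_strip hR hη.isWeight
  have hS := isWeight_indicator (s := Ioo (M.x i.castSucc) (M.x i.succ)) measurableSet_Ioo
  have hint : ∀ {l : ℝ → ℝ}, IsWeight l →
      ∫ p in Ioo (M.x i.castSucc) (M.x i.succ) ×ˢ Ioo (0 : ℝ) 1, η p.2 * (l p.1 * R p) =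
        ∫ x in Ioo (0 : ℝ) 1, H x *
          ((Ioo (M.x i.castSucc) (M.x i.succ)).indicator 1 x * l x) := by
    intro l hl
    rw [setIntegral_strip_eq _ (M.Ioo_x_subset i), ← integral_mul_Ioo_prod hR hη.isWeight
      (hS.mul hl)]
    congr 1; funext p; ring
  have hH0 : ∀ᵐ x, x ∈ Ioo (M.x i.castSucc) (M.x i.succ) → H x = 0 := by
    refine ae_eq_zero_of_test (M.Ioo_x_subset i) hHi fun ψ hψ hψi => ?_
    have e := h.row_identity hf hx hy j hψ hη hηj
    have z : ∀ k, ψ (M.x k) = 0 := fun k => image_eq_zero_of_notMem_tsupport fun hk =>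
      notMem_Ioo_of_strictMono M.x_strictMono i k (hψi hk)
    simp only [z, mul_zero, sub_self, Finset.sum_const_zero] at e
    rw [Finset.sum_eq_single i, hint hψ.isWeight] at e
    · refine Eq.trans ?_ e.symm
      congr 1; funext x
      by_cases hx' : x ∈ Ioo (M.x i.castSucc) (M.x i.succ)
      · rw [indicator_of_mem hx']; simp [mul_comm]
      · rw [image_eq_zero_of_notMem_tsupport fun hk => hx' (hψi hk)]; simp
    · intro i' _ hi'
      refine setIntegral_eq_zero_of_forall_eq_zero fun p hp => ?_
      rw [image_eq_zero_of_notMem_tsupport (f := ψ) fun hk =>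
        disjoint_Icc_Ioo_of_strictMono M.x_strictMono hi'.symm (Ioo_subset_Icc_self hp.1) (hψi hk)]
      ring
    · simp
  rw [hint hl]
  rw [integral_eq_zero_of_ae]
  filter_upwards [ae_restrict_of_ae hH0] with x hx'
  by_cases hxi : x ∈ Ioo (M.x i.castSucc) (M.x i.succ)
  · simp [hx' hxi]
  · simp [indicator_of_notMem hxi]

/-- The equation holds on each element, tested with products. -/
theorem IsFlux.integral_residual (h : IsFlux M a11 a22 f wx wy) (hf : MemLp f 2 muOmega)
    (hx : WeakX wx wxx) (hy : WeakY wy wyy) (i : Fin n) (j : Fin m) {l k : ℝ → ℝ}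
    (hl : IsWeight l) (hk : IsWeight k) :
    ∫ p in M.elem i j, k p.2 * (l p.1 * residual (a11 i j) (a22 i j) f wxx wyy p) = 0 := by
  have hR := integrable_residual hf hx hy (a11 i j) (a22 i j)
  have h0 := fun η => h.integral_residual_test hf hx hy i j hl (η := η)
  set R := residual (a11 i j) (a22 i j) f wxx wyy with hRdef
  have hlR : Integrable (fun p => l p.1 * R p) muOmega :=
    (hl.comp measurable_fst).integrable_mul hR
  have hle : volume.restrict (Ioo (M.x i.castSucc) (M.x i.succ) ×ˢ Ioo (0 : ℝ) 1) ≤ muOmega :=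
    Measure.restrict_mono (prod_mono (M.Ioo_x_subset i) Subset.rfl) le_rfl
  have hlR' := hlR.mono_measure hle
  set H : ℝ → ℝ := fun y => ∫ x in Ioo (M.x i.castSucc) (M.x i.succ), l x * R (x, y) with hH
  have hint : ∀ {k : ℝ → ℝ}, IsWeight k →
      ∫ p in Ioo (M.x i.castSucc) (M.x i.succ) ×ˢ Ioo (0 : ℝ) 1, k p.2 * (l p.1 * R p) =
        ∫ y in Ioo (0 : ℝ) 1, k y * H y := by
    intro k hk
    have := (hk.comp measurable_snd).integrable_mul hlR'
    rw [volume_restrict_prod] at this ⊢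
    refine (integral_prod_symm _ this).trans ?_
    simp only [integral_const_mul, hH]
  have hHi : IntegrableOn H (Ioo 0 1) := by
    rw [volume_restrict_prod] at hlR'
    exact hlR'.integral_prod_right
  have hH0 : ∀ᵐ y, y ∈ Ioo (M.y j.castSucc) (M.y j.succ) → H y = 0 :=
    ae_eq_zero_of_test (M.Ioo_y_subset j) hHi fun η hη hηj => by
      rw [← hint hη.isWeight, h0 η hη hηj]
  rw [Mesh.elem, ← setIntegral_strip_indicator _ (M.y_mem _).1 (M.y_mem _).2]
  have hS := isWeight_indicator (s := Icc (M.y j.castSucc) (M.y j.succ)) measurableSet_Icc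
  have := hint (hS.mul hk)
  simp only [mul_assoc] at this
  rw [this, integral_eq_zero_of_ae]
  have hne : ∀ᵐ y : ℝ, y ≠ M.y j.castSucc ∧ y ≠ M.y j.succ := by
    refine Filter.Eventually.and ?_ ?_ <;> simp [ae_iff]
  filter_upwards [ae_restrict_of_ae hH0, ae_restrict_of_ae hne] with y hy' hn
  by_cases hyj : y ∈ Icc (M.y j.castSucc) (M.y j.succ)
  · simp [hy' ⟨lt_of_le_of_ne hyj.1 hn.1.symm, lt_of_le_of_ne hyj.2 hn.2⟩]
  · simp [indicator_of_notMem hyj]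

/-! ### Continuity of the normal flux across interior edges -/

/-- A Lagrange interpolation polynomial times a cutoff that equals one at all interior nodes. It
realizes arbitrary edge values of a row by a smooth test function. -/
theorem exists_isTest1_interpolating {x : Fin (n + 1) → ℝ} (hx : StrictMono x) (h0 : x 0 = 0)
    (h1 : x (Fin.last n) = 1) (v : Fin (n + 1) → ℝ) (hv0 : v 0 = 0) (hv1 : v (Fin.last n) = 0) :
    ∃ ψ, IsTest1 ψ ∧ ∀ i, ψ (x i) = v i := by
  obtain ⟨a, b, ha, hab, hb, hK⟩ := exists_Icc_of_isCompact_subset_Ioo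
    (K := x '' {i | i ≠ 0 ∧ i ≠ Fin.last n}) ((Set.toFinite _).isCompact) (by
      rintro _ ⟨i, ⟨hi0, hi1⟩, rfl⟩
      constructor
      · rw [← h0]; exact hx (Fin.pos_of_ne_zero hi0)
      · rw [← h1]; exact hx (lt_of_le_of_ne (Fin.le_last i) hi1))
  set r := max (1 / 4) (max (1 / 2 - a) (b - 1 / 2)) with hr
  have hr0 : 0 < r := lt_of_lt_of_le (by norm_num) (le_max_left _ _)
  have hr1 : r < 1 / 2 := max_lt (by norm_num) (max_lt (by linarith) (by linarith))
  let B : ContDiffBump (1 / 2 : ℝ) := ⟨r, (r + 1 / 2) / 2, hr0, by linarith⟩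
  let P := Lagrange.interpolate Finset.univ x v
  have hBs : tsupport B ⊆ Ioo 0 1 := by
    rw [B.tsupport_eq, Real.closedBall_eq_Icc]
    intro t ht
    have h1 : (1 / 2 : ℝ) - (r + 1 / 2) / 2 ≤ t := ht.1
    have h2 : t ≤ (1 / 2 : ℝ) + (r + 1 / 2) / 2 := ht.2
    constructor <;> linarith
  have ht : IsTest1 fun t => B t * P.eval t :=
    ⟨B.contDiff.mul (by simpa using P.contDiff_aeval (𝕜 := ℝ) (n := ∞)), B.hasCompactSupport.mul_right,
      (tsupport_mul_subset_left).trans hBs⟩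
  refine ⟨_, ht, fun i => ?_⟩
  by_cases hi0 : i = 0
  · subst hi0; rw [h0, hv0]; exact ht.eq_zero (by simp)
  by_cases hi1 : i = Fin.last n
  · subst hi1; rw [h1, hv1]; exact ht.eq_zero (by simp)
  have hm := hK ⟨i, ⟨hi0, hi1⟩, rfl⟩
  have e1 : B (x i) = 1 := B.one_of_mem_closedBall (by
    rw [Real.closedBall_eq_Icc]
    have h1 : 1 / 2 - a ≤ r := (le_max_left _ _).trans (le_max_right _ _)
    have h2 : b - 1 / 2 ≤ r := (le_max_right _ _).trans (le_max_right _ _)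
    exact ⟨by linarith [hm.1], by linarith [hm.2]⟩)
  rw [e1, one_mul]
  exact Lagrange.eval_interpolate_at_node v hx.injective.injOn (Finset.mem_univ i)

/-- Summation by parts in a row: the flux is continuous across the interior edges. -/
theorem IsFlux.sum_edgeV (h : IsFlux M a11 a22 f wx wy) (hf : MemLp f 2 muOmega)
    (hx : WeakX wx wxx) (hy : WeakY wy wyy) (j : Fin m) (v : Fin (n + 1) → ℝ) (hv0 : v 0 = 0)
    (hv1 : v (Fin.last n) = 0) :
    ∑ i, a11 i j * (edgeV wx wxx (M.y j.castSucc) (M.y j.succ) (M.x i.succ) * v i.succ -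
      edgeV wx wxx (M.y j.castSucc) (M.y j.succ) (M.x i.castSucc) * v i.castSucc) = 0 := by
  obtain ⟨ψ, hψ, hψv⟩ := exists_isTest1_interpolating M.x_strictMono M.x_zero M.x_last v hv0 hv1
  have hwx := hx.1.integrable one_le_two
  have hwxx := hx.2.1.integrable one_le_two
  set T : ℝ → ℝ → ℝ := fun t y => ∫ x in Ioo (0 : ℝ) 1, (wx (x, y) + traceKernel t x * wxx (x, y))
    with hT
  have hTi : ∀ t, IntegrableOn (T t) (Ioo 0 1) := by
    intro t
    have := integrable_trace hwx hwxx t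
    rw [muOmega_eq_prod] at this
    exact this.integral_prod_right
  have hTk : ∀ {k : ℝ → ℝ} (t : ℝ), IsWeight k →
      traceV wx wxx k t = ∫ y in Ioo (0 : ℝ) 1, k y * T t y := by
    intro k t hk
    rw [traceV, integral_muOmega_symm ((hk.comp measurable_snd).integrable_mul
      (integrable_trace hwx hwxx t))]
    simp only [integral_const_mul, hT]
  set J : ℝ → ℝ := fun y => ∑ i, a11 i j * (T (M.x i.succ) y * v i.succ -
    T (M.x i.castSucc) y * v i.castSucc) with hJ
  have hJi : IntegrableOn J (Ioo 0 1) := integrable_finsetSum _ fun i _ =>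
    (((hTi _).mul_const _).sub ((hTi _).mul_const _)).const_mul _
  have hJk : ∀ {k : ℝ → ℝ}, IsWeight k →
      ∫ y in Ioo (0 : ℝ) 1, k y * J y = ∑ i, a11 i j * (traceV wx wxx k (M.x i.succ) * v i.succ -
        traceV wx wxx k (M.x i.castSucc) * v i.castSucc) := by
    intro k hk
    simp only [hJ, Finset.mul_sum]
    rw [integral_finsetSum]
    · refine Finset.sum_congr rfl fun i _ => ?_
      rw [hTk _ hk, hTk _ hk, ← integral_mul_const, ← integral_mul_const, ← integral_sub
        ((hk.integrable_mul (hTi _)).mul_const _) ((hk.integrable_mul (hTi _)).mul_const _),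
        ← integral_const_mul]
      congr 1; funext y; ring
    · exact fun i _ => hk.integrable_mul
        ((((hTi _).mul_const _).sub ((hTi _).mul_const _)).const_mul _)
  have hJ0 : ∀ᵐ y, y ∈ Ioo (M.y j.castSucc) (M.y j.succ) → J y = 0 := by
    refine ae_eq_zero_of_test (M.Ioo_y_subset j) hJi fun η hη hηj => ?_
    rw [hJk hη.isWeight]
    have e := h.row_identity hf hx hy j hψ hη hηj
    simp only [hψv] at e
    rw [e]
    -- The residual is already known to vanish in each element, so `row_identity` now says that the
    -- weighted jumps of the flux sum to zero.
    exact Finset.sum_eq_zero fun i _ => h.integral_residual_test hf hx hy i j hψ.isWeight hη hηj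
  have hS := isWeight_indicator (s := Icc (M.y j.castSucc) (M.y j.succ)) measurableSet_Icc
  simp only [edgeV]
  rw [← hJk hS, integral_eq_zero_of_ae]
  have hne : ∀ᵐ y : ℝ, y ≠ M.y j.castSucc ∧ y ≠ M.y j.succ := by
    refine Filter.Eventually.and ?_ ?_ <;> simp [ae_iff]
  filter_upwards [ae_restrict_of_ae hJ0, ae_restrict_of_ae hne] with y hy' hn
  by_cases hyj : y ∈ Icc (M.y j.castSucc) (M.y j.succ)
  · simp [hy' ⟨lt_of_le_of_ne hyj.1 hn.1.symm, lt_of_le_of_ne hyj.2 hn.2⟩]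
  · simp [indicator_of_notMem hyj]

end Equation

/-! ### Estimates on a rectangle -/

/-- Cauchy–Schwarz: the integral of `(F - t g)²` is nonnegative, `g²` is replaced by its bound `B²`
and the total mass by `A`, and `t` minimizes the resulting quadratic. -/
theorem sq_integral_mul_le {α : Type*} [MeasurableSpace α] {μ : Measure α} [IsFiniteMeasure μ]
    {F g : α → ℝ} (hF : MemLp F 2 μ) (hg : AEStronglyMeasurable g μ) {B A : ℝ} (hB : 0 < B)
    (hA : 0 < A) (hgB : ∀ᵐ p ∂μ, |g p| ≤ B) (hμ : μ.real univ ≤ A) :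
    (∫ p, F p * g p ∂μ) ^ 2 ≤ B ^ 2 * A * ∫ p, F p ^ 2 ∂μ := by
  set S := ∫ p, F p * g p ∂μ with hS
  have hD : 0 < B ^ 2 * A := by positivity
  set t := S / (B ^ 2 * A) with ht
  have hi1 : Integrable (fun p => F p ^ 2) μ := hF.integrable_sq
  have hi2 : Integrable (fun p => F p * g p) μ :=
    (hF.integrable one_le_two).mul_bdd hg hgB
  have h0 : 0 ≤ ∫ p, (F p ^ 2 - 2 * t * (F p * g p) + t ^ 2 * B ^ 2) ∂μ := by
    refine integral_nonneg_of_ae ?_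
    filter_upwards [hgB] with p hp
    have h1 : g p ^ 2 ≤ B ^ 2 := by rw [← sq_abs]; gcongr
    have h2 : t ^ 2 * g p ^ 2 ≤ t ^ 2 * B ^ 2 := by gcongr
    simp only [Pi.zero_apply]
    nlinarith [sq_nonneg (F p - t * g p)]
  have e1 : ∫ p, (F p ^ 2 - 2 * t * (F p * g p) + t ^ 2 * B ^ 2) ∂μ =
      (∫ p, F p ^ 2 ∂μ) - 2 * t * S + t ^ 2 * B ^ 2 * μ.real univ := by
    rw [integral_add (f := fun p => F p ^ 2 - 2 * t * (F p * g p)) (hi1.sub (hi2.const_mul _))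
      (integrable_const _), integral_sub hi1 (hi2.const_mul _), integral_const_mul, integral_const,
      smul_eq_mul]
    ring
  rw [e1] at h0
  have h3 : t ^ 2 * B ^ 2 * μ.real univ ≤ t ^ 2 * B ^ 2 * A := by gcongr
  have h4 : 0 ≤ (∫ p, F p ^ 2 ∂μ) - 2 * t * S + t ^ 2 * (B ^ 2 * A) := by linarith
  have h5 : t * (B ^ 2 * A) = S := div_mul_cancel₀ _ hD.ne'
  have h6 : 0 ≤ (B ^ 2 * A) * ((∫ p, F p ^ 2 ∂μ) - 2 * t * S + t ^ 2 * (B ^ 2 * A)) :=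
    mul_nonneg hD.le h4
  have h7 : (B ^ 2 * A) * ((∫ p, F p ^ 2 ∂μ) - 2 * t * S + t ^ 2 * (B ^ 2 * A)) =
      B ^ 2 * A * (∫ p, F p ^ 2 ∂μ) - S ^ 2 := by
    rw [← h5]; ring
  linarith

/-- A rectangle in the closed unit square. -/
structure IsRect (a b c d : ℝ) : Prop where
  ha : 0 ≤ a
  hab : a < b
  hb : b ≤ 1
  hc : 0 ≤ c
  hcd : c < d
  hd : d ≤ 1

theorem IsRect.swap {a b c d : ℝ} (h : IsRect a b c d) : IsRect c d a b :=
  ⟨h.hc, h.hcd, h.hd, h.ha, h.hab, h.hb⟩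

theorem IsRect.memLp {a b c d : ℝ} (hr : IsRect a b c d)
    {F : ℝ × ℝ → ℝ} (hF : MemLp F 2 muOmega) :
    MemLp F 2 (volume.restrict (Icc a b ×ˢ Icc c d)) :=
  hF.mono_measure (restrict_Icc_prod_Icc_le hr.ha hr.hb hr.hc hr.hd)

theorem IsRect.measureReal {a b c d : ℝ} (hr : IsRect a b c d) :
    (volume : Measure (ℝ × ℝ)).real (Icc a b ×ˢ Icc c d) =
    (b - a) * (d - c) := by
  rw [Measure.volume_eq_prod, measureReal_prod_prod, Real.volume_real_Icc_of_le hr.hab.le,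
    Real.volume_real_Icc_of_le hr.hcd.le]

theorem IsRect.integrable_mul {a b c d : ℝ} (hr : IsRect a b c d)
    {F : ℝ × ℝ → ℝ} (hF : MemLp F 2 muOmega) {p : ℝ → ℝ}
    (hp : Continuous p) :
    Integrable (fun q => F q * p q.1) (volume.restrict (Icc a b ×ˢ Icc c d)) := by
  have : IsFiniteMeasure ((volume : Measure (ℝ × ℝ)).restrict (Icc a b ×ˢ Icc c d)) :=
    isFiniteMeasure_of_le _ (restrict_Icc_prod_Icc_le hr.ha hr.hb hr.hc hr.hd)
  obtain ⟨C, hC⟩ := isCompact_Icc.exists_bound_of_continuousOn (s := Icc a b) hp.continuousOn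
  refine ((hr.memLp hF).integrable one_le_two).mul_bdd (c := C)
    (hp.comp continuous_fst).aestronglyMeasurable ?_
  filter_upwards [ae_restrict_mem (measurableSet_Icc.prod measurableSet_Icc)] with q hq
    using hC _ hq.1

theorem IsRect.sq_integral_le {a b c d : ℝ} (hr : IsRect a b c d)
    {F : ℝ × ℝ → ℝ} (hF : MemLp F 2 muOmega) {p : ℝ → ℝ}
    (hp : Continuous p) {B : ℝ} (hB : 0 < B) (hpB : ∀ x ∈ Icc a b, |p x| ≤ B) :
    (∫ q in Icc a b ×ˢ Icc c d, F q * p q.1) ^ 2 ≤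
      B ^ 2 * ((b - a) * (d - c)) * ∫ q in Icc a b ×ˢ Icc c d, F q ^ 2 := by
  have : IsFiniteMeasure ((volume : Measure (ℝ × ℝ)).restrict (Icc a b ×ˢ Icc c d)) :=
    isFiniteMeasure_of_le _ (restrict_Icc_prod_Icc_le hr.ha hr.hb hr.hc hr.hd)
  refine sq_integral_mul_le (hr.memLp hF) (hp.comp continuous_fst).aestronglyMeasurable hB
    (mul_pos (sub_pos.2 hr.hab) (sub_pos.2 hr.hcd)) ?_ ?_
  · filter_upwards [ae_restrict_mem (measurableSet_Icc.prod measurableSet_Icc)] with q hq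
      using hpB _ hq.1
  · rw [measureReal_restrict_apply_univ, hr.measureReal]

theorem WeakX.rect {a b c d : ℝ} (hr : IsRect a b c d)
    {w z : ℝ × ℝ → ℝ} (h : WeakX w z) {p p' : ℝ → ℝ}
    (hp : ContDiff ℝ 1 p) (hp' : ∀ x, HasDerivAt p (p' x) x) :
    (∫ q in Icc a b ×ˢ Icc c d, w q * p' q.1) + ∫ q in Icc a b ×ˢ Icc c d, z q * p q.1 =
      edgeV w z c d b * p b - edgeV w z c d a * p a := by
  have e : deriv p = p' := funext fun x => (hp' x).deriv
  have := h.rect_integral hr.ha hr.hab.le hr.hb hr.hc hr.hd hp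
  rw [e] at this
  rw [← this, integral_add]
  · exact hr.integrable_mul h.1 (e ▸ hp.continuous_deriv le_rfl)
  · exact hr.integrable_mul h.2.1 hp.continuous

theorem WeakX.edgeV_sub {a b c d : ℝ} (hr : IsRect a b c d)
    {w z : ℝ × ℝ → ℝ} (h : WeakX w z) :
    edgeV w z c d b - edgeV w z c d a = ∫ q in Icc a b ×ˢ Icc c d, z q := by
  have := WeakX.rect hr h (p := fun _ => 1) (p' := fun _ => 0) contDiff_const
    (fun x => hasDerivAt_const x 1)
  simp only [mul_zero, mul_one, integral_zero, zero_add] at this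
  exact this.symm

/-- With a weight that vanishes on one edge, this expresses the mean over the opposite edge by
integrals over the rectangle. -/
theorem WeakX.edgeV_affine {a b c d : ℝ} (hr : IsRect a b c d)
    {w z : ℝ × ℝ → ℝ} (h : WeakX w z) (s β : ℝ) :
    β * (∫ q in Icc a b ×ˢ Icc c d, w q) + (∫ q in Icc a b ×ˢ Icc c d, z q * (s + β * q.1)) =
      edgeV w z c d b * (s + β * b) - edgeV w z c d a * (s + β * a) := by
  have := WeakX.rect hr h (p := fun x => s + β * x) (p' := fun _ => β) (by fun_prop)
    (fun x => by simpa using ((hasDerivAt_id x).const_mul β).const_add s)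
  rw [← this, integral_mul_const]
  ring

/-- The weight on the right is minus the primitive of `x - (a + b) / 2` that vanishes at both ends.
Edge terms disappear and two powers of the width are gained. -/
theorem WeakX.integral_moment {a b c d : ℝ} (hr : IsRect a b c d)
    {w z : ℝ × ℝ → ℝ} (h : WeakX w z) :
    ∫ q in Icc a b ×ˢ Icc c d, w q * (q.1 - (a + b) / 2) =
      ∫ q in Icc a b ×ˢ Icc c d, z q * ((b - a) ^ 2 / 8 - (q.1 - (a + b) / 2) ^ 2 / 2) := by
  have hd : ∀ x, HasDerivAt (fun x : ℝ => (x - (a + b) / 2) ^ 2 / 2 - (b - a) ^ 2 / 8)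
      (x - (a + b) / 2) x := by
    intro x
    have := ((((hasDerivAt_id x).sub_const ((a + b) / 2)).pow 2).div_const 2).sub_const
      ((b - a) ^ 2 / 8)
    refine this.congr_deriv ?_
    simp only [id, Nat.cast_ofNat, Nat.add_one_sub_one, pow_one]; ring
  have := WeakX.rect hr h (p := fun x => (x - (a + b) / 2) ^ 2 / 2 - (b - a) ^ 2 / 8)
    (p' := fun x => x - (a + b) / 2) (by fun_prop) hd
  have e1 : (b - (a + b) / 2) ^ 2 / 2 - (b - a) ^ 2 / 8 = 0 := by ring
  have e2 : (a - (a + b) / 2) ^ 2 / 2 - (b - a) ^ 2 / 8 = 0 := by ring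
  rw [e1, e2, mul_zero, mul_zero, sub_zero] at this
  rw [eq_neg_of_add_eq_zero_left this, ← integral_neg]
  congr 1; funext q; ring

/-- The quadratic weight has mean `(b - a)² / 12`. Its deviation from that mean has a cubic
primitive vanishing at both ends, which gives the third-order remainder of the trapezoidal rule. -/
theorem WeakX.integral_second_moment {a b c d : ℝ} (hr : IsRect a b c d)
    {w z : ℝ × ℝ → ℝ} (h : WeakX w z) :
    ∫ q in Icc a b ×ˢ Icc c d, w q * ((b - a) ^ 2 / 8 - (q.1 - (a + b) / 2) ^ 2 / 2) =
      (b - a) ^ 2 / 12 * (∫ q in Icc a b ×ˢ Icc c d, w q) -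
      ∫ q in Icc a b ×ˢ Icc c d,
        z q * ((b - a) ^ 2 / 24 * (q.1 - (a + b) / 2) - (q.1 - (a + b) / 2) ^ 3 / 6) := by
  have hd : ∀ x, HasDerivAt
      (fun x : ℝ => (b - a) ^ 2 / 24 * (x - (a + b) / 2) - (x - (a + b) / 2) ^ 3 / 6)
      ((b - a) ^ 2 / 8 - (x - (a + b) / 2) ^ 2 / 2 - (b - a) ^ 2 / 12) x := by
    intro x
    have h0 := (hasDerivAt_id x).sub_const ((a + b) / 2)
    have := (h0.const_mul ((b - a) ^ 2 / 24)).sub ((h0.pow 3).div_const 6)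
    refine this.congr_deriv ?_
    simp only [id, Nat.cast_ofNat, Nat.add_one_sub_one]; ring
  have := WeakX.rect hr h (by fun_prop) hd
  have e1 : (b - a) ^ 2 / 24 * (b - (a + b) / 2) - (b - (a + b) / 2) ^ 3 / 6 = 0 := by ring
  have e2 : (b - a) ^ 2 / 24 * (a - (a + b) / 2) - (a - (a + b) / 2) ^ 3 / 6 = 0 := by ring
  rw [e1, e2, mul_zero, mul_zero, sub_zero] at this
  have i1 := hr.integrable_mul h.1
    (p := fun x => (b - a) ^ 2 / 8 - (x - (a + b) / 2) ^ 2 / 2) (by fun_prop)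
  have i2 := hr.integrable_mul h.1 (p := fun _ => (b - a) ^ 2 / 12) (by fun_prop)
  have e3 : ∫ q in Icc a b ×ˢ Icc c d,
      w q * ((b - a) ^ 2 / 8 - (q.1 - (a + b) / 2) ^ 2 / 2 - (b - a) ^ 2 / 12) =
      (∫ q in Icc a b ×ˢ Icc c d, w q * ((b - a) ^ 2 / 8 - (q.1 - (a + b) / 2) ^ 2 / 2)) -
        (b - a) ^ 2 / 12 * ∫ q in Icc a b ×ˢ Icc c d, w q := by
    rw [mul_comm ((b - a) ^ 2 / 12), ← integral_mul_const, ← integral_sub i1 i2]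
    congr 1; funext q; ring
  rw [e3] at this
  linarith

theorem WeakX.sq_moment_le {a b c d : ℝ} (hr : IsRect a b c d)
    {w z : ℝ × ℝ → ℝ} (h : WeakX w z) :
    (∫ q in Icc a b ×ˢ Icc c d, w q * (q.1 - (a + b) / 2)) ^ 2 ≤
      (b - a) ^ 4 * ((b - a) * (d - c)) * ∫ q in Icc a b ×ˢ Icc c d, z q ^ 2 := by
  have hpos : 0 < b - a := sub_pos.2 hr.hab
  rw [WeakX.integral_moment hr h]
  have := hr.sq_integral_le h.2.1
    (p := fun x => (b - a) ^ 2 / 8 - (x - (a + b) / 2) ^ 2 / 2) (by fun_prop)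
    (B := (b - a) ^ 2) (by positivity) (fun x hx => by
      have h1 : (x - (a + b) / 2) ^ 2 ≤ ((b - a) / 2) ^ 2 :=
        sq_le_sq' (by linarith [hx.1]) (by linarith [hx.2])
      rw [abs_le]
      constructor <;> nlinarith [sq_nonneg (x - (a + b) / 2)])
  rwa [← pow_mul] at this

/-! ### Quadrature rules with remainders in third derivatives -/

/-- Means of `u` and of its derivatives over a rectangle and over two opposite edges, with the
errors of the quadrature rules. `h` is the distance of the edges, `A` the area; `s` stands for the
second tangential derivative, `f` for the normal derivative. -/
structure EdgeRules (h A uW uE Qu fW fE Qux Quxx sW sE Qs k J N : ℝ) : Prop where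
  grad : uE - uW = h * Qux
  tang : sE - sW = h * k
  tang_le : k ^ 2 * A ≤ N
  fluxE : (fE - Qux - h / 2 * Quxx) ^ 2 * A ≤ h ^ 4 * N
  fluxW : (fW - Qux + h / 2 * Quxx) ^ 2 * A ≤ h ^ 4 * N
  meanE : (sE - Qs) ^ 2 * A ≤ h ^ 2 * N
  meanW : (sW - Qs) ^ 2 * A ≤ h ^ 2 * N
  trapezoid : (uE + uW - 2 * Qu - h ^ 2 / 6 * Quxx) ^ 2 * A ≤ h ^ 6 * N
  moment : J ^ 2 ≤ h ^ 4 * A * N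

theorem sq_div_mul_le {I A K N : ℝ} (hA : 0 < A) (h : I ^ 2 ≤ K * A * N) :
    (I / A) ^ 2 * A ≤ K * N := by
  rw [div_pow, div_mul_eq_mul_div, div_le_iff₀ (by positivity)]
  nlinarith

/-- Each edge mean is the mean over the rectangle plus a weighted integral of the `x`-derivative
(`E`, `W`), with a weight that vanishes on the opposite edge. Splitting the weight at the midpoint
isolates the leading term; the rest is a centred moment and is integrated by parts once or twice
more. -/
theorem edgeRules_of_weakX {a b c d : ℝ} (hr : IsRect a b c d) {u ux uxx uxxx uyy uxyy : ℝ × ℝ → ℝ}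
    (h1 : WeakX u ux) (h2 : WeakX ux uxx) (h3 : WeakX uxx uxxx) (h4 : WeakX uyy uxyy) {N : ℝ}
    (hN1 : ∫ q in Icc a b ×ˢ Icc c d, uxxx q ^ 2 ≤ N)
    (hN2 : ∫ q in Icc a b ×ˢ Icc c d, uxyy q ^ 2 ≤ N) :
    EdgeRules (b - a) ((b - a) * (d - c))
      (edgeV u ux c d a / (d - c)) (edgeV u ux c d b / (d - c))
      ((∫ q in Icc a b ×ˢ Icc c d, u q) / ((b - a) * (d - c)))
      (edgeV ux uxx c d a / (d - c)) (edgeV ux uxx c d b / (d - c))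
      ((∫ q in Icc a b ×ˢ Icc c d, ux q) / ((b - a) * (d - c)))
      ((∫ q in Icc a b ×ˢ Icc c d, uxx q) / ((b - a) * (d - c)))
      (edgeV uyy uxyy c d a / (d - c)) (edgeV uyy uxyy c d b / (d - c))
      ((∫ q in Icc a b ×ˢ Icc c d, uyy q) / ((b - a) * (d - c)))
      ((∫ q in Icc a b ×ˢ Icc c d, uxyy q) / ((b - a) * (d - c)))
      (∫ q in Icc a b ×ˢ Icc c d, uyy q * (q.1 - (a + b) / 2)) N := by
  have hx : 0 < b - a := sub_pos.2 hr.hab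
  have hy : 0 < d - c := sub_pos.2 hr.hcd
  have hA : 0 < (b - a) * (d - c) := mul_pos hx hy
  have E : ∀ {w z : ℝ × ℝ → ℝ}, WeakX w z → edgeV w z c d b / (d - c) =
      (∫ q in Icc a b ×ˢ Icc c d, w q) / ((b - a) * (d - c)) +
      (∫ q in Icc a b ×ˢ Icc c d, z q * (q.1 - a)) / ((b - a) * (d - c)) := by
    intro w z h
    have := WeakX.edgeV_affine hr h (-a) 1
    simp only [one_mul, neg_add_eq_sub, sub_self, mul_zero, sub_zero] at this
    rw [← add_div, this]; field_simp
  have W : ∀ {w z : ℝ × ℝ → ℝ}, WeakX w z → edgeV w z c d a / (d - c) =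
      (∫ q in Icc a b ×ˢ Icc c d, w q) / ((b - a) * (d - c)) +
      (∫ q in Icc a b ×ˢ Icc c d, z q * (q.1 - b)) / ((b - a) * (d - c)) := by
    intro w z h
    have := WeakX.edgeV_affine hr h (-b) 1
    simp only [one_mul, neg_add_eq_sub, sub_self, mul_zero, zero_sub] at this
    rw [← add_div, this]; field_simp; ring
  have split : ∀ {z : ℝ × ℝ → ℝ} (s : ℝ), MemLp z 2 muOmega →
      ∫ q in Icc a b ×ˢ Icc c d, z q * (q.1 - s) =
        (∫ q in Icc a b ×ˢ Icc c d, z q * (q.1 - (a + b) / 2)) +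
          ((a + b) / 2 - s) * ∫ q in Icc a b ×ˢ Icc c d, z q := by
    intro z s hz
    have i1 := hr.integrable_mul hz (p := fun x => x - (a + b) / 2) (by fun_prop)
    have i2 := hr.integrable_mul hz (p := fun _ => (a + b) / 2 - s) (by fun_prop)
    rw [mul_comm ((a + b) / 2 - s), ← integral_mul_const, ← integral_add i1 i2]
    congr 1; funext q; ring
  have hN0 : 0 ≤ N := le_trans (integral_nonneg fun q => sq_nonneg _) hN1
  have hm := WeakX.sq_moment_le hr h3
  have hm' : (∫ q in Icc a b ×ˢ Icc c d, uxx q * (q.1 - (a + b) / 2)) ^ 2 ≤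
      (b - a) ^ 4 * ((b - a) * (d - c)) * N := hm.trans (by gcongr)
  refine ⟨?_, ?_, ?_, ?_, ?_, ?_, ?_, ?_, ?_⟩
  · rw [← sub_div, WeakX.edgeV_sub hr h1]; field_simp
  · rw [← sub_div, WeakX.edgeV_sub hr h4]; field_simp
  · have := hr.sq_integral_le h4.2.1 (p := fun _ => 1) (by fun_prop) (B := 1) one_pos (by simp)
    simp only [mul_one] at this
    have := sq_div_mul_le (K := 1) (N := N) hA (this.trans (by
      rw [one_pow]; gcongr))
    simpa using this
  · have e : ∀ Q I X A : ℝ, Q + (I + ((a + b) / 2 - a) * X) / A - Q - (b - a) / 2 * (X / A) =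
        I / A := by intros; ring
    rw [E h2, split a h2.2.1, e]
    exact sq_div_mul_le hA hm'
  · have e : ∀ Q I X A : ℝ, Q + (I + ((a + b) / 2 - b) * X) / A - Q + (b - a) / 2 * (X / A) =
        I / A := by intros; ring
    rw [W h2, split b h2.2.1, e]
    exact sq_div_mul_le hA hm'
  · rw [E h4, add_sub_cancel_left]
    refine sq_div_mul_le hA ?_
    refine (hr.sq_integral_le h4.2.1 (p := fun x => x - a) (by fun_prop) hx
      (fun x hx => ?_)).trans (by gcongr)
    rw [abs_of_nonneg (by linarith [hx.1])]; linarith [hx.2]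
  · rw [W h4, add_sub_cancel_left]
    refine sq_div_mul_le hA ?_
    refine (hr.sq_integral_le h4.2.1 (p := fun x => x - b) (by fun_prop) hx
      (fun x hx => ?_)).trans (by gcongr)
    rw [abs_of_nonpos (by linarith [hx.2])]; linarith [hx.1]
  · rw [E h1, W h1, split a h1.2.1, split b h1.2.1, WeakX.integral_moment hr h2,
      WeakX.integral_second_moment hr h3]
    have hrb := hr.sq_integral_le h3.2.1
      (p := fun x => (b - a) ^ 2 / 24 * (x - (a + b) / 2) - (x - (a + b) / 2) ^ 3 / 6)
      (by fun_prop) (B := (b - a) ^ 3 / 2) (by positivity) (fun x hx' => by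
        have h0 : |x - (a + b) / 2| ≤ (b - a) / 2 := by
          rw [abs_le]; constructor <;> linarith [hx'.1, hx'.2]
        have e : (b - a) ^ 2 / 24 * (x - (a + b) / 2) - (x - (a + b) / 2) ^ 3 / 6 =
            ((b - a) ^ 2 / 24 - (x - (a + b) / 2) ^ 2 / 6) * (x - (a + b) / 2) := by ring
        have h1 : (x - (a + b) / 2) ^ 2 ≤ ((b - a) / 2) ^ 2 := by
          rw [← sq_abs]; gcongr
        have h2 : |(b - a) ^ 2 / 24 - (x - (a + b) / 2) ^ 2 / 6| ≤ (b - a) ^ 2 := by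
          rw [abs_le]; constructor <;> nlinarith [sq_nonneg (x - (a + b) / 2)]
        rw [e, abs_mul]
        calc _ ≤ (b - a) ^ 2 * ((b - a) / 2) := by gcongr
          _ = (b - a) ^ 3 / 2 := by ring)
    set r := ∫ q in Icc a b ×ˢ Icc c d, uxxx q *
      ((b - a) ^ 2 / 24 * (q.1 - (a + b) / 2) - (q.1 - (a + b) / 2) ^ 3 / 6) with hrdef
    have : (-2 * r) ^ 2 ≤ (b - a) ^ 6 * ((b - a) * (d - c)) * N := by
      have : (-2 * r) ^ 2 = 4 * r ^ 2 := by ring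
      rw [this]
      calc 4 * r ^ 2 ≤ 4 * (((b - a) ^ 3 / 2) ^ 2 * ((b - a) * (d - c)) *
            ∫ q in Icc a b ×ˢ Icc c d, uxxx q ^ 2) := by gcongr
        _ = (b - a) ^ 6 * ((b - a) * (d - c)) * ∫ q in Icc a b ×ˢ Icc c d, uxxx q ^ 2 := by ring
        _ ≤ _ := by gcongr
    have e : ∀ Q Y X A : ℝ, Q + ((b - a) ^ 2 / 12 * Y - r + ((a + b) / 2 - a) * X) / A +
        (Q + ((b - a) ^ 2 / 12 * Y - r + ((a + b) / 2 - b) * X) / A) - 2 * Q -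
        (b - a) ^ 2 / 6 * (Y / A) = (-2 * r) / A := by intros; ring
    rw [e]
    exact sq_div_mul_le hA this
  · exact (WeakX.sq_moment_le hr h4).trans (by gcongr)

/-! ### Algebra on one element -/

theorem young_weighted {κ w : ℝ} (hκ : 0 < κ) (hw : 0 < w) (x y : ℝ) :
    x * y ≤ κ / 4 * (w * x ^ 2) + y ^ 2 / (κ * w) := by
  have h : κ / 4 * (w * x ^ 2) + y ^ 2 / (κ * w) - x * y =
      (κ * w * x / 2 - y) ^ 2 / (κ * w) := by field_simp; ring
  have : 0 ≤ (κ * w * x / 2 - y) ^ 2 / (κ * w) := by positivity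
  linarith

/-- The constant in the estimate of the stabilizer on an edge. -/
noncomputable def edgeConst (ρ Λ : ℝ) : ℝ := 3 * (Λ ^ 2 / 4 + Λ ^ 2 + 13 / 4 * ρ ^ 2)

/-- The hypotheses carry the area `hx * hy` and powers of `hx` alone. Cancelling one `hx` leaves the
length weight `hy` of the edge, so no bound on `hx / hy` enters. -/
theorem edge_residual_le {hx hy h X Y D a a' ρ Λ N : ℝ} (hx0 : 0 < hx) (hy0 : 0 < hy)
    (hxh : hx ≤ h) (hyh : hy ≤ h) (ha : 0 ≤ a) (haL : a ≤ Λ) (ha' : 0 ≤ a') (haL' : a' ≤ Λ)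
    (hN : 0 ≤ N) (hX : X ^ 2 * (hx * hy) ≤ hx ^ 2 * N) (hY : Y ^ 2 * (hx * hy) ≤ hx ^ 4 * N)
    (hD : D ^ 2 * (hx * hy) ≤ 13 * hx ^ 6 * N) :
    hy * h * (a * (hy / 2) * X + a' * Y + ρ * h⁻¹ / 2 * D) ^ 2 ≤ edgeConst ρ Λ * h ^ 4 * N := by
  have h0 : 0 < h := hx0.trans_le hxh
  have hX' : hy * X ^ 2 ≤ h * N := by
    have : hx * (hy * X ^ 2) ≤ hx * (hx * N) := by nlinarith
    exact (le_of_mul_le_mul_left this hx0).trans (by gcongr)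
  have hY' : hy * Y ^ 2 ≤ h ^ 3 * N := by
    have : hx * (hy * Y ^ 2) ≤ hx * (hx ^ 3 * N) := by nlinarith
    exact (le_of_mul_le_mul_left this hx0).trans (by gcongr)
  have hD' : hy * D ^ 2 ≤ 13 * h ^ 5 * N := by
    have : hx * (hy * D ^ 2) ≤ hx * (13 * hx ^ 5 * N) := by nlinarith
    exact (le_of_mul_le_mul_left this hx0).trans (by gcongr)
  have h3 : ∀ x y z : ℝ, (x + y + z) ^ 2 ≤ 3 * (x ^ 2 + y ^ 2 + z ^ 2) := by
    intro x y z
    linarith [sq_nonneg (x - y), sq_nonneg (y - z), sq_nonneg (x - z)]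
  calc hy * h * (a * (hy / 2) * X + a' * Y + ρ * h⁻¹ / 2 * D) ^ 2
      ≤ hy * h * (3 * ((a * (hy / 2) * X) ^ 2 + (a' * Y) ^ 2 + (ρ * h⁻¹ / 2 * D) ^ 2)) := by
        gcongr; exact h3 _ _ _
    _ = 3 * h * (a ^ 2 * hy ^ 2 / 4 * (hy * X ^ 2) + a' ^ 2 * (hy * Y ^ 2) +
          ρ ^ 2 * h⁻¹ ^ 2 / 4 * (hy * D ^ 2)) := by ring
    _ ≤ 3 * h * (Λ ^ 2 * h ^ 2 / 4 * (h * N) + Λ ^ 2 * (h ^ 3 * N) +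
          ρ ^ 2 * h⁻¹ ^ 2 / 4 * (13 * h ^ 5 * N)) := by gcongr
    _ = edgeConst ρ Λ * h ^ 4 * N := by unfold edgeConst; field_simp

section Element

variable {ρ Λ h hx hy a11 a22 N : ℝ}
  {uW uE uS uN Qu fW fE fS fN Qux Quy Quxx Quyy sW sE tS tN k k' J J' : ℝ}

/-- The residual of the stabilizer on an edge with normal derivative `f` and tangential second
derivative `s`, if `u₀` has the mean `μ` on the edge; `l` is the length of the edge. -/
noncomputable def edgeResidual (ρ h l a a' u s f Qf μ : ℝ) : ℝ :=
  ρ * h⁻¹ * (u + 1 / 12 * l * (l - 6 * ρ⁻¹ * a * h) * s - μ) - a' * (f - Qf)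

/-- For both pairs of opposite edges the values `u + l²/12 s` add up, to leading order, to `2 Qu +
hx²/6 Quxx + hy²/6 Quyy`: one of the last two terms comes from the trapezoidal rule, the other from
the correction. Subtracting the same `κ` on all four edges preserves this balance. With the given
`κ`, the term with `ρ⁻¹` in the edge value cancels the tangential half of `ρ h⁻¹ κ`, while the
normal half matches the leading part of `a' (f - Qf)`. -/
theorem exists_edgeMeans_of_le (hρ : 0 < ρ) (hx0 : 0 < hx) (hy0 : 0 < hy) (hxh : hx ≤ h)
    (hyh : hy ≤ h) (h1 : 0 ≤ a11) (h1L : a11 ≤ Λ) (h2 : 0 ≤ a22) (h2L : a22 ≤ Λ) (hN : 0 ≤ N)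
    (hX : EdgeRules hx (hx * hy) uW uE Qu fW fE Qux Quxx sW sE Quyy k J N)
    (hY : EdgeRules hy (hx * hy) uS uN Qu fS fN Quy Quyy tS tN Quxx k' J' N) (hle : hy ≤ hx) :
    ∃ mW mE mS mN : ℝ, mW + mE = mS + mN ∧
      hy * h * edgeResidual ρ h hy a22 a11 uE sE fE Qux mE ^ 2 ≤ edgeConst ρ Λ * h ^ 4 * N ∧
      hy * h * edgeResidual ρ h hy a22 (-a11) uW sW fW Qux mW ^ 2 ≤ edgeConst ρ Λ * h ^ 4 * N ∧
      hx * h * edgeResidual ρ h hx a11 a22 uN tN fN Quy mN ^ 2 ≤ edgeConst ρ Λ * h ^ 4 * N ∧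
      hx * h * edgeResidual ρ h hx a11 (-a22) uS tS fS Quy mS ^ 2 ≤ edgeConst ρ Λ * h ^ 4 * N := by
  have h0 : 0 < h := hx0.trans_le hxh
  set δ := uE + hy ^ 2 / 12 * sE + (uW + hy ^ 2 / 12 * sW) - (uN + hx ^ 2 / 12 * tN) -
    (uS + hx ^ 2 / 12 * tS) with hδ
  set κ := h / ρ * (a11 * (hx / 2) * Quxx + a22 * (hy / 2) * Quyy) with hκ
  -- The second-order terms of the two sums cancel, leaving six remainders. The square of the sum
  -- costs a factor six, and `6 (2 + 4/144) ≤ 13`.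
  have hδb : δ ^ 2 * (hx * hy) ≤ 13 * hx ^ 6 * N := by
    have e : δ = (uE + uW - 2 * Qu - hx ^ 2 / 6 * Quxx) -
        (uN + uS - 2 * Qu - hy ^ 2 / 6 * Quyy) + hy ^ 2 / 12 * (sE - Quyy) +
        hy ^ 2 / 12 * (sW - Quyy) - hx ^ 2 / 12 * (tN - Quxx) - hx ^ 2 / 12 * (tS - Quxx) := by
      rw [hδ]; ring
    have h6 : ∀ p q r s t w : ℝ, (p - q + r + s - t - w) ^ 2 ≤
        6 * (p ^ 2 + q ^ 2 + r ^ 2 + s ^ 2 + t ^ 2 + w ^ 2) := by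
      intro p q r s t w
      linarith [sq_nonneg (p + q), sq_nonneg (p - r), sq_nonneg (p - s), sq_nonneg (p + t),
        sq_nonneg (p + w), sq_nonneg (q + r), sq_nonneg (q + s), sq_nonneg (q - t),
        sq_nonneg (q - w), sq_nonneg (r - s), sq_nonneg (r + t), sq_nonneg (r + w),
        sq_nonneg (s + t), sq_nonneg (s + w), sq_nonneg (t - w)]
    have A0 : 0 < hx * hy := mul_pos hx0 hy0
    have b1 := hX.trapezoid
    have b2 : (uN + uS - 2 * Qu - hy ^ 2 / 6 * Quyy) ^ 2 * (hx * hy) ≤ hx ^ 6 * N :=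
      hY.trapezoid.trans (by gcongr)
    have b3 : ∀ s, (s - Quyy) ^ 2 * (hx * hy) ≤ hx ^ 2 * N →
        (hy ^ 2 / 12 * (s - Quyy)) ^ 2 * (hx * hy) ≤ hx ^ 6 * N / 144 := by
      intro s hs
      calc (hy ^ 2 / 12 * (s - Quyy)) ^ 2 * (hx * hy)
          = hy ^ 4 / 144 * ((s - Quyy) ^ 2 * (hx * hy)) := by ring
        _ ≤ hx ^ 4 / 144 * (hx ^ 2 * N) := by gcongr
        _ = _ := by ring
    have b4 : ∀ t, (t - Quxx) ^ 2 * (hx * hy) ≤ hy ^ 2 * N →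
        (hx ^ 2 / 12 * (t - Quxx)) ^ 2 * (hx * hy) ≤ hx ^ 6 * N / 144 := by
      intro t ht
      calc (hx ^ 2 / 12 * (t - Quxx)) ^ 2 * (hx * hy)
          = hx ^ 4 / 144 * ((t - Quxx) ^ 2 * (hx * hy)) := by ring
        _ ≤ hx ^ 4 / 144 * (hy ^ 2 * N) := by gcongr
        _ ≤ hx ^ 4 / 144 * (hx ^ 2 * N) := by gcongr
        _ = _ := by ring
    have c1 := b3 sE hX.meanE
    have c2 := b3 sW hX.meanW
    have c3 := b4 tN hY.meanE
    have c4 := b4 tS hY.meanW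
    have hN6 : 0 ≤ hx ^ 6 * N := by positivity
    rw [e]
    refine (mul_le_mul_of_nonneg_right (h6 _ _ _ _ _ _) A0.le).trans ?_
    linarith
  have sq_neg' : ∀ x y : ℝ, (x - y) ^ 2 = (y - x) ^ 2 := fun x y => by ring
  -- The whole defect is absorbed by the edges of length `hy`, which lie at distance `hx`. There `hy
  -- δ²` is at most `13 hx⁵ N`; on the other pair a factor `hx / hy` would remain.
  refine ⟨uW + hy ^ 2 / 12 * sW - κ - δ / 2, uE + hy ^ 2 / 12 * sE - κ - δ / 2,
    uS + hx ^ 2 / 12 * tS - κ, uN + hx ^ 2 / 12 * tN - κ, by rw [hδ]; ring, ?_, ?_, ?_, ?_⟩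
  · have e : edgeResidual ρ h hy a22 a11 uE sE fE Qux (uE + hy ^ 2 / 12 * sE - κ - δ / 2) =
        a22 * (hy / 2) * (Quyy - sE) + a11 * (-(fE - Qux - hx / 2 * Quxx)) +
          ρ * h⁻¹ / 2 * δ := by
      rw [edgeResidual, hκ]; field_simp; ring
    rw [e]
    exact edge_residual_le hx0 hy0 hxh hyh h2 h2L h1 h1L hN (by rw [sq_neg']; exact hX.meanE)
      (by rw [neg_sq]; exact hX.fluxE) hδb
  · have e : edgeResidual ρ h hy a22 (-a11) uW sW fW Qux (uW + hy ^ 2 / 12 * sW - κ - δ / 2) =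
        a22 * (hy / 2) * (Quyy - sW) + a11 * (fW - Qux + hx / 2 * Quxx) +
          ρ * h⁻¹ / 2 * δ := by
      rw [edgeResidual, hκ]; field_simp; ring
    rw [e]
    exact edge_residual_le hx0 hy0 hxh hyh h2 h2L h1 h1L hN (by rw [sq_neg']; exact hX.meanW)
      hX.fluxW hδb
  · have e : edgeResidual ρ h hx a11 a22 uN tN fN Quy (uN + hx ^ 2 / 12 * tN - κ) =
        a11 * (hx / 2) * (Quxx - tN) + a22 * (-(fN - Quy - hy / 2 * Quyy)) +
          ρ * h⁻¹ / 2 * 0 := by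
      rw [edgeResidual, hκ]; field_simp; ring
    rw [e]
    exact edge_residual_le hy0 hx0 hyh hxh h1 h1L h2 h2L hN
      (by rw [sq_neg', mul_comm hy]; exact hY.meanE)
      (by rw [neg_sq, mul_comm hy]; exact hY.fluxE) (by rw [zero_pow two_ne_zero, zero_mul]; positivity)
  · have e : edgeResidual ρ h hx a11 (-a22) uS tS fS Quy (uS + hx ^ 2 / 12 * tS - κ) =
        a11 * (hx / 2) * (Quxx - tS) + a22 * (fS - Quy + hy / 2 * Quyy) +
          ρ * h⁻¹ / 2 * 0 := by
      rw [edgeResidual, hκ]; field_simp; ring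
    rw [e]
    exact edge_residual_le hy0 hx0 hyh hxh h1 h1L h2 h2L hN
      (by rw [sq_neg', mul_comm hy]; exact hY.meanW)
      (by rw [mul_comm hy]; exact hY.fluxW) (by rw [zero_pow two_ne_zero, zero_mul]; positivity)

/-- The defect of the midpoint rules is put on the pair of edges at the larger distance. -/
theorem exists_edgeMeans (hρ : 0 < ρ) (hx0 : 0 < hx) (hy0 : 0 < hy) (hxh : hx ≤ h)
    (hyh : hy ≤ h) (h1 : 0 ≤ a11) (h1L : a11 ≤ Λ) (h2 : 0 ≤ a22) (h2L : a22 ≤ Λ) (hN : 0 ≤ N)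
    (hX : EdgeRules hx (hx * hy) uW uE Qu fW fE Qux Quxx sW sE Quyy k J N)
    (hY : EdgeRules hy (hx * hy) uS uN Qu fS fN Quy Quyy tS tN Quxx k' J' N) :
    ∃ mW mE mS mN : ℝ, mW + mE = mS + mN ∧
      hy * h * edgeResidual ρ h hy a22 a11 uE sE fE Qux mE ^ 2 ≤ edgeConst ρ Λ * h ^ 4 * N ∧
      hy * h * edgeResidual ρ h hy a22 (-a11) uW sW fW Qux mW ^ 2 ≤ edgeConst ρ Λ * h ^ 4 * N ∧
      hx * h * edgeResidual ρ h hx a11 a22 uN tN fN Quy mN ^ 2 ≤ edgeConst ρ Λ * h ^ 4 * N ∧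
      hx * h * edgeResidual ρ h hx a11 (-a22) uS tS fS Quy mS ^ 2 ≤ edgeConst ρ Λ * h ^ 4 * N := by
  rcases le_total hy hx with hle | hle
  · exact exists_edgeMeans_of_le hρ hx0 hy0 hxh hyh h1 h1L h2 h2L hN hX hY hle
  · rw [mul_comm hx hy] at hX hY
    obtain ⟨mS, mN, mW, mE, e, b1, b2, b3, b4⟩ :=
      exists_edgeMeans_of_le hρ hy0 hx0 hyh hxh h2 h2L h1 h1L hN hY hX hle
    exact ⟨mW, mE, mS, mN, e.symm, b3, b4, b1, b2⟩

/-- The constant in the estimate of the perturbation of the discrete gradient. -/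
noncomputable def gradConst (ρ Λ : ℝ) : ℝ := (1 + 6 * ρ⁻¹ * Λ) ^ 2

/-- Difference quotients of exact edge means are exact, and both corrections carry the same factor.
Only the difference of the tangential second derivatives on opposite edges remains, and this is `hx`
times the mean `k` of a third derivative. -/
theorem grad_perturbation_le (hρ : 0 < ρ) (hx0 : 0 < hx) (hy0 : 0 < hy)
    (hyh : hy ≤ h) (h2 : 0 ≤ a22) (h2L : a22 ≤ Λ) (hN : 0 ≤ N)
    (hX : EdgeRules hx (hx * hy) uW uE Qu fW fE Qux Quxx sW sE Quyy k J N) {g : ℝ}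
    (hg : hx * g = (uE + 1 / 12 * hy * (hy - 6 * ρ⁻¹ * a22 * h) * sE) -
      (uW + 1 / 12 * hy * (hy - 6 * ρ⁻¹ * a22 * h) * sW)) :
    hx * hy * (g - Qux) ^ 2 ≤ gradConst ρ Λ * h ^ 4 * N := by
  have h0 : 0 < h := hy0.trans_le hyh
  have e : g - Qux = 1 / 12 * hy * (hy - 6 * ρ⁻¹ * a22 * h) * k := by
    refine mul_left_cancel₀ hx0.ne' ?_
    linear_combination hg + hX.grad + 1 / 12 * hy * (hy - 6 * ρ⁻¹ * a22 * h) * hX.tang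
  have hb : (hy - 6 * ρ⁻¹ * a22 * h) ^ 2 ≤ ((1 + 6 * ρ⁻¹ * Λ) * h) ^ 2 := by
    have h3 : 0 ≤ 6 * ρ⁻¹ * a22 * h := by positivity
    have h4 : 6 * ρ⁻¹ * a22 * h ≤ 6 * ρ⁻¹ * Λ * h := by gcongr
    refine sq_le_sq' (by nlinarith) (by nlinarith)
  calc hx * hy * (g - Qux) ^ 2
      = 1 / 144 * hy ^ 2 * (hy - 6 * ρ⁻¹ * a22 * h) ^ 2 * (k ^ 2 * (hx * hy)) := by rw [e]; ring
    _ ≤ 1 / 144 * h ^ 2 * ((1 + 6 * ρ⁻¹ * Λ) * h) ^ 2 * N := by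
        have := hX.tang_le
        gcongr
    _ = 1 / 144 * (gradConst ρ Λ * h ^ 4 * N) := by unfold gradConst; ring
    _ ≤ gradConst ρ Λ * h ^ 4 * N := by
        have : 0 ≤ gradConst ρ Λ * h ^ 4 * N := by unfold gradConst; positivity
        linarith

/-- The consistency terms belonging to one coordinate direction are bounded by the energy: `Δ` is
the gradient error, `rE` and `rW` are edge residuals, `J` is a centred moment. The slope `β` of
`v_0` is not part of the energy, so it is written as `g - (bE - bW) / hx`; the powers of `hx` in the
bound for `J` compensate this division. Each of `g`, `bE`, `bW` occurs in two products, and six uses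
of Young's inequality with weight `κ / 4` give `κ / 2`. -/
theorem half_residual_le {κ a a' Δ g bE bW rE rW β K₁ K₂ : ℝ} (hκ : 0 < κ) (hx0 : 0 < hx)
    (hy0 : 0 < hy) (hxh : hx ≤ h) (ha : 0 ≤ a) (haL : a ≤ Λ) (ha' : 0 ≤ a')
    (haL' : a' ≤ Λ) (hN : 0 ≤ N) (hΔ : hx * hy * Δ ^ 2 ≤ K₁ * h ^ 4 * N)
    (hrE : hy * h * rE ^ 2 ≤ K₂ * h ^ 4 * N) (hrW : hy * h * rW ^ 2 ≤ K₂ * h ^ 4 * N)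
    (hJ : J ^ 2 ≤ hx ^ 4 * (hx * hy) * N) (hβ : hx * β = hx * g - (bE - bW)) :
    hx * hy * (a * Δ * g) + hy * (bE * rE + bW * rW) + a' * β * J ≤
      κ / 2 * (hx * hy * g ^ 2 + h⁻¹ * (hy * (bE ^ 2 + bW ^ 2))) +
        κ⁻¹ * (Λ ^ 2 * K₁ + 2 * K₂ + 3 * Λ ^ 2) * h ^ 4 * N := by
  have h0 : 0 < h := hx0.trans_le hxh
  have hA : 0 < hx * hy := mul_pos hx0 hy0
  have hw : 0 < h⁻¹ * hy := by positivity
  have y1 := young_weighted hκ hA g (hx * hy * (a * Δ))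
  have y2 := young_weighted hκ hw bE (hy * rE)
  have y3 := young_weighted hκ hw bW (hy * rW)
  have y4 := young_weighted hκ hA g (a' * J)
  have y5 := young_weighted hκ hw bE (-(a' * J / hx))
  have y6 := young_weighted hκ hw bW (a' * J / hx)
  have hβ' : β = g - bE / hx + bW / hx := by field_simp; linarith
  have e1 : (hx * hy * (a * Δ)) ^ 2 / (κ * (hx * hy)) ≤ κ⁻¹ * (Λ ^ 2 * K₁) * h ^ 4 * N := by
    calc (hx * hy * (a * Δ)) ^ 2 / (κ * (hx * hy)) = κ⁻¹ * a ^ 2 * (hx * hy * Δ ^ 2) := by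
          field_simp
      _ ≤ κ⁻¹ * Λ ^ 2 * (K₁ * h ^ 4 * N) := by gcongr
      _ = _ := by ring
  have e2 : ∀ r, hy * h * r ^ 2 ≤ K₂ * h ^ 4 * N →
      (hy * r) ^ 2 / (κ * (h⁻¹ * hy)) ≤ κ⁻¹ * K₂ * h ^ 4 * N := by
    intro r hr
    calc (hy * r) ^ 2 / (κ * (h⁻¹ * hy)) = κ⁻¹ * (hy * h * r ^ 2) := by field_simp
      _ ≤ κ⁻¹ * (K₂ * h ^ 4 * N) := by gcongr
      _ = _ := by ring
  have e4 : (a' * J) ^ 2 / (κ * (hx * hy)) ≤ κ⁻¹ * Λ ^ 2 * h ^ 4 * N := by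
    calc (a' * J) ^ 2 / (κ * (hx * hy)) = κ⁻¹ * a' ^ 2 * (J ^ 2 / (hx * hy)) := by field_simp
      _ ≤ κ⁻¹ * Λ ^ 2 * (hx ^ 4 * (hx * hy) * N / (hx * hy)) := by gcongr
      _ = κ⁻¹ * Λ ^ 2 * (hx ^ 4 * N) := by field_simp
      _ ≤ κ⁻¹ * Λ ^ 2 * (h ^ 4 * N) := by gcongr
      _ = _ := by ring
  have e5 : (a' * J / hx) ^ 2 / (κ * (h⁻¹ * hy)) ≤ κ⁻¹ * Λ ^ 2 * h ^ 4 * N := by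
    calc (a' * J / hx) ^ 2 / (κ * (h⁻¹ * hy)) = κ⁻¹ * a' ^ 2 * (h * J ^ 2 / (hx ^ 2 * hy)) := by
          field_simp
      _ ≤ κ⁻¹ * Λ ^ 2 * (h * (hx ^ 4 * (hx * hy) * N) / (hx ^ 2 * hy)) := by gcongr
      _ = κ⁻¹ * Λ ^ 2 * (h * hx ^ 3 * N) := by field_simp
      _ ≤ κ⁻¹ * Λ ^ 2 * (h * h ^ 3 * N) := by gcongr
      _ = _ := by ring
  have e2E := e2 rE hrE
  have e2W := e2 rW hrW
  rw [neg_sq] at y5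
  have split : hx * hy * (a * Δ * g) + hy * (bE * rE + bW * rW) + a' * β * J =
      g * (hx * hy * (a * Δ)) + bE * (hy * rE) + bW * (hy * rW) + g * (a' * J) +
        bE * (-(a' * J / hx)) + bW * (a' * J / hx) := by
    rw [hβ']; ring
  rw [split]
  linarith

end Element

/-! ### Functions of three weak derivatives -/

theorem WeakX.swap {w z : ℝ × ℝ → ℝ} (h : WeakX w z) :
    WeakY (fun p => w p.swap) (fun p => z p.swap) := by
  refine ⟨h.1.comp_measurePreserving measurePreserving_swap_muOmega,
    h.2.1.comp_measurePreserving measurePreserving_swap_muOmega, fun φ hφ => ?_⟩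
  have e := h.2.2 _ hφ.comp_swap
  simp only [Function.iterate_one, Function.iterate_zero, id_eq] at e ⊢
  change ∫ p, w p * dx (fun q => φ q.swap) p ∂muOmega = _ * ∫ p, z p * φ p.swap ∂muOmega at e
  change ∫ p, w p.swap * dy φ p ∂muOmega = _ * ∫ p, z p.swap * φ p ∂muOmega
  rw [← integral_comp_swap_muOmega, ← integral_comp_swap_muOmega (fun p => z p * φ p.swap)] at e
  simp only [Prod.swap_swap, dx_comp_swap (hφ.1.differentiable (by simp))] at e
  rw [show (0 + 1 : ℕ) = 1 + 0 from rfl, ← e]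

/-- `u` and its weak derivatives of order at most three. -/
structure IsH3 (u ux uy uxx uxy uyy uxxx uxxy uxyy uyyy : ℝ × ℝ → ℝ) : Prop where
  x_u : WeakX u ux
  y_u : WeakY u uy
  x_ux : WeakX ux uxx
  y_ux : WeakY ux uxy
  x_uy : WeakX uy uxy
  y_uy : WeakY uy uyy
  x_uxx : WeakX uxx uxxx
  y_uxx : WeakY uxx uxxy
  x_uxy : WeakX uxy uxxy
  y_uxy : WeakY uxy uxyy
  x_uyy : WeakX uyy uxyy
  y_uyy : WeakY uyy uyyy

theorem IsH3.swap {u ux uy uxx uxy uyy uxxx uxxy uxyy uyyy : ℝ × ℝ → ℝ}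
    (h : IsH3 u ux uy uxx uxy uyy uxxx uxxy uxyy uyyy) :
    IsH3 (fun p => u p.swap) (fun p => uy p.swap) (fun p => ux p.swap) (fun p => uyy p.swap)
      (fun p => uxy p.swap) (fun p => uxx p.swap) (fun p => uyyy p.swap) (fun p => uxyy p.swap)
      (fun p => uxxy p.swap) (fun p => uxxx p.swap) :=
  ⟨h.y_u.swap, h.x_u.swap, h.y_uy.swap, h.x_uy.swap, h.y_ux.swap, h.x_ux.swap, h.y_uyy.swap,
    h.x_uyy.swap, h.y_uxy.swap, h.x_uxy.swap, h.y_uxx.swap, h.x_uxx.swap⟩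

theorem MemSobolev.isH3 {u : ℝ × ℝ → ℝ} (hu : MemSobolev 3 u) :
    IsH3 u (weakDeriv 1 0 u) (weakDeriv 0 1 u) (weakDeriv 2 0 u) (weakDeriv 1 1 u)
      (weakDeriv 0 2 u) (weakDeriv 3 0 u) (weakDeriv 2 1 u) (weakDeriv 1 2 u)
      (weakDeriv 0 3 u) := by
  have s := fun {i j : ℕ} (h : i + j ≤ 3) => weakDeriv_spec hu h
  exact ⟨⟨hu.1, s (by norm_num)⟩, ⟨hu.1, s (by norm_num)⟩,
    weakX_of_isWeakDeriv (s (by norm_num)) (s (by norm_num)),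
    weakY_of_isWeakDeriv (s (by norm_num)) (s (by norm_num)),
    weakX_of_isWeakDeriv (s (by norm_num)) (s (by norm_num)),
    weakY_of_isWeakDeriv (s (by norm_num)) (s (by norm_num)),
    weakX_of_isWeakDeriv (s (by norm_num)) (s (by norm_num)),
    weakY_of_isWeakDeriv (s (by norm_num)) (s (by norm_num)),
    weakX_of_isWeakDeriv (s (by norm_num)) (s (by norm_num)),
    weakY_of_isWeakDeriv (s (by norm_num)) (s (by norm_num)),
    weakX_of_isWeakDeriv (s (by norm_num)) (s (by norm_num)),
    weakY_of_isWeakDeriv (s (by norm_num)) (s (by norm_num))⟩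

/-! ### Means over edges -/

/-- The mean of the trace of `w` over the segment `{t} × [c, d]`. -/
noncomputable def meanV (w z : ℝ × ℝ → ℝ) (c d t : ℝ) : ℝ := edgeV w z c d t / (d - c)

theorem intervalAverage_eq_meanV {w z : ℝ × ℝ → ℝ} {c d t : ℝ} (hc : 0 ≤ c) (hcd : c < d)
    (hd : d ≤ 1) {τ : ℝ → ℝ}
    (h : ∀ k, IsWeight k → ∫ y in Ioo (0 : ℝ) 1, k y * τ y = traceV w z k t) :
    ⨍ y in c..d, τ y = meanV w z c d t := by
  rw [interval_average_eq_div, meanV, edgeV, ← h _ (isWeight_indicator measurableSet_Icc),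
    intervalIntegral.integral_of_le hcd.le, ← integral_Icc_eq_integral_Ioc]
  congr 1
  have e : (fun y => (Icc c d).indicator 1 y * τ y) = (Icc c d).indicator τ := by
    funext y
    by_cases hy : y ∈ Icc c d <;> simp [hy]
  have h1 : (Ioo (0 : ℝ) 1 ∩ Icc c d : Set ℝ) =ᵐ[volume] Icc c d := by
    have := (Ioo_ae_eq_Icc (μ := volume) (a := (0 : ℝ)) (b := 1)).inter (ae_eq_refl (Icc c d))
    rwa [inter_eq_right.2 (Icc_subset_Icc hc hd)] at this
  rw [e, setIntegral_indicator measurableSet_Icc, Measure.restrict_congr_set h1]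

namespace Mesh

variable (M : Mesh n m)

theorem isRect (i : Fin n) (j : Fin m) :
    IsRect (M.x i.castSucc) (M.x i.succ) (M.y j.castSucc) (M.y j.succ) :=
  ⟨(M.x_mem _).1, M.x_lt i, (M.x_mem _).2, (M.y_mem _).1, M.y_lt j, (M.y_mem _).2⟩

theorem hx_pos (i : Fin n) : 0 < M.hx i := sub_pos.2 (M.x_lt i)

theorem hy_pos (j : Fin m) : 0 < M.hy j := sub_pos.2 (M.y_lt j)

theorem le_size (i : Fin n) (j : Fin m) : Real.sqrt (M.hx i ^ 2 + M.hy j ^ 2) ≤ M.size :=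
  le_ciSup (f := fun T : Fin n × Fin m => Real.sqrt (M.hx T.1 ^ 2 + M.hy T.2 ^ 2))
    (Set.finite_range _).bddAbove (i, j)

theorem hx_le_size (i : Fin n) (j : Fin m) : M.hx i ≤ M.size := by
  refine le_trans ?_ (M.le_size i j)
  exact Real.le_sqrt_of_sq_le (by nlinarith [sq_nonneg (M.hy j)])

theorem hy_le_size (i : Fin n) (j : Fin m) : M.hy j ≤ M.size := by
  refine le_trans ?_ (M.le_size i j)
  exact Real.le_sqrt_of_sq_le (by nlinarith [sq_nonneg (M.hx i)])

/-- The midpoint of the `i`-th column. -/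
noncomputable def xm (i : Fin n) : ℝ := (M.x i.castSucc + M.x i.succ) / 2

/-- The midpoint of the `j`-th row. -/
noncomputable def ym (j : Fin m) : ℝ := (M.y j.castSucc + M.y j.succ) / 2

theorem affine_apply (F : ℝ × ℝ →ᵃ[ℝ] ℝ) (p q : ℝ × ℝ) :
    F p = F q + F.linear (1, 0) * (p.1 - q.1) + F.linear (0, 1) * (p.2 - q.2) := by
  have h := F.map_vadd q (p - q)
  have e : p - q = (p.1 - q.1) • ((1, 0) : ℝ × ℝ) + (p.2 - q.2) • ((0, 1) : ℝ × ℝ) := by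
    ext <;> simp
  rw [e, map_add, map_smul, map_smul] at h
  rw [← e] at h
  simp only [vadd_eq_add, sub_add_cancel, smul_eq_mul] at h
  rw [h]; ring

theorem average_affine {c d : ℝ} (hcd : c < d) (α β : ℝ) :
    ⨍ t in c..d, (α + β * (t - (c + d) / 2)) = α := by
  rw [interval_average_eq_div, intervalIntegral.integral_add (by simp)
    ((by fun_prop : Continuous fun t : ℝ => β * (t - (c + d) / 2)).intervalIntegrable _ _),
    intervalIntegral.integral_const, intervalIntegral.integral_const_mul,
    intervalIntegral.integral_sub (by simp) (by simp), integral_id,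
    intervalIntegral.integral_const]
  have : d - c ≠ 0 := (sub_pos.2 hcd).ne'
  simp only [smul_eq_mul]
  field_simp
  ring

theorem QbV_affine (k : Fin (n + 1)) (j : Fin m) (F : ℝ × ℝ →ᵃ[ℝ] ℝ) :
    M.QbV k j F = F (M.x k, M.ym j) := by
  rw [QbV, ← average_affine (M.y_lt j) (F (M.x k, M.ym j)) (F.linear (0, 1))]
  congr 1; funext t
  rw [affine_apply F (M.x k, t) (M.x k, M.ym j)]
  simp [ym]

theorem QbH_affine (i : Fin n) (k : Fin (m + 1)) (F : ℝ × ℝ →ᵃ[ℝ] ℝ) :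
    M.QbH i k F = F (M.xm i, M.y k) := by
  rw [QbH, ← average_affine (M.x_lt i) (F (M.xm i, M.y k)) (F.linear (1, 0))]
  congr 1; funext t
  rw [affine_apply F (t, M.y k) (M.xm i, M.y k)]
  simp [xm]

theorem Qh_eq (i : Fin n) (j : Fin m) (w : ℝ × ℝ → ℝ) :
    M.Qh i j w = (∫ p in M.elem i j, w p) / (M.hx i * M.hy j) := by
  rw [Qh, setAverage_eq, elem, (M.isRect i j).measureReal, smul_eq_mul, hx, hy]
  ring

end Mesh

/-- An affine function with given values at the midpoints of the edges of an element. -/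
theorem exists_affine_edgeMeans (M : Mesh n m) (i : Fin n) (j : Fin m) {mW mE mS mN : ℝ}
    (h : mW + mE = mS + mN) : ∃ F : ℝ × ℝ →ᵃ[ℝ] ℝ,
      F (M.x i.castSucc, M.ym j) = mW ∧ F (M.x i.succ, M.ym j) = mE ∧
      F (M.xm i, M.y j.castSucc) = mS ∧ F (M.xm i, M.y j.succ) = mN := by
  have hx := (M.hx_pos i).ne'
  have hy := (M.hy_pos j).ne'
  -- The slopes are the difference quotients, and the value at the centre is half of either sum,
  -- which is where the compatibility relation is needed.
  let L : ℝ × ℝ →ₗ[ℝ] ℝ := ((mE - mW) / M.hx i) • LinearMap.fst ℝ ℝ ℝ +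
    ((mN - mS) / M.hy j) • LinearMap.snd ℝ ℝ ℝ
  let F : ℝ × ℝ →ᵃ[ℝ] ℝ := L.toAffineMap + AffineMap.const ℝ (ℝ × ℝ)
    ((mW + mE) / 2 - (mE - mW) / M.hx i * M.xm i - (mN - mS) / M.hy j * M.ym j)
  have hF : ∀ p : ℝ × ℝ, F p = (mE - mW) / M.hx i * p.1 + (mN - mS) / M.hy j * p.2 +
      ((mW + mE) / 2 - (mE - mW) / M.hx i * M.xm i - (mN - mS) / M.hy j * M.ym j) := by
    intro p
    simp [F, L]
  have e1 : M.x i.castSucc = M.xm i - M.hx i / 2 := by simp only [Mesh.xm, Mesh.hx]; ring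
  have e2 : M.x i.succ = M.xm i + M.hx i / 2 := by simp only [Mesh.xm, Mesh.hx]; ring
  have e3 : M.y j.castSucc = M.ym j - M.hy j / 2 := by simp only [Mesh.ym, Mesh.hy]; ring
  have e4 : M.y j.succ = M.ym j + M.hy j / 2 := by simp only [Mesh.ym, Mesh.hy]; ring
  refine ⟨F, ?_, ?_, ?_, ?_⟩ <;> rw [hF] <;> simp only [e1, e2, e3, e4] <;> field_simp
  · ring
  · ring
  · linear_combination (M.hx i * M.hy j) * h
  · linear_combination (M.hx i * M.hy j) * h

/-- Glues values prescribed from the elements of a row or column into one value per edge: the first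
node takes its value from the first interval, every other node from the interval before it. -/
theorem exists_node_values {φ : Fin n → Fin (n + 1) → ℝ}
    (h : ∀ i i' : Fin n, i'.val = i.val + 1 → φ i i.succ = φ i' i.succ) :
    ∃ p : Fin (n + 1) → ℝ, ∀ i, p i.castSucc = φ i i.castSucc ∧ p i.succ = φ i i.succ := by
  cases n with
  | zero => exact ⟨fun _ => 0, fun i => i.elim0⟩
  | succ n =>
    refine ⟨Fin.cases (φ 0 0) fun i => φ i i.succ, fun i => ⟨?_, by simp⟩⟩
    refine Fin.cases ?_ (fun k => ?_) i
    · simp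
    · rw [Fin.castSucc_succ]
      exact h _ _ (by simp)

/-! ### The estimate on one element -/

/-- The contribution of an element to `‖∇_d v‖² + h⁻¹ ‖v_b - Q_b v_0‖²`. -/
noncomputable def localEnergy (M : Mesh n m) (v : WeakFun n m) (i : Fin n) (j : Fin m) : ℝ :=
  M.hx i * M.hy j * ((weakGrad M v i j).1 ^ 2 + (weakGrad M v i j).2 ^ 2) +
  M.size⁻¹ * (M.hy j * ((v.vV i.succ j - v.v0 i j (M.x i.succ, M.ym j)) ^ 2 +
      (v.vV i.castSucc j - v.v0 i j (M.x i.castSucc, M.ym j)) ^ 2) +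
    M.hx i * ((v.vH i j.succ - v.v0 i j (M.xm i, M.y j.succ)) ^ 2 +
      (v.vH i j.castSucc - v.v0 i j (M.xm i, M.y j.castSucc)) ^ 2))

/-- The contribution of an element to the bilinear form of the method. -/
noncomputable def localForm (M : Mesh n m) (ρ : ℝ) (a11 a22 : Fin n → Fin m → ℝ)
    (w v : WeakFun n m) (i : Fin n) (j : Fin m) : ℝ :=
  M.hx i * M.hy j * (a11 i j * (weakGrad M w i j).1 * (weakGrad M v i j).1 +
    a22 i j * (weakGrad M w i j).2 * (weakGrad M v i j).2) +
  ρ * M.size⁻¹ * (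
    M.hy j * ((w.vV i.castSucc j - w.v0 i j (M.x i.castSucc, M.ym j)) *
      (v.vV i.castSucc j - v.v0 i j (M.x i.castSucc, M.ym j))) +
    M.hy j * ((w.vV i.succ j - w.v0 i j (M.x i.succ, M.ym j)) *
      (v.vV i.succ j - v.v0 i j (M.x i.succ, M.ym j))) +
    M.hx i * ((w.vH i j.castSucc - w.v0 i j (M.xm i, M.y j.castSucc)) *
      (v.vH i j.castSucc - v.v0 i j (M.xm i, M.y j.castSucc))) +
    M.hx i * ((w.vH i j.succ - w.v0 i j (M.xm i, M.y j.succ)) *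
      (v.vH i j.succ - v.v0 i j (M.xm i, M.y j.succ))))

theorem form_eq_sum (M : Mesh n m) (ρ : ℝ) (a11 a22 : Fin n → Fin m → ℝ) (w v : WeakFun n m) :
    diffusionForm M a11 a22 w v + stabilizer M ρ w v =
      ∑ i, ∑ j, localForm M ρ a11 a22 w v i j := by
  simp only [diffusionForm, stabilizer, Finset.mul_sum, ← Finset.sum_add_distrib,
    Mesh.QbV_affine, Mesh.QbH_affine, Mesh.area, localForm]

/-- The boundary term of an element: the flux of `a (wx, wy)` weighted by `v_b`. -/
noncomputable def localFlux (M : Mesh n m) (a11 a22 : Fin n → Fin m → ℝ)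
    (wx wxx wy wyy : ℝ × ℝ → ℝ) (v : WeakFun n m) (i : Fin n) (j : Fin m) : ℝ :=
  a11 i j * (edgeV wx wxx (M.y j.castSucc) (M.y j.succ) (M.x i.succ) * v.vV i.succ j -
    edgeV wx wxx (M.y j.castSucc) (M.y j.succ) (M.x i.castSucc) * v.vV i.castSucc j) +
  a22 i j * (edgeV (fun p => wy p.swap) (fun p => wyy p.swap) (M.x i.castSucc) (M.x i.succ)
      (M.y j.succ) * v.vH i j.succ -
    edgeV (fun p => wy p.swap) (fun p => wyy p.swap) (M.x i.castSucc) (M.x i.succ)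
      (M.y j.castSucc) * v.vH i j.castSucc)

theorem hx_mul_weakGrad (M : Mesh n m) (v : WeakFun n m) (i : Fin n) (j : Fin m) :
    M.hx i * (weakGrad M v i j).1 = v.vV i.succ j - v.vV i.castSucc j := by
  have hx := (M.hx_pos i).ne'
  have hy := (M.hy_pos j).ne'
  simp only [weakGrad, Mesh.area]
  field_simp

theorem hy_mul_weakGrad (M : Mesh n m) (v : WeakFun n m) (i : Fin n) (j : Fin m) :
    M.hy j * (weakGrad M v i j).2 = v.vH i j.succ - v.vH i j.castSucc := by
  have hx := (M.hx_pos i).ne'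
  have hy := (M.hy_pos j).ne'
  simp only [weakGrad, Mesh.area]
  field_simp

/-- The perturbed edge value on a vertical edge at `t`, seen from the element `(i, j)`. -/
noncomputable def perturbedV (M : Mesh n m) (ρ : ℝ) (a22 : Fin n → Fin m → ℝ)
    (u ux uyy uxyy : ℝ × ℝ → ℝ) (i : Fin n) (j : Fin m) (t : ℝ) : ℝ :=
  meanV u ux (M.y j.castSucc) (M.y j.succ) t +
    1 / 12 * M.hy j * (M.hy j - 6 * ρ⁻¹ * a22 i j * M.size) *
      meanV uyy uxyy (M.y j.castSucc) (M.y j.succ) t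

/-- The perturbed edge value on a horizontal edge at `t`, seen from the element `(i, j)`. -/
noncomputable def perturbedH (M : Mesh n m) (ρ : ℝ) (a11 : Fin n → Fin m → ℝ)
    (u uy uxx uxxy : ℝ × ℝ → ℝ) (i : Fin n) (j : Fin m) (t : ℝ) : ℝ :=
  meanV (fun p => u p.swap) (fun p => uy p.swap) (M.x i.castSucc) (M.x i.succ) t +
    1 / 12 * M.hx i * (M.hx i - 6 * ρ⁻¹ * a11 i j * M.size) *
      meanV (fun p => uxx p.swap) (fun p => uxxy p.swap) (M.x i.castSucc) (M.x i.succ) t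

/-- The constant in the estimate of the residual of an element. -/
noncomputable def elemConst (κ ρ Λ : ℝ) : ℝ :=
  2 * (κ⁻¹ * (Λ ^ 2 * gradConst ρ Λ + 2 * edgeConst ρ Λ + 3 * Λ ^ 2))

section Element

variable {M : Mesh n m} {ρ Λ κ : ℝ} {a11 a22 : Fin n → Fin m → ℝ}
  {f u ux uy uxx uxy uyy uxxx uxxy uxyy uyyy : ℝ × ℝ → ℝ}

/-- The equation holds on the element when tested with `1`, `x - xm` and `y - ym`, hence with `F`.
Integrating `uxx` by parts in `x` uses only the part of `F` that is constant along vertical edges,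
which yields the midpoint values. The tangential slope stays behind as a centred moment over the
element; the same is done for `uyy` in `y`. -/
theorem integral_load (hH : IsH3 u ux uy uxx uxy uyy uxxx uxxy uxyy uyyy)
    (hf : MemLp f 2 muOmega) (hflux : IsFlux M a11 a22 f ux uy) (i : Fin n) (j : Fin m)
    (F : ℝ × ℝ →ᵃ[ℝ] ℝ) :
    ∫ p in M.elem i j, f p * F p =
      -(a11 i j * (edgeV ux uxx (M.y j.castSucc) (M.y j.succ) (M.x i.succ) *
            F (M.x i.succ, M.ym j) -
          edgeV ux uxx (M.y j.castSucc) (M.y j.succ) (M.x i.castSucc) *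
            F (M.x i.castSucc, M.ym j) -
          F.linear (1, 0) * (∫ p in M.elem i j, ux p) +
          F.linear (0, 1) * ∫ p in M.elem i j, uxx p * (p.2 - M.ym j))) -
      a22 i j * (edgeV (fun p => uy p.swap) (fun p => uyy p.swap) (M.x i.castSucc) (M.x i.succ)
            (M.y j.succ) * F (M.xm i, M.y j.succ) -
          edgeV (fun p => uy p.swap) (fun p => uyy p.swap) (M.x i.castSucc) (M.x i.succ)
            (M.y j.castSucc) * F (M.xm i, M.y j.castSucc) -
          F.linear (0, 1) * (∫ p in M.elem i j, uy p) +
          F.linear (1, 0) * ∫ p in M.elem i j, uyy p * (p.1 - M.xm i)) := by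
  have hr := M.isRect i j
  set β := F.linear (1, 0) with hβ
  set γ := F.linear (0, 1) with hγ
  set α := F (M.xm i, M.ym j) with hα
  have hF : ∀ p : ℝ × ℝ, F p = α + β * (p.1 - M.xm i) + γ * (p.2 - M.ym j) :=
    fun p => Mesh.affine_apply F p (M.xm i, M.ym j)
  have swapI : ∀ G : ℝ × ℝ → ℝ, ∫ p in Icc (M.y j.castSucc) (M.y j.succ) ×ˢ
      Icc (M.x i.castSucc) (M.x i.succ), G p.swap = ∫ p in M.elem i j, G p :=
    fun G => setIntegral_elem_swap M i j G
  have i1 : ∀ {w : ℝ × ℝ → ℝ} {p : ℝ → ℝ}, MemLp w 2 muOmega → Continuous p →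
      Integrable (fun q => w q * p q.1) (volume.restrict (M.elem i j)) :=
    fun hw hp => hr.integrable_mul hw hp
  have i2 : ∀ {w : ℝ × ℝ → ℝ} {p : ℝ → ℝ}, MemLp w 2 muOmega → Continuous p →
      Integrable (fun q => w q * p q.2) (volume.restrict (M.elem i j)) := by
    intro w p hw hp
    have hfin : IsFiniteMeasure (volume.restrict (M.elem i j)) :=
      isFiniteMeasure_of_le _ (elem_measure_le M i j)
    obtain ⟨C, hC⟩ := isCompact_Icc.exists_bound_of_continuousOn
      (s := Icc (M.y j.castSucc) (M.y j.succ)) hp.continuousOn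
    refine (((hw.mono_measure (elem_measure_le M i j))).integrable one_le_two).mul_bdd (c := C)
      (hp.comp continuous_snd).aestronglyMeasurable ?_
    filter_upwards [ae_restrict_mem (measurableSet_elem M i j)] with q hq using hC _ hq.2
  -- the splitting of a product with an affine function
  have split : ∀ {w : ℝ × ℝ → ℝ}, MemLp w 2 muOmega → ∫ p in M.elem i j, w p * F p =
      (∫ p in M.elem i j, w p * (α - β * M.xm i + β * p.1)) +
        γ * ∫ p in M.elem i j, w p * (p.2 - M.ym j) := by
    intro w hw
    rw [← integral_const_mul, ← integral_add (i1 hw (p := fun x => α - β * M.xm i + β * x)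
      (by fun_prop)) ((i2 hw (p := fun y => y - M.ym j) (by fun_prop)).const_mul γ)]
    congr 1; funext p; rw [hF]; ring
  have split' : ∀ {w : ℝ × ℝ → ℝ}, MemLp w 2 muOmega → ∫ p in M.elem i j, w p * F p =
      (∫ p in M.elem i j, w p * (α - γ * M.ym j + γ * p.2)) +
        β * ∫ p in M.elem i j, w p * (p.1 - M.xm i) := by
    intro w hw
    rw [← integral_const_mul, ← integral_add (i2 hw (p := fun y => α - γ * M.ym j + γ * y)
      (by fun_prop)) ((i1 hw (p := fun x => x - M.xm i) (by fun_prop)).const_mul β)]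
    congr 1; funext p; rw [hF]; ring
  have ex := WeakX.edgeV_affine hr hH.x_ux (α - β * M.xm i) β
  have ey := WeakX.edgeV_affine hr.swap hH.swap.x_ux (α - γ * M.ym j) γ
  rw [swapI uy] at ey
  have ey' : ∫ q in Icc (M.y j.castSucc) (M.y j.succ) ×ˢ Icc (M.x i.castSucc) (M.x i.succ),
      uyy q.swap * (α - γ * M.ym j + γ * q.1) =
      ∫ p in M.elem i j, uyy p * (α - γ * M.ym j + γ * p.2) :=
    swapI fun p => uyy p * (α - γ * M.ym j + γ * p.2)
  rw [ey'] at ey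
  change β * (∫ q in M.elem i j, ux q) + (∫ q in M.elem i j, _) = _ at ex
  have hres : ∫ p in M.elem i j, residual (a11 i j) (a22 i j) f uxx uyy p * F p = 0 := by
    -- Weights must be bounded on the whole line; the cutoff to the element changes nothing in the
    -- integrals.
    have hb : ∀ {a b : ℝ} (s : ℝ), IsWeight ((Icc a b).indicator fun t : ℝ => t - s) := by
      intro a b s
      obtain ⟨C, hC⟩ := isCompact_Icc.exists_bound_of_continuousOn (s := Icc a b)
        (f := fun t : ℝ => t - s) (by fun_prop)
      refine ⟨(measurable_id.sub_const s).indicator measurableSet_Icc, max C 0, fun t => ?_⟩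
      by_cases ht : t ∈ Icc a b
      · rw [indicator_of_mem ht]; exact (hC t ht).trans (le_max_left _ _)
      · rw [indicator_of_notMem ht]; simp
    have h1w : IsWeight (fun _ : ℝ => (1 : ℝ)) := ⟨measurable_const, 1, by simp⟩
    have z1 := hflux.integral_residual hf hH.x_ux hH.y_uy i j h1w h1w
    have z2 := hflux.integral_residual hf hH.x_ux hH.y_uy i j
      (hb (a := M.x i.castSucc) (b := M.x i.succ) (M.xm i)) h1w
    have z3 := hflux.integral_residual hf hH.x_ux hH.y_uy i j h1w
      (hb (a := M.y j.castSucc) (b := M.y j.succ) (M.ym j))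
    set R := residual (a11 i j) (a22 i j) f uxx uyy with hR
    have hRL : MemLp R 2 muOmega := by
      have := (hf.add (hH.x_ux.2.1.const_mul (a11 i j))).add (hH.y_uy.2.1.const_mul (a22 i j))
      exact this
    have z2' : ∫ p in M.elem i j, R p * (p.1 - M.xm i) = 0 := by
      rw [← z2]
      refine setIntegral_congr_fun (measurableSet_elem M i j) fun p hp => ?_
      simp only [indicator_of_mem hp.1]; ring
    have z3' : ∫ p in M.elem i j, R p * (p.2 - M.ym j) = 0 := by
      rw [← z3]
      refine setIntegral_congr_fun (measurableSet_elem M i j) fun p hp => ?_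
      simp only [indicator_of_mem hp.2]; ring
    simp only [one_mul] at z1
    have hRi : Integrable R (volume.restrict (M.elem i j)) := by
      simpa using i1 hRL (p := fun _ => 1) (by fun_prop)
    have e : ∫ p in M.elem i j, R p * (α - β * M.xm i + β * p.1) =
        α * (∫ p in M.elem i j, R p) + β * ∫ p in M.elem i j, R p * (p.1 - M.xm i) := by
      rw [← integral_const_mul, ← integral_const_mul, ← integral_add (hRi.const_mul α)
        ((i1 hRL (p := fun x => x - M.xm i) (by fun_prop)).const_mul β)]
      congr 1; funext p; ring
    rw [split hRL, e, z1, z2', z3']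
    ring
  have iF : ∀ {w : ℝ × ℝ → ℝ}, MemLp w 2 muOmega →
      Integrable (fun p => w p * F p) (volume.restrict (M.elem i j)) := by
    intro w hw
    refine ((i1 hw (p := fun x => α - β * M.xm i + β * x) (by fun_prop)).add
      ((i2 hw (p := fun y => y - M.ym j) (by fun_prop)).const_mul γ)).congr
      (Eventually.of_forall fun p => ?_)
    simp only [Pi.add_apply]; rw [hF]; ring
  have e0 : ∫ p in M.elem i j, residual (a11 i j) (a22 i j) f uxx uyy p * F p =
      (∫ p in M.elem i j, f p * F p) + (a11 i j * (∫ p in M.elem i j, uxx p * F p) +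
        a22 i j * ∫ p in M.elem i j, uyy p * F p) := by
    have j1 := (iF hH.x_ux.2.1).const_mul (a11 i j)
    have j2 := (iF hH.y_uy.2.1).const_mul (a22 i j)
    have j12 : Integrable (fun p => a11 i j * (uxx p * F p) + a22 i j * (uyy p * F p))
        (volume.restrict (M.elem i j)) := j1.add j2
    rw [← integral_const_mul, ← integral_const_mul, ← integral_add j1 j2,
      ← integral_add (iF hf) j12]
    congr 1; funext p; simp only [residual]; ring
  rw [e0, split hH.x_ux.2.1, split' hH.y_uy.2.1] at hres
  rw [hF (M.x i.succ, M.ym j), hF (M.x i.castSucc, M.ym j), hF (M.xm i, M.y j.succ),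
    hF (M.xm i, M.y j.castSucc)]
  simp only [sub_self, mul_zero, add_zero]
  linear_combination hres - a11 i j * ex - a22 i j * ey

end Element

section Element

variable {M : Mesh n m} {ρ Λ κ : ℝ} {a11 a22 : Fin n → Fin m → ℝ}
  {f u ux uy uxx uxy uyy uxxx uxxy uxyy uyyy : ℝ × ℝ → ℝ}

/-- The square of the seminorm of third derivatives on an element. -/
noncomputable def seminormSq (M : Mesh n m) (uxxx uxxy uxyy uyyy : ℝ × ℝ → ℝ) (i : Fin n)
    (j : Fin m) : ℝ :=
  (∫ p in M.elem i j, uxxx p ^ 2) + (∫ p in M.elem i j, uxxy p ^ 2) +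
    (∫ p in M.elem i j, uxyy p ^ 2) + ∫ p in M.elem i j, uyyy p ^ 2

theorem setIntegral_sq_nonneg (s : Set (ℝ × ℝ)) (w : ℝ × ℝ → ℝ) : 0 ≤ ∫ p in s, w p ^ 2 :=
  integral_nonneg fun _ => sq_nonneg _

theorem seminormSq_nonneg (M : Mesh n m) (uxxx uxxy uxyy uyyy : ℝ × ℝ → ℝ) (i : Fin n)
    (j : Fin m) : 0 ≤ seminormSq M uxxx uxxy uxyy uyyy i j := by
  have h := setIntegral_sq_nonneg (M.elem i j)
  have h1 := h uxxx
  have h2 := h uxxy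
  have h3 := h uxyy
  have h4 := h uyyy
  unfold seminormSq
  positivity

theorem IsH3.edgeRules_x (hH : IsH3 u ux uy uxx uxy uyy uxxx uxxy uxyy uyyy) (M : Mesh n m)
    (i : Fin n) (j : Fin m) :
    EdgeRules (M.hx i) (M.hx i * M.hy j)
      (meanV u ux (M.y j.castSucc) (M.y j.succ) (M.x i.castSucc))
      (meanV u ux (M.y j.castSucc) (M.y j.succ) (M.x i.succ))
      (M.Qh i j u)
      (meanV ux uxx (M.y j.castSucc) (M.y j.succ) (M.x i.castSucc))
      (meanV ux uxx (M.y j.castSucc) (M.y j.succ) (M.x i.succ))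
      (M.Qh i j ux) (M.Qh i j uxx)
      (meanV uyy uxyy (M.y j.castSucc) (M.y j.succ) (M.x i.castSucc))
      (meanV uyy uxyy (M.y j.castSucc) (M.y j.succ) (M.x i.succ))
      (M.Qh i j uyy) (M.Qh i j uxyy) (∫ p in M.elem i j, uyy p * (p.1 - M.xm i))
      (seminormSq M uxxx uxxy uxyy uyyy i j) := by
  simp only [Mesh.Qh_eq]
  have h := setIntegral_sq_nonneg (M.elem i j)
  refine edgeRules_of_weakX (M.isRect i j) hH.x_u hH.x_ux hH.x_uxx hH.x_uyy ?_ ?_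
  · change ∫ p in M.elem i j, uxxx p ^ 2 ≤ _
    unfold seminormSq
    linarith [h uxxy, h uxyy, h uyyy]
  · change ∫ p in M.elem i j, uxyy p ^ 2 ≤ _
    unfold seminormSq
    linarith [h uxxx, h uxxy, h uyyy]

/-- Obtained from `edgeRules_x` by reflection; the sum of the four third-derivative terms is
symmetric, so the same `N` serves both directions. -/
theorem IsH3.edgeRules_y (hH : IsH3 u ux uy uxx uxy uyy uxxx uxxy uxyy uyyy) (M : Mesh n m)
    (i : Fin n) (j : Fin m) :
    EdgeRules (M.hy j) (M.hx i * M.hy j)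
      (meanV (fun p => u p.swap) (fun p => uy p.swap) (M.x i.castSucc) (M.x i.succ)
        (M.y j.castSucc))
      (meanV (fun p => u p.swap) (fun p => uy p.swap) (M.x i.castSucc) (M.x i.succ) (M.y j.succ))
      (M.Qh i j u)
      (meanV (fun p => uy p.swap) (fun p => uyy p.swap) (M.x i.castSucc) (M.x i.succ)
        (M.y j.castSucc))
      (meanV (fun p => uy p.swap) (fun p => uyy p.swap) (M.x i.castSucc) (M.x i.succ)
        (M.y j.succ))
      (M.Qh i j uy) (M.Qh i j uyy)
      (meanV (fun p => uxx p.swap) (fun p => uxxy p.swap) (M.x i.castSucc) (M.x i.succ)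
        (M.y j.castSucc))
      (meanV (fun p => uxx p.swap) (fun p => uxxy p.swap) (M.x i.castSucc) (M.x i.succ)
        (M.y j.succ))
      (M.Qh i j uxx) (M.Qh i j uxxy) (∫ p in M.elem i j, uxx p * (p.2 - M.ym j))
      (seminormSq M uxxx uxxy uxyy uyyy i j) := by
  have e := hH.swap.edgeRules_x M.swap j i
  have q : ∀ w : ℝ × ℝ → ℝ, M.swap.Qh j i (fun p => w p.swap) = M.Qh i j w := by
    intro w
    rw [Mesh.Qh_eq, Mesh.Qh_eq, setIntegral_elem_swap, mul_comm]
    rfl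
  have s : ∀ w : ℝ × ℝ → ℝ, ∫ p in M.swap.elem j i, w p.swap ^ 2 = ∫ p in M.elem i j, w p ^ 2 :=
    fun w => setIntegral_elem_swap M i j fun p => w p ^ 2
  have hJ : ∫ p in M.swap.elem j i, uxx p.swap * (p.1 - M.swap.xm j) =
      ∫ p in M.elem i j, uxx p * (p.2 - M.ym j) :=
    setIntegral_elem_swap M i j fun p => uxx p * (p.2 - M.ym j)
  have hN : seminormSq M.swap (fun p => uyyy p.swap) (fun p => uxyy p.swap)
      (fun p => uxxy p.swap) (fun p => uxxx p.swap) j i = seminormSq M uxxx uxxy uxyy uyyy i j := by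
    simp only [seminormSq, s]; ring
  rw [q, q, q, q, q, hJ, hN, mul_comm (M.swap.hx j)] at e
  exact e

theorem grad_error_le (hH : IsH3 u ux uy uxx uxy uyy uxxx uxxy uxyy uyyy) (hρ : 0 < ρ)
    (i : Fin n) (j : Fin m) (h1 : 0 ≤ a11 i j) (h1L : a11 i j ≤ Λ) (h2 : 0 ≤ a22 i j)
    (h2L : a22 i j ≤ Λ) {w : WeakFun n m}
    (hW : w.vV i.castSucc j = perturbedV M ρ a22 u ux uyy uxyy i j (M.x i.castSucc))
    (hE : w.vV i.succ j = perturbedV M ρ a22 u ux uyy uxyy i j (M.x i.succ))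
    (hS : w.vH i j.castSucc = perturbedH M ρ a11 u uy uxx uxxy i j (M.y j.castSucc))
    (hNn : w.vH i j.succ = perturbedH M ρ a11 u uy uxx uxxy i j (M.y j.succ)) :
    M.hx i * M.hy j * ((weakGrad M w i j).1 - M.Qh i j ux) ^ 2 ≤
        gradConst ρ Λ * M.size ^ 4 * seminormSq M uxxx uxxy uxyy uyyy i j ∧
      M.hx i * M.hy j * ((weakGrad M w i j).2 - M.Qh i j uy) ^ 2 ≤
        gradConst ρ Λ * M.size ^ 4 * seminormSq M uxxx uxxy uxyy uyyy i j := by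
  have hX := hH.edgeRules_x M i j
  have hY := hH.edgeRules_y M i j
  have hN := seminormSq_nonneg M uxxx uxxy uxyy uyyy i j
  constructor
  · refine grad_perturbation_le hρ (M.hx_pos i) (M.hy_pos j) (M.hy_le_size i j) h2 h2L hN hX ?_
    rw [hx_mul_weakGrad, hW, hE]
    rfl
  · rw [mul_comm (M.hx i)] at hY ⊢
    refine grad_perturbation_le hρ (M.hy_pos j) (M.hx_pos i) (M.hx_le_size i j) h1 h1L hN hY ?_
    rw [hy_mul_weakGrad, hS, hNn]
    rfl

/-- This is the consistency estimate. The interior part `F` is the affine function with the means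
from `exists_edgeMeans`, and it is fixed before `w` and `v`, so the same `F` works for `v = w -
u_h`. -/
theorem exists_element_estimate (hH : IsH3 u ux uy uxx uxy uyy uxxx uxxy uxyy uyyy)
    (hf : MemLp f 2 muOmega) (hflux : IsFlux M a11 a22 f ux uy) (hρ : 0 < ρ) (hκ : 0 < κ)
    (i : Fin n) (j : Fin m) (h1 : 0 ≤ a11 i j) (h1L : a11 i j ≤ Λ) (h2 : 0 ≤ a22 i j)
    (h2L : a22 i j ≤ Λ) :
    ∃ F : ℝ × ℝ →ᵃ[ℝ] ℝ, ∀ w v : WeakFun n m, w.v0 i j = F →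
      w.vV i.castSucc j = perturbedV M ρ a22 u ux uyy uxyy i j (M.x i.castSucc) →
      w.vV i.succ j = perturbedV M ρ a22 u ux uyy uxyy i j (M.x i.succ) →
      w.vH i j.castSucc = perturbedH M ρ a11 u uy uxx uxxy i j (M.y j.castSucc) →
      w.vH i j.succ = perturbedH M ρ a11 u uy uxx uxxy i j (M.y j.succ) →
      localForm M ρ a11 a22 w v i j ≤ (∫ p in M.elem i j, f p * v.v0 i j p) +
        localFlux M a11 a22 ux uxx uy uyy v i j + κ / 2 * localEnergy M v i j +
        elemConst κ ρ Λ * M.size ^ 4 * seminormSq M uxxx uxxy uxyy uyyy i j := by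
  have hX := hH.edgeRules_x M i j
  have hY := hH.edgeRules_y M i j
  have hN := seminormSq_nonneg M uxxx uxxy uxyy uyyy i j
  have hx0 := M.hx_pos i
  have hy0 := M.hy_pos j
  have hxh := M.hx_le_size i j
  have hyh := M.hy_le_size i j
  obtain ⟨mW, mE, mS, mN, hm, bE, bW, bN, bS⟩ :=
    exists_edgeMeans hρ hx0 hy0 hxh hyh h1 h1L h2 h2L hN hX hY
  obtain ⟨F, fW, fE, fS, fN⟩ := exists_affine_edgeMeans M i j hm
  refine ⟨F, fun w v hw hW hE hS hNn => ?_⟩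
  obtain ⟨gx, gy⟩ := grad_error_le hH hρ i j h1 h1L h2 h2L hW hE hS hNn
  have hload := integral_load hH hf hflux i j (v.v0 i j)
  have g1 := hx_mul_weakGrad M v i j
  have g2 := hy_mul_weakGrad M v i j
  have v1 : v.v0 i j (M.x i.succ, M.ym j) - v.v0 i j (M.x i.castSucc, M.ym j) =
      M.hx i * (v.v0 i j).linear (1, 0) := by
    rw [Mesh.affine_apply (v.v0 i j) (M.x i.succ, M.ym j) (M.x i.castSucc, M.ym j), Mesh.hx]
    ring
  have v2 : v.v0 i j (M.xm i, M.y j.succ) - v.v0 i j (M.xm i, M.y j.castSucc) =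
      M.hy j * (v.v0 i j).linear (0, 1) := by
    rw [Mesh.affine_apply (v.v0 i j) (M.xm i, M.y j.succ) (M.xm i, M.y j.castSucc), Mesh.hy]
    ring
  set β := (v.v0 i j).linear (1, 0)
  set γ := (v.v0 i j).linear (0, 1)
  have half1 := half_residual_le hκ hx0 hy0 hxh h1 h1L h2 h2L hN gx bE bW hX.moment
    (g := (weakGrad M v i j).1) (β := β)
    (bE := v.vV i.succ j - v.v0 i j (M.x i.succ, M.ym j))
    (bW := v.vV i.castSucc j - v.v0 i j (M.x i.castSucc, M.ym j))
    (by linear_combination (-1 : ℝ) * v1 - g1)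
  rw [mul_comm (M.hx i)] at gy
  have half2 := half_residual_le hκ hy0 hx0 hyh h2 h2L h1 h1L hN gy bN bS
    (by rw [mul_comm (M.hy j)]; exact hY.moment)
    (g := (weakGrad M v i j).2) (β := γ)
    (bE := v.vH i j.succ - v.v0 i j (M.xm i, M.y j.succ))
    (bW := v.vH i j.castSucc - v.v0 i j (M.xm i, M.y j.castSucc))
    (by linear_combination (-1 : ℝ) * v2 - g2)
  have hq1 : ∫ p in M.elem i j, ux p = M.hx i * M.hy j * M.Qh i j ux := by
    rw [Mesh.Qh_eq]; field_simp
  have hq2 : ∫ p in M.elem i j, uy p = M.hx i * M.hy j * M.Qh i j uy := by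
    rw [Mesh.Qh_eq]; field_simp
  have hm1 : ∀ t, edgeV ux uxx (M.y j.castSucc) (M.y j.succ) t =
      M.hy j * meanV ux uxx (M.y j.castSucc) (M.y j.succ) t := by
    intro t
    rw [meanV, Mesh.hy, mul_div_cancel₀]
    exact hy0.ne'
  have hm2 : ∀ t, edgeV (fun p => uy p.swap) (fun p => uyy p.swap) (M.x i.castSucc) (M.x i.succ) t =
      M.hx i * meanV (fun p => uy p.swap) (fun p => uyy p.swap) (M.x i.castSucc) (M.x i.succ) t := by
    intro t
    rw [meanV, Mesh.hx, mul_div_cancel₀]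
    exact hx0.ne'
  rw [hq1, hq2] at hload
  simp only [hm1, hm2] at hload
  have rE : edgeResidual ρ M.size (M.hy j) (a22 i j) (a11 i j)
      (meanV u ux (M.y j.castSucc) (M.y j.succ) (M.x i.succ))
      (meanV uyy uxyy (M.y j.castSucc) (M.y j.succ) (M.x i.succ))
      (meanV ux uxx (M.y j.castSucc) (M.y j.succ) (M.x i.succ)) (M.Qh i j ux) mE =
      ρ * M.size⁻¹ * (w.vV i.succ j - w.v0 i j (M.x i.succ, M.ym j)) -
        a11 i j * (meanV ux uxx (M.y j.castSucc) (M.y j.succ) (M.x i.succ) - M.Qh i j ux) := by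
    rw [hE, hw, fE]; rfl
  have rW : edgeResidual ρ M.size (M.hy j) (a22 i j) (-a11 i j)
      (meanV u ux (M.y j.castSucc) (M.y j.succ) (M.x i.castSucc))
      (meanV uyy uxyy (M.y j.castSucc) (M.y j.succ) (M.x i.castSucc))
      (meanV ux uxx (M.y j.castSucc) (M.y j.succ) (M.x i.castSucc)) (M.Qh i j ux) mW =
      ρ * M.size⁻¹ * (w.vV i.castSucc j - w.v0 i j (M.x i.castSucc, M.ym j)) -
        -a11 i j *
          (meanV ux uxx (M.y j.castSucc) (M.y j.succ) (M.x i.castSucc) - M.Qh i j ux) := by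
    rw [hW, hw, fW]; rfl
  have rN : edgeResidual ρ M.size (M.hx i) (a11 i j) (a22 i j)
      (meanV (fun p => u p.swap) (fun p => uy p.swap) (M.x i.castSucc) (M.x i.succ) (M.y j.succ))
      (meanV (fun p => uxx p.swap) (fun p => uxxy p.swap) (M.x i.castSucc) (M.x i.succ)
        (M.y j.succ))
      (meanV (fun p => uy p.swap) (fun p => uyy p.swap) (M.x i.castSucc) (M.x i.succ) (M.y j.succ))
      (M.Qh i j uy) mN =
      ρ * M.size⁻¹ * (w.vH i j.succ - w.v0 i j (M.xm i, M.y j.succ)) -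
        a22 i j * (meanV (fun p => uy p.swap) (fun p => uyy p.swap) (M.x i.castSucc) (M.x i.succ)
          (M.y j.succ) - M.Qh i j uy) := by
    rw [hNn, hw, fN]; rfl
  have rS : edgeResidual ρ M.size (M.hx i) (a11 i j) (-a22 i j)
      (meanV (fun p => u p.swap) (fun p => uy p.swap) (M.x i.castSucc) (M.x i.succ)
        (M.y j.castSucc))
      (meanV (fun p => uxx p.swap) (fun p => uxxy p.swap) (M.x i.castSucc) (M.x i.succ)
        (M.y j.castSucc))
      (meanV (fun p => uy p.swap) (fun p => uyy p.swap) (M.x i.castSucc) (M.x i.succ)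
        (M.y j.castSucc))
      (M.Qh i j uy) mS =
      ρ * M.size⁻¹ * (w.vH i j.castSucc - w.v0 i j (M.xm i, M.y j.castSucc)) -
        -a22 i j * (meanV (fun p => uy p.swap) (fun p => uyy p.swap) (M.x i.castSucc) (M.x i.succ)
          (M.y j.castSucc) - M.Qh i j uy) := by
    rw [hS, hw, fS]; rfl
  rw [rE, rW] at half1
  rw [rN, rS] at half2
  simp only [localForm, localFlux, localEnergy, elemConst, hm1, hm2]
  generalize (∫ p in M.elem i j, f p * v.v0 i j p) = I at *
  generalize (∫ p in M.elem i j, uxx p * (p.2 - M.ym j)) = J₁ at *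
  generalize (∫ p in M.elem i j, uyy p * (p.1 - M.xm i)) = J₂ at *
  -- The means of `ux` and `uy` regroup because the discrete gradient of `v` minus the gradient of
  -- `v_0` is a difference of `v_b - v_0` on opposite edges. This is why edge residuals contain the
  -- flux minus its element mean.
  linear_combination half1 + half2 + (M.hy j * a11 i j * M.Qh i j ux) * (g1 + v1) +
    (M.hx i * a22 i j * M.Qh i j uy) * (g2 + v2) - hload

end Element

/-! ### Boundary values and interior edges -/

section Boundary

variable {M : Mesh n m} {ρ : ℝ} {a11 a22 : Fin n → Fin m → ℝ}
  {u ux uy uxx uxy uyy uxxx uxxy uxyy uyyy : ℝ × ℝ → ℝ} {g G : ℝ × ℝ → ℝ}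

/-- Shows that the boundary data of the method are exactly the perturbed edge values computed from
`u`. -/
theorem QbV_boundary (hH : IsH3 u ux uy uxx uxy uyy uxxx uxxy uxyy uyyy) (k : Fin (n + 1))
    (j : Fin m) (hτ : IsTraceV u (M.x k) fun y => g (M.x k, y))
    (hG : IsWeakSecondDeriv (fun y => g (M.x k, y)) fun y => G (M.x k, y)) :
    M.QbV k j g = meanV u ux (M.y j.castSucc) (M.y j.succ) (M.x k) ∧
      M.QbV k j G = meanV uyy uxyy (M.y j.castSucc) (M.y j.succ) (M.x k) := by
  have h0 := fun κ (hκ : IsWeight κ) => hτ.integral_eq hH.x_u (M.x_mem k) hκ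
  exact ⟨intervalAverage_eq_meanV (M.y_mem _).1 (M.y_lt j) (M.y_mem _).2 h0,
    intervalAverage_eq_meanV (M.y_mem _).1 (M.y_lt j) (M.y_mem _).2 fun κ hκ =>
      integral_secondDeriv_eq h0 hH.y_u hH.y_uy hH.y_ux hH.y_uxy hG hκ⟩

theorem QbH_boundary (hH : IsH3 u ux uy uxx uxy uyy uxxx uxxy uxyy uyyy) (i : Fin n)
    (k : Fin (m + 1)) (hτ : IsTraceH u (M.y k) fun x => g (x, M.y k))
    (hG : IsWeakSecondDeriv (fun x => g (x, M.y k)) fun x => G (x, M.y k)) :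
    M.QbH i k g =
        meanV (fun p => u p.swap) (fun p => uy p.swap) (M.x i.castSucc) (M.x i.succ) (M.y k) ∧
      M.QbH i k G =
        meanV (fun p => uxx p.swap) (fun p => uxxy p.swap) (M.x i.castSucc) (M.x i.succ)
          (M.y k) := by
  have h0 := fun κ (hκ : IsWeight κ) => hτ.integral_eq hH.y_u (M.y_mem k) hκ
  exact ⟨intervalAverage_eq_meanV (M.x_mem _).1 (M.x_lt i) (M.x_mem _).2 h0,
    intervalAverage_eq_meanV (M.x_mem _).1 (M.x_lt i) (M.x_mem _).2 fun κ hκ =>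
      integral_secondDeriv_eq h0 hH.swap.y_u hH.swap.y_uy hH.swap.y_ux hH.swap.y_uxy hG hκ⟩

/-- The edge value depends on the element only through the coefficient; where it jumps, the mean of
`uyy` that it multiplies is zero. -/
theorem perturbedV_single (hX : WeakX uyy uxyy) (i i' : Fin n) (j : Fin m)
    (h : a22 i j ≠ a22 i' j → ∃ τ, IsTraceV uyy (M.x i.succ) τ ∧
      ⨍ t in M.y j.castSucc..M.y j.succ, τ t = 0) :
    perturbedV M ρ a22 u ux uyy uxyy i j (M.x i.succ) =
      perturbedV M ρ a22 u ux uyy uxyy i' j (M.x i.succ) := by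
  by_cases ha : a22 i j = a22 i' j
  · simp only [perturbedV, ha]
  · obtain ⟨τ, hτ, h0⟩ := h ha
    rw [intervalAverage_eq_meanV (M.y_mem _).1 (M.y_lt j) (M.y_mem _).2 fun κ hκ =>
      hτ.integral_eq hX (M.x_mem _) hκ] at h0
    simp only [perturbedV, h0, mul_zero]

theorem perturbedH_single (hY : WeakY uxx uxxy) (i : Fin n) (j j' : Fin m)
    (h : a11 i j ≠ a11 i j' → ∃ τ, IsTraceH uxx (M.y j.succ) τ ∧
      ⨍ s in M.x i.castSucc..M.x i.succ, τ s = 0) :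
    perturbedH M ρ a11 u uy uxx uxxy i j (M.y j.succ) =
      perturbedH M ρ a11 u uy uxx uxxy i j' (M.y j.succ) := by
  by_cases ha : a11 i j = a11 i j'
  · simp only [perturbedH, ha]
  · obtain ⟨τ, hτ, h0⟩ := h ha
    rw [intervalAverage_eq_meanV (M.x_mem _).1 (M.x_lt i) (M.x_mem _).2 fun κ hκ =>
      hτ.integral_eq hY (M.y_mem _) hκ] at h0
    simp only [perturbedH, h0, mul_zero]

end Boundary

/-! ### Summation over the elements -/

/-- The difference of two weak functions. -/
noncomputable def WeakFun.sub (w v : WeakFun n m) : WeakFun n m :=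
  ⟨fun i j => w.v0 i j - v.v0 i j, fun i j => w.vV i j - v.vV i j, fun i j => w.vH i j - v.vH i j⟩

theorem weakGrad_sub (M : Mesh n m) (w v : WeakFun n m) (i : Fin n) (j : Fin m) :
    weakGrad M (w.sub v) i j = weakGrad M w i j - weakGrad M v i j := by
  simp only [weakGrad, WeakFun.sub]
  ext <;> simp <;> ring

theorem localForm_sub (M : Mesh n m) (ρ : ℝ) (a11 a22 : Fin n → Fin m → ℝ)
    (w w' v : WeakFun n m) (i : Fin n) (j : Fin m) :
    localForm M ρ a11 a22 (w.sub w') v i j =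
      localForm M ρ a11 a22 w v i j - localForm M ρ a11 a22 w' v i j := by
  simp only [localForm, weakGrad_sub]
  simp only [WeakFun.sub, Prod.fst_sub, Prod.snd_sub, AffineMap.coe_sub, Pi.sub_apply]
  ring

theorem localEnergy_le (M : Mesh n m) {ρ κ : ℝ} {a11 a22 : Fin n → Fin m → ℝ} (v : WeakFun n m)
    (i : Fin n) (j : Fin m) (hκρ : κ ≤ ρ) (h1 : κ ≤ a11 i j) (h2 : κ ≤ a22 i j) :
    κ * localEnergy M v i j ≤ localForm M ρ a11 a22 v v i j := by
  have hx := M.hx_pos i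
  have hy := M.hy_pos j
  have hs : 0 < M.size := hx.trans_le (M.hx_le_size i j)
  have e1 : κ * (M.hx i * M.hy j * (weakGrad M v i j).1 ^ 2) ≤
      a11 i j * (M.hx i * M.hy j * (weakGrad M v i j).1 ^ 2) := by gcongr
  have e2 : κ * (M.hx i * M.hy j * (weakGrad M v i j).2 ^ 2) ≤
      a22 i j * (M.hx i * M.hy j * (weakGrad M v i j).2 ^ 2) := by gcongr
  have e3 : κ * (M.size⁻¹ * (M.hy j * ((v.vV i.succ j - v.v0 i j (M.x i.succ, M.ym j)) ^ 2 +
      (v.vV i.castSucc j - v.v0 i j (M.x i.castSucc, M.ym j)) ^ 2) +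
    M.hx i * ((v.vH i j.succ - v.v0 i j (M.xm i, M.y j.succ)) ^ 2 +
      (v.vH i j.castSucc - v.v0 i j (M.xm i, M.y j.castSucc)) ^ 2))) ≤
      ρ * (M.size⁻¹ * (M.hy j * ((v.vV i.succ j - v.v0 i j (M.x i.succ, M.ym j)) ^ 2 +
      (v.vV i.castSucc j - v.v0 i j (M.x i.castSucc, M.ym j)) ^ 2) +
    M.hx i * ((v.vH i j.succ - v.v0 i j (M.xm i, M.y j.succ)) ^ 2 +
      (v.vH i j.castSucc - v.v0 i j (M.xm i, M.y j.castSucc)) ^ 2))) := by gcongr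
  unfold localEnergy localForm
  linear_combination e1 + e2 + e3

theorem weakGrad_sq_le_localEnergy (M : Mesh n m) (v : WeakFun n m) (i : Fin n) (j : Fin m) :
    M.hx i * M.hy j * ((weakGrad M v i j).1 ^ 2 + (weakGrad M v i j).2 ^ 2) ≤
      localEnergy M v i j := by
  have hx := M.hx_pos i
  have hy := M.hy_pos j
  have hs : 0 < M.size := hx.trans_le (M.hx_le_size i j)
  unfold localEnergy
  refine le_add_of_nonneg_right ?_
  positivity

/-- The vertical contributions cancel in each row and the horizontal ones in each column, by
continuity of the flux and the vanishing of `v_b` at the two ends. -/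
theorem sum_localFlux {M : Mesh n m} {a11 a22 : Fin n → Fin m → ℝ}
    {f wx wy wxx wyy : ℝ × ℝ → ℝ} (h : IsFlux M a11 a22 f wx wy) (hf : MemLp f 2 muOmega)
    (hx : WeakX wx wxx) (hy : WeakY wy wyy) {v : WeakFun n m} (hv : v.VanishesOnBoundary) :
    ∑ i, ∑ j, localFlux M a11 a22 wx wxx wy wyy v i j = 0 := by
  simp only [localFlux, Finset.sum_add_distrib]
  have hfs : MemLp (fun p => f p.swap) 2 muOmega :=
    hf.comp_measurePreserving measurePreserving_swap_muOmega
  rw [Finset.sum_comm, Finset.sum_eq_zero, zero_add, Finset.sum_eq_zero]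
  · intro i _
    exact h.swap.sum_edgeV hfs hy.swap hx.swap i (fun k => v.vH i k) (hv.2 i).1 (hv.2 i).2
  · intro j _
    exact h.sum_edgeV hf hx hy j (fun k => v.vV k j) (hv.1 j).1 (hv.1 j).2

theorem sum_seminormSq_le (M : Mesh n m) {u : ℝ × ℝ → ℝ} (hu : MemSobolev 3 u) :
    ∑ i, ∑ j, seminormSq M (weakDeriv 3 0 u) (weakDeriv 2 1 u) (weakDeriv 1 2 u)
      (weakDeriv 0 3 u) i j ≤ sobolevNorm 3 u ^ 2 := by
  have hi : ∀ {i j : ℕ}, i + j ≤ 3 → Integrable (fun p => weakDeriv i j u p ^ 2) muOmega :=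
    fun h => (weakDeriv_spec hu h).1.integrable_sq
  have h0 : ∀ i j, 0 ≤ ∫ p in Omega, weakDeriv i j u p ^ 2 := fun i j =>
    setIntegral_sq_nonneg _ _
  simp only [seminormSq, Finset.sum_add_distrib]
  rw [sum_elem M (hi (by norm_num)), sum_elem M (hi (by norm_num)), sum_elem M (hi (by norm_num)),
    sum_elem M (hi (by norm_num)), sobolevNorm, Real.sq_sqrt
      (Finset.sum_nonneg fun i _ => Finset.sum_nonneg fun j _ => h0 i j)]
  simp only [Finset.sum_range_succ, Finset.sum_range_zero, Nat.reduceAdd, Nat.reduceSub, zero_add]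
  change (∫ p in Omega, weakDeriv 3 0 u p ^ 2) + (∫ p in Omega, weakDeriv 2 1 u p ^ 2) +
    (∫ p in Omega, weakDeriv 1 2 u p ^ 2) + (∫ p in Omega, weakDeriv 0 3 u p ^ 2) ≤ _
  linarith [h0 0 0, h0 0 1, h0 0 2, h0 1 0, h0 1 1, h0 2 0]

/-! ### The global estimate and its constant -/

/-- The square of the constant of the error estimate. -/
noncomputable def errorConst (κ ρ Λ : ℝ) : ℝ := 4 * gradConst ρ Λ + 4 * elemConst κ ρ Λ / κ

/-- `κ` is the coercivity constant of the bilinear form. The consistency estimates for `v = w - u_h`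
are summed, the energy of `v` is absorbed, and the triangle inequality passes from `w` to `u`. -/
theorem gradError_sq_le {ρ κ Λ : ℝ} (hρ : 0 < ρ) (hκ : 0 < κ) (hκρ : κ ≤ ρ) {M : Mesh n m}
    {a11 a22 : Fin n → Fin m → ℝ} {f u g gxx gyy : ℝ × ℝ → ℝ} {uh : WeakFun n m}
    (ha : ∀ i j, κ ≤ a11 i j ∧ a11 i j ≤ Λ ∧ κ ≤ a22 i j ∧ a22 i j ≤ Λ)
    (hf : MemLp f 2 muOmega) (hu : MemSobolev 3 u) (hsol : IsWeakSolution M a11 a22 f u)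
    (hg : HasBoundaryValue u g) (hgg : IsTangentialSecondDeriv g gxx gyy)
    (he : EdgeSingleValued M a11 a22 u) (huh : IsWGSolution M ρ a11 a22 f uh)
    (hb : HasPerturbedBoundaryValue M ρ a11 a22 g gxx gyy uh) :
    ∑ i, ∑ j, M.area i j *
      ((M.Qh i j (weakDeriv 1 0 u) - (weakGrad M uh i j).1) ^ 2 +
       (M.Qh i j (weakDeriv 0 1 u) - (weakGrad M uh i j).2) ^ 2) ≤
      errorConst κ ρ Λ * M.size ^ 4 * sobolevNorm 3 u ^ 2 := by
  have hH := hu.isH3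
  have hflux : IsFlux M a11 a22 f (weakDeriv 1 0 u) (weakDeriv 0 1 u) := hsol
  have h1 : ∀ i j, 0 ≤ a11 i j := fun i j => hκ.le.trans (ha i j).1
  have h2 : ∀ i j, 0 ≤ a22 i j := fun i j => hκ.le.trans (ha i j).2.2.1
  choose F hF using fun i j => exists_element_estimate hH hf hflux hρ hκ i j (h1 i j)
    (ha i j).2.1 (h2 i j) (ha i j).2.2.2
  choose pV hpV using fun j => exists_node_values
    (φ := fun i k => perturbedV M ρ a22 u (weakDeriv 1 0 u) (weakDeriv 0 2 u) (weakDeriv 1 2 u)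
      i j (M.x k)) fun i i' hi => perturbedV_single hH.x_uyy i i' j (he.1 i i' j hi)
  choose pH hpH using fun i => exists_node_values
    (φ := fun j k => perturbedH M ρ a11 u (weakDeriv 0 1 u) (weakDeriv 2 0 u) (weakDeriv 2 1 u)
      i j (M.y k)) fun j j' hj => perturbedH_single hH.y_uxx i j j' (he.2 i j j' hj)
  let w : WeakFun n m := ⟨F, fun k j => pV j k, fun i k => pH i k⟩
  let v : WeakFun n m := w.sub uh
  have hv : v.VanishesOnBoundary := by
    -- There is at least one column and one row because the first node `0` differs from the last
    -- node `1`; this makes boundary elements available.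
    have hn : 0 < n := by
      rcases Nat.eq_zero_or_pos n with rfl | h
      · exact absurd (M.x_zero.symm.trans M.x_last) zero_ne_one
      · exact h
    have hm : 0 < m := by
      rcases Nat.eq_zero_or_pos m with rfl | h
      · exact absurd (M.y_zero.symm.trans M.y_last) zero_ne_one
      · exact h
    obtain ⟨n, rfl⟩ := Nat.exists_eq_succ_of_ne_zero hn.ne'
    obtain ⟨m, rfl⟩ := Nat.exists_eq_succ_of_ne_zero hm.ne'
    have x0 := M.x_zero
    have x1 := M.x_last
    have y0 := M.y_zero
    have y1 := M.y_last
    refine ⟨fun j => ⟨?_, ?_⟩, fun i => ⟨?_, ?_⟩⟩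
    · have q := QbV_boundary (M := M) (g := g) (G := gyy) hH 0 j (by rw [x0]; exact hg.1)
        (by rw [x0]; exact hgg.1 0 (Or.inl rfl))
      have e := hb.1 0 j 0 (Or.inl ⟨rfl, rfl⟩)
      rw [q.1, q.2] at e
      exact sub_eq_zero.2 (((hpV j 0).1).trans e.symm)
    · have q := QbV_boundary (M := M) (g := g) (G := gyy) hH (Fin.last _) j
        (by rw [x1]; exact hg.2.1) (by rw [x1]; exact hgg.1 1 (Or.inr rfl))
      have e := hb.1 (Fin.last n) j (Fin.last _) (Or.inr ⟨rfl, rfl⟩)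
      rw [q.1, q.2] at e
      exact sub_eq_zero.2 (((hpV j (Fin.last n)).2).trans e.symm)
    · have q := QbH_boundary (M := M) (g := g) (G := gxx) hH i 0 (by rw [y0]; exact hg.2.2.1)
        (by rw [y0]; exact hgg.2 0 (Or.inl rfl))
      have e := hb.2 i 0 0 (Or.inl ⟨rfl, rfl⟩)
      rw [q.1, q.2] at e
      exact sub_eq_zero.2 (((hpH i 0).1).trans e.symm)
    · have q := QbH_boundary (M := M) (g := g) (G := gxx) hH i (Fin.last _)
        (by rw [y1]; exact hg.2.2.2) (by rw [y1]; exact hgg.2 1 (Or.inr rfl))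
      have e := hb.2 i (Fin.last m) (Fin.last _) (Or.inr ⟨rfl, rfl⟩)
      rw [q.1, q.2] at e
      exact sub_eq_zero.2 (((hpH i (Fin.last m)).2).trans e.symm)
  set N : Fin n → Fin m → ℝ := seminormSq M (weakDeriv 3 0 u) (weakDeriv 2 1 u) (weakDeriv 1 2 u)
    (weakDeriv 0 3 u) with hN
  have hNs : ∑ i, ∑ j, N i j ≤ sobolevNorm 3 u ^ 2 := sum_seminormSq_le M hu
  set K := elemConst κ ρ Λ with hK
  have hK0 : 0 ≤ K := by
    simp only [hK, elemConst, gradConst, edgeConst]; positivity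
  have hG0 : 0 ≤ gradConst ρ Λ := by unfold gradConst; positivity
  have hest : ∀ i j, localForm M ρ a11 a22 w v i j ≤ (∫ p in M.elem i j, f p * v.v0 i j p) +
      localFlux M a11 a22 (weakDeriv 1 0 u) (weakDeriv 2 0 u) (weakDeriv 0 1 u) (weakDeriv 0 2 u)
        v i j + κ / 2 * localEnergy M v i j + K * M.size ^ 4 * N i j := fun i j =>
    hF i j w v rfl (hpV j i).1 (hpV j i).2 (hpH i j).1 (hpH i j).2
  have hsum := Finset.sum_le_sum fun i (_ : i ∈ Finset.univ) =>
    Finset.sum_le_sum fun j (_ : j ∈ Finset.univ) => hest i j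
  simp only [Finset.sum_add_distrib, ← Finset.mul_sum] at hsum
  -- The load is replaced by the form at `u_h`, so the left side minus this term is the form at `(v,
  -- v)`.
  rw [sum_localFlux hflux hf hH.x_ux hH.y_uy hv, ← huh v hv, form_eq_sum] at hsum
  have hlow := Finset.sum_le_sum fun i (_ : i ∈ Finset.univ) =>
    Finset.sum_le_sum fun j (_ : j ∈ Finset.univ) =>
      localEnergy_le M (a11 := a11) (a22 := a22) v i j hκρ (ha i j).1 (ha i j).2.2.1
  have hlin : ∑ i, ∑ j, localForm M ρ a11 a22 v v i j =
      ∑ i, ∑ j, localForm M ρ a11 a22 w v i j - ∑ i, ∑ j, localForm M ρ a11 a22 uh v i j := by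
    rw [← Finset.sum_sub_distrib]
    refine Finset.sum_congr rfl fun i _ => ?_
    rw [← Finset.sum_sub_distrib]
    exact Finset.sum_congr rfl fun j _ => localForm_sub M ρ a11 a22 w uh v i j
  rw [hlin] at hlow
  simp only [← Finset.mul_sum] at hlow
  -- Coercivity gives `κ` times the energy from below and the estimate `κ / 2` times it from above;
  -- half is absorbed.
  have hE : ∑ i, ∑ j, localEnergy M v i j ≤ 2 * K / κ * M.size ^ 4 * ∑ i, ∑ j, N i j := by
    have : κ / 2 * ∑ i, ∑ j, localEnergy M v i j ≤ K * M.size ^ 4 * ∑ i, ∑ j, N i j := by linarith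
    rw [show 2 * K / κ * M.size ^ 4 * ∑ i, ∑ j, N i j =
      (K * M.size ^ 4 * ∑ i, ∑ j, N i j) / (κ / 2) by field_simp, le_div_iff₀ (by positivity)]
    linarith
  have hloc : ∀ i j, M.area i j *
      ((M.Qh i j (weakDeriv 1 0 u) - (weakGrad M uh i j).1) ^ 2 +
       (M.Qh i j (weakDeriv 0 1 u) - (weakGrad M uh i j).2) ^ 2) ≤
      4 * gradConst ρ Λ * M.size ^ 4 * N i j + 2 * localEnergy M v i j := by
    intro i j
    obtain ⟨b1, b2⟩ := grad_error_le (M := M) (w := w) hH hρ i j (h1 i j) (ha i j).2.1 (h2 i j)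
      (ha i j).2.2.2 (hpV j i).1 (hpV j i).2 (hpH i j).1 (hpH i j).2
    have b3 := weakGrad_sq_le_localEnergy M v i j
    rw [show weakGrad M v i j = weakGrad M w i j - weakGrad M uh i j from weakGrad_sub M w uh i j]
      at b3
    have hA : 0 < M.hx i * M.hy j := mul_pos (M.hx_pos i) (M.hy_pos j)
    have sq2 : ∀ q a b : ℝ, (q - b) ^ 2 ≤ 2 * (a - q) ^ 2 + 2 * (a - b) ^ 2 := fun q a b => by
      linarith [sq_nonneg (2 * a - q - b)]
    have c1 := mul_le_mul_of_nonneg_left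
      (sq2 (M.Qh i j (weakDeriv 1 0 u)) (weakGrad M w i j).1 (weakGrad M uh i j).1) hA.le
    have c2 := mul_le_mul_of_nonneg_left
      (sq2 (M.Qh i j (weakDeriv 0 1 u)) (weakGrad M w i j).2 (weakGrad M uh i j).2) hA.le
    simp only [Prod.fst_sub, Prod.snd_sub] at b3
    rw [Mesh.area]
    linarith
  calc _ ≤ ∑ i, ∑ j, (4 * gradConst ρ Λ * M.size ^ 4 * N i j + 2 * localEnergy M v i j) :=
        Finset.sum_le_sum fun i _ => Finset.sum_le_sum fun j _ => hloc i j
    _ = 4 * gradConst ρ Λ * M.size ^ 4 * (∑ i, ∑ j, N i j) +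
          2 * ∑ i, ∑ j, localEnergy M v i j := by
        simp only [Finset.sum_add_distrib, ← Finset.mul_sum]
    _ ≤ 4 * gradConst ρ Λ * M.size ^ 4 * (∑ i, ∑ j, N i j) +
          2 * (2 * K / κ * M.size ^ 4 * ∑ i, ∑ j, N i j) := by gcongr
    _ = errorConst κ ρ Λ * M.size ^ 4 * ∑ i, ∑ j, N i j := by unfold errorConst; ring
    _ ≤ errorConst κ ρ Λ * M.size ^ 4 * sobolevNorm 3 u ^ 2 := by
        have : 0 ≤ errorConst κ ρ Λ := by unfold errorConst; positivity
        gcongr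

end WG

theorem mainTheorem2 (ρ lam Lam : ℝ) (hρ : 0 < ρ) (hlam : 0 < lam) :
    ∃ C : ℝ, 0 < C ∧
      ∀ (n m : ℕ) (M : WG.Mesh n m) (a11 a22 : Fin n → Fin m → ℝ)
        (f u g gxx gyy : ℝ × ℝ → ℝ) (uh : WG.WeakFun n m),
        (∀ i j, lam ≤ a11 i j ∧ a11 i j ≤ Lam ∧ lam ≤ a22 i j ∧ a22 i j ≤ Lam) →
        MemLp f 2 WG.muOmega →
        WG.MemSobolev 3 u →
        WG.IsWeakSolution M a11 a22 f u →
        WG.HasBoundaryValue u g →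
        WG.IsTangentialSecondDeriv g gxx gyy →
        WG.EdgeSingleValued M a11 a22 u →
        WG.IsWGSolution M ρ a11 a22 f uh →
        WG.HasPerturbedBoundaryValue M ρ a11 a22 g gxx gyy uh →
        WG.gradError M u uh ≤ C * M.size ^ 2 * WG.sobolevNorm 3 u := by
  -- The diffusion part is coercive with constant `lam`, the stabilizer with constant `ρ`.
  have hκ : 0 < min lam ρ := lt_min hlam hρ
  -- The summand `1` only serves to make the constant strictly positive.
  refine ⟨Real.sqrt (WG.errorConst (min lam ρ) ρ Lam) + 1, by positivity, ?_⟩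
  intro n m M a11 a22 f u g gxx gyy uh ha hf hu hsol hg hgg he huh hb
  have ha' : ∀ i j, min lam ρ ≤ a11 i j ∧ a11 i j ≤ Lam ∧ min lam ρ ≤ a22 i j ∧ a22 i j ≤ Lam :=
    fun i j => ⟨(min_le_left _ _).trans (ha i j).1, (ha i j).2.1,
      (min_le_left _ _).trans (ha i j).2.2.1, (ha i j).2.2.2⟩
  have h := WG.gradError_sq_le hρ hκ (min_le_right _ _) ha' hf hu hsol hg hgg he huh hb
  have hS : 0 ≤ WG.sobolevNorm 3 u := Real.sqrt_nonneg _
  -- `Lam` enters only through squares, so its sign is irrelevant here.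
  have hc : 0 ≤ WG.errorConst (min lam ρ) ρ Lam := by
    unfold WG.errorConst WG.elemConst WG.gradConst WG.edgeConst
    positivity
  calc WG.gradError M u uh
      ≤ Real.sqrt (WG.errorConst (min lam ρ) ρ Lam * M.size ^ 4 * WG.sobolevNorm 3 u ^ 2) :=
        Real.sqrt_le_sqrt h
    _ = Real.sqrt (WG.errorConst (min lam ρ) ρ Lam) * M.size ^ 2 * WG.sobolevNorm 3 u := by
        rw [show WG.errorConst (min lam ρ) ρ Lam * M.size ^ 4 * WG.sobolevNorm 3 u ^ 2 =
          WG.errorConst (min lam ρ) ρ Lam * (M.size ^ 2 * WG.sobolevNorm 3 u) ^ 2 by ring,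
          Real.sqrt_mul hc, Real.sqrt_sq (by positivity)]
        ring
    _ ≤ (Real.sqrt (WG.errorConst (min lam ρ) ρ Lam) + 1) * M.size ^ 2 *
          WG.sobolevNorm 3 u := by
        gcongr
        linarith
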